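/- Fix $\kappa,\alpha\in(0,1)$ and $\lambda>0$. Model. For each $n$ let $K=K_n$ satisfy $K/n\to\kappa$, and let $p=a/n$, $q=b/n$ with constants $a>b>0$. A hidden community $S\subset\{1,\dots,n\}$ is uniform among the sets of size $K$; write $\sigma_i=\mathbf 1(i\in S)$. Given $S$, the edges of the graph $G$ are independent, an edge $\{i,j\}$ being present with probability $p$ if $i,j\in S$ and $q$ otherwise; independently of $G$, each node of $S$ is declared a cue ($c_i=1$) independently with probability $\alpha$, and no node outside $S$ is a cue (perfect side-information). Let $C=\{i: c_i=1\}$ and let $\delta i$ be the set of neighbours of $i$. Messages. Put $\upsilon=\log\frac{n-K}{K(1-\alpha)}$. The belief propagation messages are $R^0_{i\to u}=0$ and $$R^{t+1}_{i\to u}=-K(p-q)+\sum_{l\in\delta i\cap C,\,l\ne u}\log\frac pq+\sum_{l\in\delta i\setminus C,\,l\neq u}\log\frac{e^{R^t_{l\to i}-\upsilon}\,(p/q)+1}{e^{R^t_{l\to i}-\upsilon}+1}.$$ For $x\in\{0,1\}$ and $t\ge 0$, let $\xi_x^{t}$ (depending on $a,b,\kappa,\alpha$) denote the limit in distribution, as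 $n\to\infty$, of $\widetilde R^t_{i\to u}=R^t_{i\to u}-\upsilon$ conditioned on $\sigma_i=x$, $c_i=0$ (for adjacent nodes $i,u$ which are not cues). These limits exist for all $a>b>0$ and do not depend on the choice of the sequence $K_n$. Large degrees. Let $a,b\to\infty$ with $a>b$, while $\kappa$, $\alpha$ and the effective signal-to-noise ratio $$\lambda_\alpha=\frac{\kappa^2(a-b)^2(1-\alpha)^2}{(1-\kappa)b}=\lambda$$ are held fixed. Then for every $t\ge 0$, $$\xi_0^{t+1}\xrightarrow{D}\mathcal N\!\left(-\log\frac{1-\kappa}{\kappa(1-\alpha)}-\frac12\mu^{(t+1)},\ \mu^{(t+1)}\right),\qquad \xi_1^{t+1}\xrightarrow{D}\mathcal N\!\left(-\log\frac{1-\kappa}{\kappa(1-\alpha)}+\frac12\mu^{(t+1)},\ \mu^{(t+1)}\right),$$ where $\mu^{(0)}=0$ and $$\mu^{(t+1)}=\lambda_\alpha\,\alpha\,\frac{1-\kappa}{(1-\alpha)^2\kappa}+\lambda_\alpha\,\mathbb E\left[\frac{1-\kappa}{\kappa(1-\alpha)+(1-\kappa)\exp\!\left(-\mu^{(t)}/2-\sqrt{\mu^{(t)}}\,Z\right)}\right],\qquad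 Z\sim\mathcal N(0,1).$$ -/

import Mathlib

open MeasureTheory ProbabilityTheory Filter Topology
open scoped BoundedContinuousFunction ENNReal NNReal

noncomputable section

/-- A realization of the hidden community model on `n` nodes with cues:
the hidden community `S`, the set of cues `C`, and the observed graph. -/
@[ext] structure Config (n : ℕ) where
  community : Finset (Fin n)
  cues : Finset (Fin n)
  graph : SimpleGraph (Fin n)

instance (n : ℕ) : MeasurableSpace (Config n) := ⊤

open Classical in
/-- Probability that node `i` has its actual cue status given its community label, under perfect
side-information: a community node is a cue with probability `α`, other nodes never are. -/
def cueWeight {n : ℕ} (α : ℝ) (ω : Config n) (i : Fin n) : ℝ :=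
  if i ∈ ω.community then (if i ∈ ω.cues then α else 1 - α)
  else (if i ∈ ω.cues then 0 else 1)

open Classical in
/-- Probability that the pair `i, j` has its actual adjacency status given the community:
an edge is present with probability `p` inside the community and `q` otherwise. -/
def edgeWeight {n : ℕ} (p q : ℝ) (ω : Config n) (i j : Fin n) : ℝ :=
  let r := if i ∈ ω.community ∧ j ∈ ω.community then p else q
  if ω.graph.Adj i j then r else 1 - r

/-- Joint probability of a configuration: `S` is uniform among the sets of size `K`; given `S`,
cues and edges are all independent. -/
def configWeight {n : ℕ} (K : ℕ) (p q α : ℝ) (ω : Config n) : ℝ :=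
  (if ω.community.card = K then ((n.choose K : ℕ) : ℝ)⁻¹ else 0) *
    (∏ i, cueWeight α ω i) * ∏ i, ∏ j ∈ Finset.Ioi i, edgeWeight p q ω i j

/-- The law of `(S, C, G)` in the model `G(K, n, p, q)` with perfect side-information
(a probability measure when `K ≤ n` and `p, q, α ∈ [0, 1]`). -/
def communityMeasure (n K : ℕ) (p q α : ℝ) : Measure (Config n) :=
  Measure.sum fun ω : Config n => ENNReal.ofReal (configWeight K p q α ω) • Measure.dirac ω

/-- `υ = log ((n - K) / (K (1 - α)))`, the prior log-odds of not belonging to the community,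
given not being a cue. -/
def priorLogOdds (n K : ℕ) (α : ℝ) : ℝ :=
  Real.log (((n : ℝ) - K) / (K * (1 - α)))

open Classical in
/-- The belief propagation message `R^t_{i → u}` with perfect side-information. -/
def bpMessage {n : ℕ} (K : ℕ) (p q α : ℝ) (ω : Config n) : ℕ → Fin n → Fin n → ℝ
  | 0, _, _ => 0
  | t + 1, i, u =>
      -(K : ℝ) * (p - q)
        + ∑ l with ω.graph.Adj i l ∧ l ∈ ω.cues ∧ l ≠ u, Real.log (p / q)
        + ∑ l with ω.graph.Adj i l ∧ l ∉ ω.cues ∧ l ≠ u,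
            Real.log
              ((Real.exp (bpMessage K p q α ω t l i - priorLogOdds n K α) * (p / q) + 1) /
                (Real.exp (bpMessage K p q α ω t l i - priorLogOdds n K α) + 1))

/-- The message in posterior form, `R^t_{i → u} - υ`. -/
def posteriorMessage {n : ℕ} (K : ℕ) (p q α : ℝ) (ω : Config n) (t : ℕ) (i u : Fin n) : ℝ :=
  bpMessage K p q α ω t i u - priorLogOdds n K α

/-- The event that a message passes from `i` to `u` (they are adjacent and neither is a cue)
and the sender `i` has community label `x` (`true` for label `1`, `false` for label `0`). -/
def messageEvent {n : ℕ} (x : Bool) (i u : Fin n) : Set (Config n) :=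
  {ω | ω.graph.Adj i u ∧ i ∉ ω.cues ∧ u ∉ ω.cues ∧ (i ∈ ω.community ↔ x = true)}

/-- `ν` is the law of `ξ_x^t`: the limit in distribution, as `n → ∞` with `K / n → κ`, `p = a / n`
and `q = b / n`, of the posterior message `R^t_{i → u} - υ` conditioned on the sender `i` being
uncued with label `x`.  The limit is uniform over the pair of nodes. -/
def IsLimitingMessageLaw (κ α a b : ℝ) (x : Bool) (t : ℕ) (ν : ProbabilityMeasure ℝ) : Prop :=
  ∀ K : ℕ → ℕ, Tendsto (fun n => (K n : ℝ) / n) atTop (𝓝 κ) →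
    ∀ φ : ℝ →ᵇ ℝ, ∀ ε > 0, ∀ᶠ n : ℕ in atTop, ∀ i u : Fin n, i ≠ u →
      |(∫ ω, φ (posteriorMessage (K n) (a / n) (b / n) α ω t i u)
          ∂(communityMeasure n (K n) (a / n) (b / n) α)[|messageEvent x i u])
        - ∫ y, φ y ∂(ν : Measure ℝ)| < ε

/-- The effective signal-to-noise ratio `λ_α`. -/
def effectiveSNR (κ α a b : ℝ) : ℝ :=
  κ ^ 2 * (a - b) ^ 2 * (1 - α) ^ 2 / ((1 - κ) * b)

/-- The regime `a, b → ∞` with `a > b` and `λ_α` held fixed at the value `lam`. -/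
def largeDegreeRegime (κ α lam : ℝ) : Filter (ℝ × ℝ) :=
  (atTop ×ˢ atTop) ⊓ 𝓟 {ab | ab.2 < ab.1 ∧ effectiveSNR κ α ab.1 ab.2 = lam}

/-- The variances `μ^{(t)}`. -/
def messageVariance (κ α lam : ℝ) : ℕ → ℝ
  | 0 => 0
  | t + 1 =>
      lam * α * ((1 - κ) / ((1 - α) ^ 2 * κ))
        + lam * ∫ z, (1 - κ) / (κ * (1 - α) + (1 - κ) *
            Real.exp (-(messageVariance κ α lam t) / 2 - √(messageVariance κ α lam t) * z))
          ∂(gaussianReal 0 1)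

lemma messageVariance_nonneg {κ α lam : ℝ} (hκ0 : 0 < κ) (hκ1 : κ < 1) (hα0 : 0 < α) (hα1 : α < 1)
    (hlam : 0 < lam) (t : ℕ) : 0 ≤ messageVariance κ α lam t := by
  have h1 : 0 < 1 - κ := by linarith
  have h2 : 0 < 1 - α := by linarith
  cases t with
  | zero => simp [messageVariance]
  | succ t =>
    rw [messageVariance]
    have h : 0 ≤ ∫ z, (1 - κ) / (κ * (1 - α) + (1 - κ) *
            Real.exp (-(messageVariance κ α lam t) / 2 - √(messageVariance κ α lam t) * z))
          ∂(gaussianReal 0 1) := integral_nonneg fun z => by positivity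
    positivity

/-- The Gaussian law with mean `m` and variance `v ≥ 0`. -/
def gaussianLaw (m v : ℝ) : ProbabilityMeasure ℝ :=
  ⟨gaussianReal m v.toNNReal, inferInstance⟩

end

/-! Two limits are taken in turn. For fixed `a > b` and `n → ∞` the sparse graph is locally a tree:
a message is a drift plus jumps from an asymptotically Poisson set of neighbours, whose own messages
are asymptotically independent. The limit `messageLaw` is therefore a shifted compound Poisson law,
with jump intensity built from the laws one level below. To prove convergence, belief propagation is
replaced by `saMessage`, computed along self-avoiding paths. Given the community, it is exactly
independent of all edges at the excluded nodes, and it differs from the true message only if some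
walk meets its own past, an event controlled by `returnCount`, of mean `O(1/n)`. The induction on
`t` alternates between two statements. Asymptotic independence of two messages (`PairLimit`) gives
concentration of empirical averages by a second moment computation (`PairLimit.empirical`). Once
these averages are nearly deterministic, averaging over the fresh edges of two nodes gives products
`∏ (1 + r h)`, which Poisson approximation turns into compound Poisson characteristic functions,
that is, `PairLimit` at `t + 1` (`EmpiricalLimit.pair_charFun`, `PairLimit.succ`). Conditioning on
the message event is done last, in `eventually_condMean_message`. For large degrees the
characteristic exponent is expanded in `δ = a / b - 1`. The regime fixes `b δ²`, so third order
terms are `O(δ)`. The decisive fact is that a message is a log-likelihood ratio: up to the prior,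
`e^r` is the density of the label-1 law with respect to the label-0 law
(`isPosteriorPair_messageLaw`). Hence the first order term for label 0 is exactly `κ(a - b)` and
cancels the divergent drift, while the second order term depends only on the label-1 mean of the
posterior weight. For label 1 the excess rate `a - b` moves the mean up by a full variance, from
`-μ/2` to `+μ/2`. The Gaussian limit at level `t` thus determines the variance at level `t + 1`,
which is the stated recursion. -/

noncomputable section
open scoped Nat

/-! ### Compound Poisson laws and the limiting message laws. -/

/-- The `k`-fold convolution power of a measure on `ℝ`. -/
def convPow (M : Measure ℝ) : ℕ → Measure ℝ
  | 0 => Measure.dirac 0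
  | k + 1 => Measure.conv M (convPow M k)

instance (M : Measure ℝ) [IsFiniteMeasure M] (k : ℕ) : IsFiniteMeasure (convPow M k) := by
  induction k with
  | zero => rw [convPow]; infer_instance
  | succ k ih => rw [convPow]; infer_instance

/-- The compound Poisson law with intensity measure `M`. -/
def compoundPoisson (M : Measure ℝ) : Measure ℝ :=
  Measure.sum fun k : ℕ => ENNReal.ofReal (Real.exp (-M.real Set.univ) / k !) • convPow M k

lemma integral_convPow {𝕜 : Type*} [RCLike 𝕜] (M : Measure ℝ) [IsFiniteMeasure M] {f : ℝ → 𝕜}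
    (hf0 : f 0 = 1) (hfadd : ∀ x y, f (x + y) = f x * f y) (hfm : Measurable f)
    (hf : Integrable f M) (k : ℕ) :
    Integrable f (convPow M k) ∧ ∫ y, f y ∂convPow M k = (∫ y, f y ∂M) ^ k := by
  induction k with
  | zero =>
    refine ⟨?_, by simp [convPow, hf0]⟩
    rw [convPow]
    exact integrable_dirac (by simp)
  | succ k ih =>
    have hadd : Integrable (fun p : ℝ × ℝ => f (p.1 + p.2)) (M.prod (convPow M k)) := by
      simp_rw [hfadd]
      exact hf.mul_prod ih.1
    rw [convPow]
    refine ⟨?_, ?_⟩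
    · rw [Measure.conv]
      exact (integrable_map_measure hfm.aestronglyMeasurable (by fun_prop)).2 hadd
    · rw [Measure.conv, integral_map (by fun_prop) hfm.aestronglyMeasurable]
      simp_rw [hfadd]
      rw [integral_prod_mul f f, ih.2, pow_succ']

/-- Multiplicative functions are allowed beyond unimodular characters because the likelihood-ratio
identity compares transforms at `z` and `z + 1`, which involves real exponential moments. -/
lemma integral_compoundPoisson (M : Measure ℝ) [IsFiniteMeasure M] {f : ℝ → ℂ}
    (hf0 : f 0 = 1) (hfadd : ∀ x y, f (x + y) = f x * f y) (hfm : Measurable f)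
    (hf : Integrable f M) :
    Integrable f (compoundPoisson M) ∧
      ∫ y, f y ∂compoundPoisson M = Complex.exp (∫ y, (f y - 1) ∂M) := by
  -- The norm of `f` is multiplicative too, so its integrals over the convolution powers are powers,
  -- and the exponential series gives absolute integrability.
  have hn := integral_convPow (𝕜 := ℝ) M (f := fun y => ‖f y‖) (by simp [hf0])
    (fun x y => by simp [hfadd]) hfm.norm hf.norm
  have hc := integral_convPow M hf0 hfadd hfm hf
  have hpos : ∀ k : ℕ, 0 ≤ Real.exp (-M.real Set.univ) / k ! := fun k => by positivity
  have hint : Integrable f (compoundPoisson M) := by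
    refine integrable_sum_measure (fun k => (hc k).1.smul_measure ENNReal.ofReal_ne_top) ?_
    simp_rw [integral_smul_measure, (hn _).2, ENNReal.toReal_ofReal (hpos _), smul_eq_mul,
      div_mul_eq_mul_div, mul_div_assoc]
    exact (Real.summable_pow_div_factorial _).mul_left _
  refine ⟨hint, ?_⟩
  rw [compoundPoisson, integral_sum_measure hint]
  simp_rw [integral_smul_measure, (hc _).2, ENNReal.toReal_ofReal (hpos _)]
  rw [integral_sub hf (integrable_const _)]
  have h := (NormedSpace.expSeries_div_hasSum_exp (∫ y, f y ∂M)).mul_left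
    (Complex.exp (-(M.real Set.univ : ℝ)))
  rw [← Complex.exp_eq_exp_ℂ, ← Complex.exp_add] at h
  rw [integral_const, sub_eq_neg_add]
  simp only [Complex.real_smul, mul_one]
  rw [← h.tsum_eq]
  congr with k
  push_cast
  ring

instance (M : Measure ℝ) [IsFiniteMeasure M] : IsProbabilityMeasure (compoundPoisson M) := by
  have h := (integral_compoundPoisson M (f := fun _ => 1) rfl (by simp) measurable_const
    (integrable_const _)).2
  simp only [integral_const, sub_self, smul_zero, Complex.exp_zero, Complex.real_smul, mul_one,
    Complex.ofReal_eq_one] at h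
  exact ⟨(ENNReal.toReal_eq_one_iff _).1 h⟩

/-- The logarithmic likelihood ratio carried by a message with posterior value `r`. -/
def messageJump (ρ r : ℝ) : ℝ := Real.log ((Real.exp r * ρ + 1) / (Real.exp r + 1))

lemma exp_messageJump {ρ : ℝ} (hρ : 0 < ρ) (r : ℝ) :
    Real.exp (messageJump ρ r) = (Real.exp r * ρ + 1) / (Real.exp r + 1) :=
  Real.exp_log (by positivity)

lemma continuous_messageJump {ρ : ℝ} (hρ : 0 < ρ) : Continuous (messageJump ρ) := by
  unfold messageJump
  refine Continuous.log (Continuous.div (by fun_prop) (by fun_prop) fun r => ?_) fun r => ?_ <;>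
  positivity

lemma messageJump_mem {ρ : ℝ} (hρ : 1 ≤ ρ) (r : ℝ) :
    messageJump ρ r ∈ Set.Icc 0 (Real.log ρ) := by
  have h0 : 0 < ρ := by linarith
  have hr := Real.exp_pos r
  constructor
  · refine Real.log_nonneg ?_
    rw [le_div_iff₀ (by positivity)]
    nlinarith
  · refine Real.log_le_log (by positivity) ?_
    rw [div_le_iff₀ (by positivity)]
    nlinarith

/-- The rate of edges joining a node with label `x` to community nodes. -/
def communityRate (a b : ℝ) (x : Bool) : ℝ := if x then a else b

/-- The intensity measure of the jumps contributing to a message sent by a node with label `x`,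
when the messages it receives have laws `ν₁` and `ν₀`. -/
def jumpIntensity (κ α a b : ℝ) (x : Bool) (ν₁ ν₀ : Measure ℝ) : Measure ℝ :=
  ENNReal.ofReal (communityRate a b x * (κ * α)) • Measure.dirac (Real.log (a / b)) +
    ENNReal.ofReal (communityRate a b x * (κ * (1 - α))) • ν₁.map (messageJump (a / b)) +
    ENNReal.ofReal (b * (1 - κ)) • ν₀.map (messageJump (a / b))

instance (κ α a b : ℝ) (x : Bool) (ν₁ ν₀ : Measure ℝ) [IsFiniteMeasure ν₁] [IsFiniteMeasure ν₀] :
    IsFiniteMeasure (jumpIntensity κ α a b x ν₁ ν₀) := by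
  have h (r : ℝ) (ν : Measure ℝ) [IsFiniteMeasure ν] : IsFiniteMeasure (ENNReal.ofReal r • ν) :=
    Measure.smul_finite _ ENNReal.ofReal_ne_top
  unfold jumpIntensity
  infer_instance

/-- The limiting prior log-odds. -/
def limitLogOdds (κ α : ℝ) : ℝ := Real.log ((1 - κ) / (κ * (1 - α)))

/-- The limiting law of the posterior message sent by a node with label `x`. -/
def messageLaw (κ α a b : ℝ) : ℕ → Bool → Measure ℝ
  | 0, _ => Measure.dirac (-limitLogOdds κ α)
  | t + 1, x => (compoundPoisson (jumpIntensity κ α a b x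
      (messageLaw κ α a b t true) (messageLaw κ α a b t false))).map
        (· + (-(κ * (a - b)) - limitLogOdds κ α))

instance (κ α a b : ℝ) (t : ℕ) (x : Bool) : IsProbabilityMeasure (messageLaw κ α a b t x) := by
  induction t generalizing x with
  | zero => rw [messageLaw]; infer_instance
  | succ t ih =>
    rw [messageLaw]
    have := ih true
    have := ih false
    exact Measure.isProbabilityMeasure_map (by fun_prop)

/-- All jumps lie in the compact interval `[0, log (a / b)]`, so continuous functions are integrable
whatever tails the incoming laws have. -/
lemma integral_jumpIntensity {κ α a b : ℝ} (hκ0 : 0 < κ) (hκ1 : κ < 1) (hα0 : 0 < α)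
    (hα1 : α < 1) (hb : 0 < b) (hab : b < a) (x : Bool) (ν₁ ν₀ : Measure ℝ)
    [IsProbabilityMeasure ν₁] [IsProbabilityMeasure ν₀] {f : ℝ → ℂ} (hf : Continuous f) :
    Integrable f (jumpIntensity κ α a b x ν₁ ν₀) ∧
    ∫ y, f y ∂jumpIntensity κ α a b x ν₁ ν₀ =
      communityRate a b x * (κ * α) * f (Real.log (a / b)) +
      communityRate a b x * (κ * (1 - α)) * ∫ r, f (messageJump (a / b) r) ∂ν₁ +
      b * (1 - κ) * ∫ r, f (messageJump (a / b) r) ∂ν₀ := by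
  have ha : 0 < a := hb.trans hab
  have hρ : 1 ≤ a / b := by rw [le_div_iff₀ hb]; linarith
  have hρ0 : 0 < a / b := by positivity
  have hg := continuous_messageJump hρ0
  have hr : 0 < communityRate a b x := by unfold communityRate; split_ifs <;> assumption
  have hα' : 0 < 1 - α := by linarith
  have hκ' : 0 < 1 - κ := by linarith
  obtain ⟨C, hC⟩ := isCompact_Icc.exists_bound_of_continuousOn
    (s := Set.Icc 0 (Real.log (a / b))) hf.continuousOn
  have hint (ν : Measure ℝ) [IsProbabilityMeasure ν] :
      Integrable f (ν.map (messageJump (a / b))) := by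
    rw [integrable_map_measure hf.aestronglyMeasurable hg.aemeasurable]
    exact Integrable.of_bound (hf.comp hg).aestronglyMeasurable C
      (ae_of_all _ fun r => hC _ (messageJump_mem hρ r))
  have hd : Integrable f (Measure.dirac (Real.log (a / b))) := integrable_dirac (by simp)
  have i1 := hd.smul_measure (c := ENNReal.ofReal (communityRate a b x * (κ * α)))
    ENNReal.ofReal_ne_top
  have i2 := (hint ν₁).smul_measure (c := ENNReal.ofReal (communityRate a b x * (κ * (1 - α))))
    ENNReal.ofReal_ne_top
  have i3 := (hint ν₀).smul_measure (c := ENNReal.ofReal (b * (1 - κ))) ENNReal.ofReal_ne_top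
  refine ⟨(i1.add_measure i2).add_measure i3, ?_⟩
  rw [jumpIntensity, integral_add_measure (i1.add_measure i2) i3, integral_add_measure i1 i2,
    integral_smul_measure, integral_smul_measure, integral_smul_measure, integral_dirac,
    integral_map hg.aemeasurable hf.aestronglyMeasurable,
    integral_map hg.aemeasurable hf.aestronglyMeasurable,
    ENNReal.toReal_ofReal (by positivity), ENNReal.toReal_ofReal (by positivity),
    ENNReal.toReal_ofReal (by positivity)]
  simp only [Complex.real_smul]
  push_cast
  ring

lemma integral_cexp_messageLaw_succ {κ α a b : ℝ} (hκ0 : 0 < κ) (hκ1 : κ < 1) (hα0 : 0 < α)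
    (hα1 : α < 1) (hb : 0 < b) (hab : b < a) (t : ℕ) (x : Bool) (z : ℂ) :
    Integrable (fun y : ℝ => Complex.exp (z * y)) (messageLaw κ α a b (t + 1) x) ∧
    ∫ y, Complex.exp (z * y) ∂messageLaw κ α a b (t + 1) x =
      Complex.exp (z * (-(κ * (a - b)) - limitLogOdds κ α : ℝ) +
      (communityRate a b x * (κ * α) * (Complex.exp (z * Real.log (a / b)) - 1) +
      communityRate a b x * (κ * (1 - α)) *
        ∫ r, (Complex.exp (z * messageJump (a / b) r) - 1) ∂messageLaw κ α a b t true +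
      b * (1 - κ) *
        ∫ r, (Complex.exp (z * messageJump (a / b) r) - 1) ∂messageLaw κ α a b t false)) := by
  have hc : Continuous fun y : ℝ => Complex.exp (z * y) := by fun_prop
  have h1 := integral_compoundPoisson _ (by simp)
    (fun x y => by push_cast; rw [mul_add, Complex.exp_add]) hc.measurable
    (integral_jumpIntensity hκ0 hκ1 hα0 hα1 hb hab x (messageLaw κ α a b t true)
      (messageLaw κ α a b t false) hc).1
  have h2 := (integral_jumpIntensity hκ0 hκ1 hα0 hα1 hb hab x (messageLaw κ α a b t true)
      (messageLaw κ α a b t false) (f := fun y : ℝ => Complex.exp (z * y) - 1) (by fun_prop)).2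
  rw [messageLaw]
  have hadd (y : ℝ) : Complex.exp (z * (y + (-(κ * (a - b)) - limitLogOdds κ α) : ℝ)) =
      Complex.exp (z * y) * Complex.exp (z * (-(κ * (a - b)) - limitLogOdds κ α : ℝ)) := by
    rw [← Complex.exp_add]; push_cast; ring_nf
  constructor
  · rw [integrable_map_measure hc.aestronglyMeasurable (by fun_prop)]
    simp only [Function.comp_def, hadd]
    exact h1.1.mul_const _
  · rw [integral_map (by fun_prop) hc.aestronglyMeasurable]
    simp only [hadd]
    rw [integral_mul_const, h1.2, h2, ← Complex.exp_add, add_comm]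

lemma integrable_exp_messageLaw {κ α a b : ℝ} (hκ0 : 0 < κ) (hκ1 : κ < 1) (hα0 : 0 < α)
    (hα1 : α < 1) (hb : 0 < b) (hab : b < a) (t : ℕ) (x : Bool) :
    Integrable (fun r => Real.exp r) (messageLaw κ α a b t x) := by
  cases t with
  | zero => rw [messageLaw]; exact integrable_dirac (by simp)
  | succ t =>
    have h := (integral_cexp_messageLaw_succ hκ0 hκ1 hα0 hα1 hb hab t x 1).1.norm
    simpa [Complex.norm_exp] using h

lemma exp_neg_limitLogOdds {κ α : ℝ} (hκ0 : 0 < κ) (hκ1 : κ < 1) (hα1 : α < 1) :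
    (1 - κ) * Real.exp (-limitLogOdds κ α) = κ * (1 - α) := by
  have hα' : 0 < 1 - α := by linarith
  have hκ' : 0 < 1 - κ := by linarith
  rw [limitLogOdds, Real.exp_neg, Real.exp_log (by positivity)]
  field_simp

/-! ### The likelihood-ratio identity between the two label laws. -/

/-- The laws of the messages sent from the two labels are mutually absolutely continuous, with
likelihood ratio given by the message itself. -/
def IsPosteriorPair (κ α : ℝ) (ν₁ ν₀ : Measure ℝ) : Prop :=
  ENNReal.ofReal (1 - κ) • ν₀.withDensity (fun r => ENNReal.ofReal (Real.exp r)) =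
    ENNReal.ofReal (κ * (1 - α)) • ν₁

lemma IsPosteriorPair.integral {κ α : ℝ} {ν₁ ν₀ : Measure ℝ} (h : IsPosteriorPair κ α ν₁ ν₀)
    (hκ0 : 0 < κ) (hκ1 : κ < 1) (hα1 : α < 1) {E : Type*} [NormedAddCommGroup E]
    [NormedSpace ℝ E] (H : ℝ → E) :
    (1 - κ) • ∫ r, Real.exp r • H r ∂ν₀ = (κ * (1 - α)) • ∫ r, H r ∂ν₁ := by
  have hα' : 0 < 1 - α := by linarith
  have hκ' : 0 < 1 - κ := by linarith
  have h' := congrArg (fun μ => ∫ r, H r ∂μ) h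
  simp only [integral_smul_measure] at h'
  rw [integral_withDensity_eq_integral_toReal_smul (by fun_prop) (by simp),
    ENNReal.toReal_ofReal (by positivity), ENNReal.toReal_ofReal (by positivity)] at h'
  simpa [ENNReal.toReal_ofReal (Real.exp_pos _).le] using h'

/-- Both measures are finite, the tilted one thanks to the exponential moment, so equality of
characteristic functions suffices: only imaginary `z` is used. -/
lemma isPosteriorPair_of_integral {κ α : ℝ} {ν₁ ν₀ : Measure ℝ} [IsFiniteMeasure ν₁]
    (hκ1 : κ < 1) (hκ0 : 0 < κ) (hα1 : α < 1) (hint : Integrable (fun r => Real.exp r) ν₀)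
    (h : ∀ z : ℂ, (1 - κ) * ∫ r : ℝ, Complex.exp ((z + 1) * r) ∂ν₀ =
      (κ * (1 - α)) * ∫ r : ℝ, Complex.exp (z * r) ∂ν₁) : IsPosteriorPair κ α ν₁ ν₀ := by
  have hα' : 0 < 1 - α := by linarith
  have hκ' : 0 < 1 - κ := by linarith
  have : IsFiniteMeasure (ν₀.withDensity fun r => ENNReal.ofReal (Real.exp r)) :=
    isFiniteMeasure_withDensity_ofReal hint.2
  have := Measure.smul_finite (ν₀.withDensity fun r => ENNReal.ofReal (Real.exp r))
    (c := ENNReal.ofReal (1 - κ)) ENNReal.ofReal_ne_top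
  have := Measure.smul_finite ν₁ (c := ENNReal.ofReal (κ * (1 - α))) ENNReal.ofReal_ne_top
  refine Measure.ext_of_charFun (funext fun θ => ?_)
  rw [charFun_apply_real, charFun_apply_real, integral_smul_measure, integral_smul_measure,
    integral_withDensity_eq_integral_toReal_smul (by fun_prop) (by simp),
    ENNReal.toReal_ofReal (by positivity), ENNReal.toReal_ofReal (by positivity)]
  have h' := h (θ * Complex.I)
  simp only [Complex.real_smul, ENNReal.toReal_ofReal (Real.exp_pos _).le]
  push_cast
  convert h' using 4 with r r
  · rw [← Complex.exp_add]; ring_nf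
  · ring_nf

/-- Tilting a compound Poisson law by `e^y` tilts its intensity by `e^y`. A cue jump has rate ratio
`a / b`, the exponential of its size. For the other jumps, writing `ν₁` as a multiple of `e^r ν₀` by
induction, the label-1 intensity is `e^g` times the label-0 one, since `b (e^r + 1) e^g = a e^r +
b`. The total masses differ by `κ(a - b)`, which the tilted drift absorbs, and the prior log-odds
give the constant. -/
lemma isPosteriorPair_messageLaw {κ α a b : ℝ} (hκ0 : 0 < κ) (hκ1 : κ < 1) (hα0 : 0 < α)
    (hα1 : α < 1) (hb : 0 < b) (hab : b < a) (t : ℕ) :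
    IsPosteriorPair κ α (messageLaw κ α a b t true) (messageLaw κ α a b t false) := by
  have hυ : (1 - κ : ℂ) * Complex.exp (-limitLogOdds κ α : ℝ) = κ * (1 - α) := by
    exact_mod_cast exp_neg_limitLogOdds hκ0 hκ1 hα1
  have hα' : 0 < 1 - α := by linarith
  have hκ' : 0 < 1 - κ := by linarith
  induction t with
  | zero =>
    refine isPosteriorPair_of_integral hκ1 hκ0 hα1
      (integrable_exp_messageLaw hκ0 hκ1 hα0 hα1 hb hab _ _) fun z => ?_
    simp only [messageLaw, integral_dirac]
    rw [add_mul, Complex.exp_add, one_mul, ← hυ]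
    ring
  | succ t ih =>
    have ha : 0 < a := hb.trans hab
    have hρ0 : 0 < a / b := by positivity
    have hρ : 1 ≤ a / b := by rw [le_div_iff₀ hb]; linarith
    refine isPosteriorPair_of_integral hκ1 hκ0 hα1
      (integrable_exp_messageLaw hκ0 hκ1 hα0 hα1 hb hab _ _) fun z => ?_
    rw [(integral_cexp_messageLaw_succ hκ0 hκ1 hα0 hα1 hb hab t false _).2,
      (integral_cexp_messageLaw_succ hκ0 hκ1 hα0 hα1 hb hab t true _).2]
    have hshift {X Y : ℂ} (h : X = (-limitLogOdds κ α : ℝ) + Y) :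
        (1 - κ : ℂ) * Complex.exp X = κ * (1 - α) * Complex.exp Y := by
      rw [h, Complex.exp_add, ← hυ, mul_assoc]
    refine hshift ?_
    set g := messageJump (a / b) with hg_def
    have hg : Continuous g := continuous_messageJump hρ0
    have hexp (r : ℝ) : Complex.exp (g r) =
        (Complex.exp r * (a / b) + 1) / (Complex.exp r + 1) := by
      exact_mod_cast congrArg Complex.ofReal (exp_messageJump hρ0 r)
    have hint (ν : Measure ℝ) [IsProbabilityMeasure ν] (w : ℂ) :
        Integrable (fun r => Complex.exp (w * g r)) ν := by
      have hc : Continuous fun y : ℝ => Complex.exp (w * y) := by fun_prop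
      obtain ⟨C, hC⟩ := isCompact_Icc.exists_bound_of_continuousOn
        (s := Set.Icc 0 (Real.log (a / b))) hc.continuousOn
      exact Integrable.of_bound (hc.comp hg).aestronglyMeasurable C
        (ae_of_all _ fun r => hC _ (messageJump_mem hρ r))
    have hlog : Complex.exp ((z + 1) * Real.log (a / b)) =
        Complex.exp (z * Real.log (a / b)) * (a / b) := by
      rw [add_mul, Complex.exp_add, one_mul, ← Complex.ofReal_exp, Real.exp_log hρ0]
      push_cast; rfl
    have hsub (ν : Measure ℝ) [IsProbabilityMeasure ν] (w : ℂ) :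
        ∫ r, (Complex.exp (w * g r) - 1) ∂ν = ∫ r, Complex.exp (w * g r) ∂ν - 1 := by
      rw [integral_sub (hint ν w) (integrable_const _)]; simp
    simp only [hsub]
    -- This test function is chosen so that, by the formula for `e^g`, multiplication by `e^r`
    -- leaves a combination of `e^{zg}` and `e^{(z+1)g}` with constant coefficients.
    have key := ih.integral hκ0 hκ1 hα1 fun r => b * Complex.exp ((z + 1) * g r)
      - a * Complex.exp (z * g r)
    have hkey (r : ℝ) : Real.exp r • (b * Complex.exp ((z + 1) * g r)
        - a * Complex.exp (z * g r)) =
        b * Complex.exp (z * g r) - b * Complex.exp ((z + 1) * g r) := by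
      have hne : Complex.exp r + 1 ≠ 0 := by
        rw [← Complex.ofReal_exp]; exact_mod_cast (by positivity : Real.exp r + 1 ≠ 0)
      have hb' : (b : ℂ) ≠ 0 := by exact_mod_cast hb.ne'
      rw [add_mul, Complex.exp_add, one_mul, hexp, Complex.real_smul, Complex.ofReal_exp]
      field_simp
      ring
    simp only [hkey] at key
    rw [integral_sub ((hint _ _).const_mul _) ((hint _ _).const_mul _),
      integral_sub ((hint _ _).const_mul _) ((hint _ _).const_mul _)] at key
    simp only [integral_const_mul, Complex.real_smul] at key
    push_cast at key
    rw [hlog]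
    simp only [communityRate, if_true, Bool.false_eq_true, if_false]
    have hb' : (b : ℂ) ≠ 0 := by exact_mod_cast hb.ne'
    push_cast
    field_simp
    linear_combination -key
end

/-! ### Conditional expectations given the community, and independence by toggling. -/

noncomputable section
open scoped Classical

instance (n : ℕ) : Fintype (Config n) :=
  Fintype.ofInjective
    (fun ω : Config n => (ω.community, ω.cues, fun i j : Fin n => decide (ω.graph.Adj i j)))
    (by
      rintro ⟨S, C, G⟩ ⟨S', C', G'⟩ h
      simp only [Prod.mk.injEq] at h
      obtain ⟨rfl, rfl, h⟩ := h
      congr 1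
      ext i j
      simpa using congrFun (congrFun h i) j)

variable {n : ℕ}

/-- The conditional weight of a configuration given that the community is `S`. -/
def condWeight (S : Finset (Fin n)) (p q α : ℝ) (ω : Config n) : ℝ :=
  if ω.community = S then
    (∏ i, cueWeight α ω i) * ∏ i, ∏ j ∈ Finset.Ioi i, edgeWeight p q ω i j
  else 0

/-- The conditional expectation given that the community is `S`. -/
def condMean {V : Type*} [AddCommGroup V] [Module ℝ V] (S : Finset (Fin n)) (p q α : ℝ)
    (F : Config n → V) : V :=
  ∑ ω, condWeight S p q α ω • F ω

/-- The conditional probability of an edge given the community. -/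
def edgeProb (S : Finset (Fin n)) (p q : ℝ) (i j : Fin n) : ℝ :=
  if i ∈ S ∧ j ∈ S then p else q

/-- The conditional probability of a cue given the community. -/
def cueProb (S : Finset (Fin n)) (α : ℝ) (i : Fin n) : ℝ := if i ∈ S then α else 0

/-- Change the adjacency status of the pair `x, y`. -/
def toggleEdge (x y : Fin n) (ω : Config n) : Config n :=
  { ω with graph := symmDiff ω.graph (SimpleGraph.edge x y) }

/-- Change the cue status of the node `x`. -/
def toggleCue (x : Fin n) (ω : Config n) : Config n :=
  { ω with cues := symmDiff ω.cues {x} }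

@[simp] lemma toggleEdge_community (x y : Fin n) (ω : Config n) :
    (toggleEdge x y ω).community = ω.community := rfl
@[simp] lemma toggleEdge_cues (x y : Fin n) (ω : Config n) :
    (toggleEdge x y ω).cues = ω.cues := rfl
@[simp] lemma toggleCue_community (x : Fin n) (ω : Config n) :
    (toggleCue x ω).community = ω.community := rfl

lemma toggleEdge_involutive (x y : Fin n) : Function.Involutive (toggleEdge x y) := fun ω => by
  simp [toggleEdge]

lemma toggleCue_involutive (x : Fin n) : Function.Involutive (toggleCue x) := fun ω => by
  simp [toggleCue]

lemma toggleEdge_comm (x y : Fin n) (ω : Config n) : toggleEdge x y ω = toggleEdge y x ω := by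
  rw [toggleEdge, toggleEdge, SimpleGraph.edge_comm]

lemma toggleEdge_adj_self {x y : Fin n} (h : x ≠ y) (ω : Config n) :
    (toggleEdge x y ω).graph.Adj x y ↔ ¬ ω.graph.Adj x y := by
  simp [toggleEdge, symmDiff_def, SimpleGraph.edge_adj, h]

lemma toggleEdge_adj_of_ne {x y i j : Fin n} (h : ¬ (i = x ∧ j = y ∨ i = y ∧ j = x))
    (ω : Config n) : (toggleEdge x y ω).graph.Adj i j ↔ ω.graph.Adj i j := by
  have h' : ¬ (SimpleGraph.edge x y).Adj i j := by
    rw [SimpleGraph.edge_adj]; tauto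
  simp [toggleEdge, symmDiff_def, h']

lemma mem_toggleCue_self (x : Fin n) (ω : Config n) :
    x ∈ (toggleCue x ω).cues ↔ x ∉ ω.cues := by
  simp [toggleCue, Finset.mem_symmDiff]

lemma mem_toggleCue_of_ne {x i : Fin n} (h : i ≠ x) (ω : Config n) :
    i ∈ (toggleCue x ω).cues ↔ i ∈ ω.cues := by
  simp [toggleCue, Finset.mem_symmDiff, h]

/-- Independence without a product space: on each pair `{ω, T ω}` the weights are in ratio `r : 1 -
r` and `Φ` is constant, so the terms `W (1_P - r) Φ` cancel. There are no fixed points because `T`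
flips `P`. -/
lemma sum_weight_ite_of_involutive {Ω V : Type*} [Fintype Ω] [AddCommGroup V] [Module ℝ V]
    {T : Ω → Ω} (hT : Function.Involutive T) {P : Ω → Prop} [DecidablePred P] (hP : ∀ ω, P (T ω) ↔ ¬ P ω)
    {W : Ω → ℝ} {r : ℝ} (hW : ∀ ω, P ω → (1 - r) * W ω = r * W (T ω)) {Φ : Ω → V}
    (hΦ : ∀ ω, Φ (T ω) = Φ ω) :
    ∑ ω, W ω • (if P ω then Φ ω else 0) = r • ∑ ω, W ω • Φ ω := by
  rw [← sub_eq_zero, Finset.smul_sum, ← Finset.sum_sub_distrib]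
  have hsum : ∀ ω, W ω • (if P ω then Φ ω else 0) - r • W ω • Φ ω =
      (W ω * ((if P ω then 1 else 0) - r)) • Φ ω := fun ω => by
    split_ifs <;> module
  simp only [hsum]
  refine Finset.sum_involution (fun ω _ => T ω) (fun ω _ => ?_) (fun ω _ _ h => ?_)
    (fun _ _ => Finset.mem_univ _) (fun ω _ => hT ω)
  · rw [hΦ, ← add_smul]
    by_cases h : P ω
    · have h' : ¬ P (T ω) := by rw [hP]; simpa using h
      rw [if_pos h, if_neg h']
      have : W ω * (1 - r) + W (T ω) * (0 - r) = 0 := by linarith [hW ω h]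
      rw [this, zero_smul]
    · have h' : P (T ω) := (hP ω).2 h
      have := hW _ h'
      rw [hT] at this
      rw [if_neg h, if_pos h']
      have : W ω * (0 - r) + W (T ω) * (1 - r) = 0 := by linarith
      rw [this, zero_smul]
  · have := hP ω
    rw [h] at this
    tauto

/-- The ratio of two products differing in one factor, cleared of denominators because weights may
vanish. -/
lemma prod_mul_of_forall_ne {ι : Type*} {s : Finset ι} {f g : ι → ℝ} {e : ι} (he : e ∈ s)
    (h : ∀ i ∈ s, i ≠ e → f i = g i) : (∏ i ∈ s, f i) * g e = (∏ i ∈ s, g i) * f e := by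
  rw [← Finset.mul_prod_erase s f he, ← Finset.mul_prod_erase s g he,
    Finset.prod_congr rfl fun i hi => h i (Finset.mem_of_mem_erase hi) (Finset.ne_of_mem_erase hi)]
  ring

lemma edgeWeight_eq (p q : ℝ) (ω : Config n) (i j : Fin n) :
    edgeWeight p q ω i j = if ω.graph.Adj i j then edgeProb ω.community p q i j
      else 1 - edgeProb ω.community p q i j := rfl

lemma cueWeight_eq (α : ℝ) (ω : Config n) (i : Fin n) :
    cueWeight α ω i = if i ∈ ω.cues then cueProb ω.community α i
      else 1 - cueProb ω.community α i := by
  unfold cueWeight cueProb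
  split_ifs <;> simp

lemma edgeWeight_toggleEdge_of_ne {x y i j : Fin n} (h : ¬ (i = x ∧ j = y ∨ i = y ∧ j = x))
    (p q : ℝ) (ω : Config n) : edgeWeight p q (toggleEdge x y ω) i j = edgeWeight p q ω i j := by
  rw [edgeWeight_eq, edgeWeight_eq]
  simp only [toggleEdge_adj_of_ne h, toggleEdge_community]

lemma edgeWeight_prod_toggleEdge {x y : Fin n} (hxy : x < y) (p q : ℝ) (ω : Config n) :
    (∏ i, ∏ j ∈ Finset.Ioi i, edgeWeight p q ω i j) * edgeWeight p q (toggleEdge x y ω) x y =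
      (∏ i, ∏ j ∈ Finset.Ioi i, edgeWeight p q (toggleEdge x y ω) i j) *
        edgeWeight p q ω x y := by
  rw [Finset.prod_sigma', Finset.prod_sigma']
  refine prod_mul_of_forall_ne (s := Finset.univ.sigma fun i : Fin n => Finset.Ioi i)
    (f := fun e => edgeWeight p q ω e.1 e.2)
    (g := fun e => edgeWeight p q (toggleEdge x y ω) e.1 e.2) (e := ⟨x, y⟩) (by simpa) ?_
  rintro ⟨i, j⟩ hij hne
  simp only [Finset.mem_sigma, Finset.mem_univ, Finset.mem_Ioi, true_and] at hij
  refine (edgeWeight_toggleEdge_of_ne ?_ _ _ _).symm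
  rintro (⟨rfl, rfl⟩ | ⟨rfl, rfl⟩)
  · exact hne rfl
  · exact absurd hij hxy.asymm

lemma cueWeight_prod_toggleCue (x : Fin n) (α : ℝ) (ω : Config n) :
    (∏ i, cueWeight α ω i) * cueWeight α (toggleCue x ω) x =
      (∏ i, cueWeight α (toggleCue x ω) i) * cueWeight α ω x := by
  refine prod_mul_of_forall_ne (f := fun i => cueWeight α ω i)
    (g := fun i => cueWeight α (toggleCue x ω) i) (Finset.mem_univ x) fun i _ hne => ?_
  rw [cueWeight_eq, cueWeight_eq]
  simp only [mem_toggleCue_of_ne hne, toggleCue_community]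

section condMean

variable {V : Type*} [AddCommGroup V] [Module ℝ V] {S : Finset (Fin n)} {p q α : ℝ}

lemma condMean_congr {F F' : Config n → V} (h : ∀ ω, ω.community = S → F ω = F' ω) :
    condMean S p q α F = condMean S p q α F' := by
  refine Finset.sum_congr rfl fun ω _ => ?_
  by_cases hω : ω.community = S
  · rw [h ω hω]
  · simp [condWeight, hω]

/-- An event decided by the edge `x y` is independent of what does not depend on that edge. -/
lemma condMean_ite_adj {x y : Fin n} (hxy : x ≠ y) {Φ : Config n → V}
    (hΦ : ∀ ω, Φ (toggleEdge x y ω) = Φ ω) :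
    condMean S p q α (fun ω => if ω.graph.Adj x y then Φ ω else 0) =
      edgeProb S p q x y • condMean S p q α Φ := by
  wlog hlt : x < y generalizing x y with H
  · have := H hxy.symm (fun ω => by rw [toggleEdge_comm, hΦ])
      (lt_of_le_of_ne (not_lt.1 hlt) hxy.symm)
    simpa only [SimpleGraph.adj_comm _ y x, edgeProb, and_comm (a := y ∈ S)] using this
  refine sum_weight_ite_of_involutive (toggleEdge_involutive x y) (toggleEdge_adj_self hxy)
    (fun ω hω => ?_) hΦ
  unfold condWeight
  by_cases hS : ω.community = S
  · rw [if_pos hS, if_pos (by exact hS)]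
    have h := edgeWeight_prod_toggleEdge hlt p q ω
    have hω' : ¬ (toggleEdge x y ω).graph.Adj x y := by
      rw [toggleEdge_adj_self hxy]; simpa using hω
    rw [edgeWeight_eq, if_neg hω', edgeWeight_eq _ _ _ x y, if_pos hω, toggleEdge_community, hS] at h
    have hc : ∏ i, cueWeight α (toggleEdge x y ω) i = ∏ i, cueWeight α ω i :=
      Finset.prod_congr rfl fun i _ => by simp only [cueWeight_eq]; rfl
    rw [hc]
    linear_combination (∏ i, cueWeight α ω i) * h
  · rw [if_neg hS, if_neg (by exact hS), mul_zero, mul_zero]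

/-- The cue status of `x` is independent of what does not depend on it. -/
lemma condMean_ite_cue (x : Fin n) {Φ : Config n → V} (hΦ : ∀ ω, Φ (toggleCue x ω) = Φ ω) :
    condMean S p q α (fun ω => if x ∈ ω.cues then Φ ω else 0) =
      cueProb S α x • condMean S p q α Φ := by
  refine sum_weight_ite_of_involutive (P := fun ω => x ∈ ω.cues) (toggleCue_involutive x) (mem_toggleCue_self x)
    (fun ω hω => ?_) hΦ
  unfold condWeight
  by_cases hS : ω.community = S
  · rw [if_pos hS, if_pos (by exact hS)]
    have h := cueWeight_prod_toggleCue x α ω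
    have hω' : x ∉ (toggleCue x ω).cues := by
      rw [mem_toggleCue_self]; simpa using hω
    rw [cueWeight_eq _ (toggleCue x ω) x, if_neg hω', cueWeight_eq _ ω x, if_pos hω,
      toggleCue_community, hS] at h
    have hc : ∏ i, ∏ j ∈ Finset.Ioi i, edgeWeight p q (toggleCue x ω) i j =
        ∏ i, ∏ j ∈ Finset.Ioi i, edgeWeight p q ω i j := rfl
    rw [hc]
    linear_combination (∏ i, ∏ j ∈ Finset.Ioi i, edgeWeight p q ω i j) * h
  · rw [if_neg hS, if_neg (by exact hS), mul_zero, mul_zero]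

lemma condMean_add (F F' : Config n → V) :
    condMean S p q α (fun ω => F ω + F' ω) = condMean S p q α F + condMean S p q α F' := by
  simp [condMean, smul_add, Finset.sum_add_distrib]

lemma condMean_sub (F F' : Config n → V) :
    condMean S p q α (fun ω => F ω - F' ω) = condMean S p q α F - condMean S p q α F' := by
  simp [condMean, smul_sub, Finset.sum_sub_distrib]

lemma condMean_sum {ι : Type*} (s : Finset ι) (F : ι → Config n → V) :
    condMean S p q α (fun ω => ∑ i ∈ s, F i ω) = ∑ i ∈ s, condMean S p q α (F i) := by
  simp only [condMean, Finset.smul_sum]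
  exact Finset.sum_comm

lemma condMean_smul (c : ℝ) (F : Config n → V) :
    condMean S p q α (fun ω => c • F ω) = c • condMean S p q α F := by
  simp only [condMean, Finset.smul_sum]
  exact Finset.sum_congr rfl fun ω _ => smul_comm _ _ _

lemma condMean_mul_left {A : Type*} [Ring A] [Algebra ℝ A] (c : A) (F : Config n → A) :
    condMean S p q α (fun ω => c * F ω) = c * condMean S p q α F := by
  simp [condMean, Finset.mul_sum]

lemma condMean_ite_not_adj {x y : Fin n} (hxy : x ≠ y) {Φ : Config n → V}
    (hΦ : ∀ ω, Φ (toggleEdge x y ω) = Φ ω) :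
    condMean S p q α (fun ω => if ω.graph.Adj x y then 0 else Φ ω) =
      (1 - edgeProb S p q x y) • condMean S p q α Φ := by
  rw [sub_smul, one_smul, ← condMean_ite_adj hxy hΦ, ← condMean_sub]
  congr with ω
  split_ifs <;> simp

lemma condMean_ite_not_cue (x : Fin n) {Φ : Config n → V} (hΦ : ∀ ω, Φ (toggleCue x ω) = Φ ω) :
    condMean S p q α (fun ω => if x ∈ ω.cues then 0 else Φ ω) =
      (1 - cueProb S α x) • condMean S p q α Φ := by
  rw [sub_smul, one_smul, ← condMean_ite_cue x hΦ, ← condMean_sub]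
  congr with ω
  split_ifs <;> simp

/-- Ordered pairs with `e.1 < e.2` make distinct entries of `L` distinct edges, so each toggle
leaves the other conditions unchanged. -/
lemma condMean_no_edge (L : Finset (Fin n × Fin n)) (hL : ∀ e ∈ L, e.1 < e.2) {Φ : Config n → V}
    (hΦ : ∀ x y ω, Φ (toggleEdge x y ω) = Φ ω) :
    condMean S p q α (fun ω => if ∀ e ∈ L, ¬ ω.graph.Adj e.1 e.2 then Φ ω else 0) =
      (∏ e ∈ L, (1 - edgeProb S p q e.1 e.2)) • condMean S p q α Φ := by
  induction L using Finset.induction_on with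
  | empty => simp
  | insert e L he ih =>
    have he' := hL e (Finset.mem_insert_self _ _)
    have hL' : ∀ e ∈ L, e.1 < e.2 := fun e h => hL e (Finset.mem_insert_of_mem h)
    rw [Finset.prod_insert he, mul_smul, ← ih hL', ← condMean_ite_not_adj he'.ne]
    · congr with ω
      simp only [Finset.forall_mem_insert]
      split_ifs <;> tauto
    · intro ω
      rw [hΦ]
      congr 1
      refine propext (forall₂_congr fun f hf => not_congr (toggleEdge_adj_of_ne ?_ ω))
      rintro (⟨h1, h2⟩ | ⟨h1, h2⟩)
      · exact he (by rwa [show e = f from Prod.ext h1.symm h2.symm])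
      · have := hL' f hf
        rw [h1, h2] at this
        exact this.asymm he'

lemma condMean_no_cue (L : Finset (Fin n)) {Φ : Config n → V}
    (hΦ : ∀ x ω, Φ (toggleCue x ω) = Φ ω) :
    condMean S p q α (fun ω => if ∀ i ∈ L, i ∉ ω.cues then Φ ω else 0) =
      (∏ i ∈ L, (1 - cueProb S α i)) • condMean S p q α Φ := by
  induction L using Finset.induction_on with
  | empty => simp
  | insert e L he ih =>
    rw [Finset.prod_insert he, mul_smul, ← ih, ← condMean_ite_not_cue e]
    · congr with ω
      simp only [Finset.forall_mem_insert]
      split_ifs <;> tauto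
    · intro ω
      rw [hΦ]
      congr 1
      refine propext (forall₂_congr fun f hf => not_congr (mem_toggleCue_of_ne ?_ ω))
      rintro rfl
      exact he hf

lemma edgeProb_mem (hp0 : 0 ≤ p) (hp1 : p < 1) (hq0 : 0 ≤ q) (hq1 : q < 1) (i j : Fin n) :
    0 ≤ edgeProb S p q i j ∧ edgeProb S p q i j < 1 := by
  unfold edgeProb; split_ifs <;> constructor <;> assumption

lemma cueProb_mem (hα0 : 0 ≤ α) (hα1 : α < 1) (i : Fin n) :
    0 ≤ cueProb S α i ∧ cueProb S α i < 1 := by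
  unfold cueProb; split_ifs <;> constructor <;> first | assumption | simp

/-- The mass is found without summing over all configurations. The weight of "no edge, no cue" is,
by independence, a product times the total mass; it is also the weight of a single configuration,
equal to that same product. The product is nonzero since `p, q, α < 1`. -/
lemma condMean_one (hp0 : 0 ≤ p) (hp1 : p < 1) (hq0 : 0 ≤ q) (hq1 : q < 1) (hα0 : 0 ≤ α)
    (hα1 : α < 1) : condMean S p q α (fun _ => (1 : ℝ)) = 1 := by
  set L : Finset (Fin n × Fin n) := Finset.univ.filter fun e => e.1 < e.2 with hL_def
  have h1 : condMean S p q α (fun ω => if ∀ e ∈ L, ¬ ω.graph.Adj e.1 e.2 then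
      (if ∀ i ∈ Finset.univ, i ∉ ω.cues then (1 : ℝ) else 0) else 0) =
      (∏ e ∈ L, (1 - edgeProb S p q e.1 e.2)) * ((∏ i, (1 - cueProb S α i)) *
        condMean S p q α (fun _ => (1 : ℝ))) := by
    rw [condMean_no_edge L (by simp [L]) (fun x y ω => rfl), condMean_no_cue _ (fun _ _ => rfl)]
    rfl
  have h2 : condMean S p q α (fun ω => if ∀ e ∈ L, ¬ ω.graph.Adj e.1 e.2 then
      (if ∀ i ∈ Finset.univ, i ∉ ω.cues then (1 : ℝ) else 0) else 0) =
      (∏ e ∈ L, (1 - edgeProb S p q e.1 e.2)) * (∏ i, (1 - cueProb S α i)) := by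
    rw [condMean, Finset.sum_eq_single (⟨S, ∅, ⊥⟩ : Config n)]
    · simp only [condWeight, cueWeight_eq, edgeWeight_eq]
      simp [Finset.prod_sigma', mul_comm]
      left
      refine Finset.prod_bij' (fun e _ => (e.1, e.2)) (fun e _ => ⟨e.1, e.2⟩) ?_ ?_ ?_ ?_ ?_ <;>
      simp [L]
    · rintro ⟨S', C, G⟩ - hne
      by_cases hS : S' = S
      · subst hS
        have : ¬ ((∀ e ∈ L, ¬ G.Adj e.1 e.2) ∧ ∀ i ∈ Finset.univ, i ∉ C) := by
          rintro ⟨hG, hC⟩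
          refine hne ?_
          have hC' : C = ∅ := Finset.eq_empty_of_forall_notMem fun i => hC i (Finset.mem_univ _)
          have hG' : G = ⊥ := by
            ext i j
            simp only [SimpleGraph.bot_adj, iff_false]
            intro hij
            rcases lt_or_gt_of_ne hij.ne with h | h
            · exact hG (i, j) (by simp [L, h]) hij
            · exact hG (j, i) (by simp [L, h]) hij.symm
          rw [hC', hG']
        by_cases h1 : ∀ e ∈ L, ¬ G.Adj e.1 e.2
        · rw [if_pos h1, if_neg fun h2 => this ⟨h1, h2⟩, smul_zero]
        · rw [if_neg h1, smul_zero]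
      · simp [condWeight, hS]
    · simp
  rw [h1, ← mul_assoc] at h2
  refine mul_left_cancel₀ (mul_pos ?_ ?_).ne' (h2.trans (mul_one _).symm)
  · exact Finset.prod_pos fun e _ => sub_pos.2 (edgeProb_mem hp0 hp1 hq0 hq1 _ _).2
  · exact Finset.prod_pos fun e _ => sub_pos.2 (cueProb_mem hα0 hα1 _).2

lemma condWeight_nonneg (hp0 : 0 ≤ p) (hp1 : p < 1) (hq0 : 0 ≤ q) (hq1 : q < 1) (hα0 : 0 ≤ α)
    (hα1 : α < 1) (ω : Config n) : 0 ≤ condWeight S p q α ω := by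
  unfold condWeight
  split_ifs
  · refine mul_nonneg (Finset.prod_nonneg fun i _ => ?_)
      (Finset.prod_nonneg fun i _ => Finset.prod_nonneg fun j _ => ?_)
    · rw [cueWeight_eq]
      have := cueProb_mem (S := ω.community) hα0 hα1 i
      split_ifs <;> linarith
    · rw [edgeWeight_eq]
      have := edgeProb_mem (S := ω.community) hp0 hp1 hq0 hq1 i j
      split_ifs <;> linarith
  · exact le_rfl

lemma condMean_mono (hw : ∀ ω, 0 ≤ condWeight S p q α ω) {F F' : Config n → ℝ}
    (h : ∀ ω, ω.community = S → F ω ≤ F' ω) : condMean S p q α F ≤ condMean S p q α F' := by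
  refine Finset.sum_le_sum fun ω _ => ?_
  by_cases hω : ω.community = S
  · exact mul_le_mul_of_nonneg_left (h ω hω) (hw ω)
  · simp [condWeight, hω]

lemma norm_condMean_le {E : Type*} [NormedAddCommGroup E] [NormedSpace ℝ E]
    (hw : ∀ ω, 0 ≤ condWeight S p q α ω) (F : Config n → E) :
    ‖condMean S p q α F‖ ≤ condMean S p q α fun ω => ‖F ω‖ := by
  refine (norm_sum_le _ _).trans_eq (Finset.sum_congr rfl fun ω _ => ?_)
  rw [norm_smul, Real.norm_of_nonneg (hw ω), smul_eq_mul]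

/-- Averaging over the edges from `i` to the nodes of `L`. -/
lemma condMean_mul_prod_adj {i : Fin n} (L : Finset (Fin n)) (hi : i ∉ L)
    {F : Config n → ℂ} {h : Fin n → Config n → ℂ}
    (hF : ∀ l ∈ L, ∀ ω, F (toggleEdge i l ω) = F ω)
    (hh : ∀ l ∈ L, ∀ m ∈ L, ∀ ω, h m (toggleEdge i l ω) = h m ω) :
    condMean S p q α (fun ω => F ω * ∏ l ∈ L, (1 + if ω.graph.Adj i l then h l ω else 0)) =
      condMean S p q α (fun ω => F ω * ∏ l ∈ L, (1 + edgeProb S p q i l * h l ω)) := by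
  induction L using Finset.induction_on generalizing F with
  | empty => simp
  | insert l L hl ih =>
    have hil : i ≠ l := fun h => hi (h ▸ Finset.mem_insert_self _ _)
    have hiL : i ∉ L := fun h => hi (Finset.mem_insert_of_mem h)
    have hinv : ∀ ω, F (toggleEdge i l ω) * h l (toggleEdge i l ω) *
        ∏ m ∈ L, (1 + if (toggleEdge i l ω).graph.Adj i m then h m (toggleEdge i l ω) else 0) =
        F ω * h l ω * ∏ m ∈ L, (1 + if ω.graph.Adj i m then h m ω else 0) := fun ω => by
      rw [hF l (Finset.mem_insert_self _ _), hh l (Finset.mem_insert_self _ _) l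
        (Finset.mem_insert_self _ _)]
      congr 1
      refine Finset.prod_congr rfl fun m hm => ?_
      have hml : m ≠ l := fun h => hl (h ▸ hm)
      rw [hh l (Finset.mem_insert_self _ _) m (Finset.mem_insert_of_mem hm)]
      simp only [toggleEdge_adj_of_ne (x := i) (y := l) (i := i) (j := m) (by tauto) ω]
    have key := condMean_ite_adj (S := S) (p := p) (q := q) (α := α) hil
      (Φ := fun ω => F ω * h l ω * ∏ m ∈ L, (1 + if ω.graph.Adj i m then h m ω else 0)) hinv
    have hF' : ∀ m ∈ L, ∀ ω, F (toggleEdge i m ω) = F ω :=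
      fun m hm => hF m (Finset.mem_insert_of_mem hm)
    have hh' : ∀ l ∈ L, ∀ m ∈ L, ∀ ω, h m (toggleEdge i l ω) = h m ω :=
      fun l hl m hm => hh l (Finset.mem_insert_of_mem hl) m (Finset.mem_insert_of_mem hm)
    have hhl : ∀ m ∈ L, ∀ ω, h l (toggleEdge i m ω) = h l ω :=
      fun m hm => hh m (Finset.mem_insert_of_mem hm) l (Finset.mem_insert_self _ _)
    simp only [Finset.prod_insert hl]
    -- Splitting off the factor at `l` calls for the induction hypothesis with both weights `F` and
    -- `F * h l`, hence the generalization over `F`.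
    calc _ = condMean S p q α (fun ω => F ω *
            ∏ m ∈ L, (1 + if ω.graph.Adj i m then h m ω else 0)) +
          condMean S p q α (fun ω => if ω.graph.Adj i l then F ω * h l ω *
            ∏ m ∈ L, (1 + if ω.graph.Adj i m then h m ω else 0) else 0) := by
          rw [← condMean_add]
          congr with ω
          split_ifs <;> ring
      _ = condMean S p q α (fun ω => F ω * ∏ m ∈ L, (1 + edgeProb S p q i m * h m ω)) +
          condMean S p q α (fun ω => edgeProb S p q i l • (F ω * h l ω *
            ∏ m ∈ L, (1 + edgeProb S p q i m * h m ω))) := by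
          rw [key, ih hiL hF' hh', ih hiL (F := fun ω => F ω * h l ω)
            (fun m hm ω => by rw [hF' m hm, hhl m hm]) hh', condMean_smul]
      _ = _ := by
          rw [← condMean_add]
          congr with ω
          rw [Complex.real_smul]
          ring

end condMean
end

/-! ### Self-avoiding messages and the cost of returning walks. -/

noncomputable section
open scoped Classical

variable {n : ℕ}

/-- The contribution of a neighbour `l` whose message has posterior value `r`. -/
def jumpAt (p q : ℝ) (ω : Config n) (l : Fin n) (r : ℝ) : ℝ :=
  if l ∈ ω.cues then Real.log (p / q) else messageJump (p / q) r

/-- The belief propagation message of `i` computed along self-avoiding paths that start at `i`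
and avoid `A`. -/
def saMessage (K : ℕ) (p q α : ℝ) (ω : Config n) : ℕ → Finset (Fin n) → Fin n → ℝ
  | 0, _, _ => 0
  | t + 1, A, i => -(K : ℝ) * (p - q) + ∑ l ∈ (insert i A)ᶜ,
      if ω.graph.Adj i l then
        jumpAt p q ω l (saMessage K p q α ω t (insert i A) l - priorLogOdds n K α) else 0

/-- The number of paths of length at most `t` which start at `i`, are self-avoiding except for
their last node, and end in their own past, where `A` is the set of nodes visited before `i` and
`u` is the last of them. -/
def returnCount (ω : Config n) : ℕ → Finset (Fin n) → Fin n → Fin n → ℝ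
  | 0, _, _, _ => 0
  | t + 1, A, u, i => (∑ l ∈ A.erase u, if ω.graph.Adj i l then 1 else 0) +
      ∑ l ∈ (insert i A)ᶜ, if ω.graph.Adj i l then returnCount ω t (insert i A) i l else 0

lemma bpMessage_succ (K : ℕ) (p q α : ℝ) (ω : Config n) (t : ℕ) (i u : Fin n) :
    bpMessage K p q α ω (t + 1) i u = -(K : ℝ) * (p - q) + ∑ l ∈ Finset.univ.erase u,
      if ω.graph.Adj i l then
        jumpAt p q ω l (bpMessage K p q α ω t l i - priorLogOdds n K α) else 0 := by
  rw [bpMessage, add_assoc, Finset.sum_filter, Finset.sum_filter, ← Finset.sum_add_distrib]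
  congr 1
  refine (Finset.sum_erase Finset.univ (a := u) ?_).symm.trans ?_
  · simp
  · refine Finset.sum_congr rfl fun l hl => ?_
    have hl' : l ≠ u := Finset.ne_of_mem_erase hl
    unfold jumpAt messageJump
    split_ifs <;> simp_all

lemma returnCount_nonneg (ω : Config n) (t : ℕ) (A : Finset (Fin n)) (u i : Fin n) :
    0 ≤ returnCount ω t A u i := by
  induction t generalizing A u i with
  | zero => exact le_rfl
  | succ t ih =>
    rw [returnCount]
    refine add_nonneg (Finset.sum_nonneg fun l _ => ?_) (Finset.sum_nonneg fun l _ => ?_)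
    · split_ifs <;> norm_num
    · split_ifs
      · exact ih _ _ _
      · exact le_rfl

/-- The two recursions differ only in neighbours lying in the visited set other than the parent `u`.
Each of these adds `1` to the nonnegative count, so a count below `1` excludes them at every level.
-/
lemma bpMessage_eq_saMessage {K : ℕ} {p q α : ℝ} {ω : Config n} {t : ℕ} {A : Finset (Fin n)}
    {u i : Fin n} (hu : u ∈ A) (hi : i ∉ A) (h : returnCount ω t A u i < 1) :
    bpMessage K p q α ω t i u = saMessage K p q α ω t A i := by
  induction t generalizing A u i with
  | zero => rfl
  | succ t ih =>
    rw [returnCount] at h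
    have h1 : ∀ l ∈ A.erase u, 0 ≤ if ω.graph.Adj i l then (1 : ℝ) else 0 := fun l _ => by
      split_ifs <;> norm_num
    have h2 : ∀ l ∈ (insert i A)ᶜ,
        0 ≤ if ω.graph.Adj i l then returnCount ω t (insert i A) i l else 0 := fun l _ => by
      split_ifs
      · exact returnCount_nonneg _ _ _ _ _
      · exact le_rfl
    have h1' := Finset.sum_nonneg h1
    have h2' := Finset.sum_nonneg h2
    rw [bpMessage_succ, saMessage]
    congr 1
    symm
    have hsub : (insert i A)ᶜ ⊆ Finset.univ.erase u := fun l hl => by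
      simp only [Finset.mem_compl, Finset.mem_insert, not_or] at hl
      simp only [Finset.mem_erase, Finset.mem_univ, and_true]
      rintro rfl
      exact hl.2 hu
    have hrest : ∀ l ∈ Finset.univ.erase u, l ∉ (insert i A)ᶜ → ¬ ω.graph.Adj i l := by
      intro l hl hl'
      simp only [Finset.mem_compl, not_not, Finset.mem_insert] at hl'
      rcases hl' with rfl | hl'
      · exact SimpleGraph.irrefl _
      · intro hadj
        have hl'' : l ∈ A.erase u := Finset.mem_erase.2 ⟨Finset.ne_of_mem_erase hl, hl'⟩
        have := Finset.single_le_sum h1 hl''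
        rw [if_pos hadj] at this
        linarith
    rw [← Finset.sum_subset hsub fun l hl hl' => if_neg (hrest l hl hl')]
    refine Finset.sum_congr rfl fun l hl => ?_
    split_ifs with hadj
    · rw [ih (Finset.mem_insert_self _ _) (by simpa using hl)]
      have := Finset.single_le_sum h2 hl
      rw [if_pos hadj] at this
      linarith
    · rfl

/-- The source of all independence: the recursion never looks at edges touching `A`, and the cue
status of `i` is read only by the node that receives its message. -/
lemma saMessage_congr {K : ℕ} {p q α : ℝ} {ω ω' : Config n} {t : ℕ} {A : Finset (Fin n)}
    {i : Fin n} (hi : i ∉ A)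
    (hadj : ∀ x ∉ A, ∀ y ∉ A, (ω.graph.Adj x y ↔ ω'.graph.Adj x y))
    (hcue : ∀ x ∉ A, x ≠ i → (x ∈ ω.cues ↔ x ∈ ω'.cues)) :
    saMessage K p q α ω t A i = saMessage K p q α ω' t A i := by
  induction t generalizing A i with
  | zero => rfl
  | succ t ih =>
    rw [saMessage, saMessage]
    congr 1
    refine Finset.sum_congr rfl fun l hl => ?_
    have hl' : l ∉ insert i A := by simpa using hl
    have hA : ∀ x ∉ insert i A, x ≠ i ∧ x ∉ A := fun x hx => by simpa using hx
    unfold jumpAt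
    simp only [hadj i hi l (hA l hl').2, hcue l (hA l hl').2 (hA l hl').1]
    rw [ih hl' (fun x hx y hy => hadj x (hA x hx).2 y (hA y hy).2)
      fun x hx _ => hcue x (hA x hx).2 (hA x hx).1]

lemma saMessage_toggleEdge {K : ℕ} {p q α : ℝ} {t : ℕ} {A : Finset (Fin n)} {i x y : Fin n}
    (hi : i ∉ A) (hx : x ∈ A) (ω : Config n) :
    saMessage K p q α (toggleEdge x y ω) t A i = saMessage K p q α ω t A i := by
  refine saMessage_congr hi (fun v hv w hw => toggleEdge_adj_of_ne ?_ ω) fun v _ _ => Iff.rfl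
  rintro (⟨rfl, -⟩ | ⟨-, rfl⟩)
  exacts [hv hx, hw hx]

lemma saMessage_toggleCue {K : ℕ} {p q α : ℝ} {t : ℕ} {A : Finset (Fin n)} {i x : Fin n}
    (hi : i ∉ A) (hx : x ∈ insert i A) (ω : Config n) :
    saMessage K p q α (toggleCue x ω) t A i = saMessage K p q α ω t A i := by
  refine saMessage_congr hi (fun v _ w _ => Iff.rfl) fun v hv hvi => mem_toggleCue_of_ne ?_ ω
  rintro rfl
  exact (Finset.mem_insert.1 hx).elim hvi hv

/-- Edges from explored nodes back into `A` are counted, but the edge from `i` to its parent `u` is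
not. The count is therefore independent of the edge that leads to `i`. -/
lemma returnCount_congr {ω ω' : Config n} {t : ℕ} {A : Finset (Fin n)} {u i : Fin n} (hu : u ∈ A)
    (hi : i ∉ A)
    (hadj : ∀ x y, x ∉ A → ¬ (x = i ∧ y = u) → (ω.graph.Adj x y ↔ ω'.graph.Adj x y)) :
    returnCount ω t A u i = returnCount ω' t A u i := by
  induction t generalizing A u i with
  | zero => rfl
  | succ t ih =>
    rw [returnCount, returnCount]
    have hA : ∀ x ∉ insert i A, x ≠ i ∧ x ∉ A := fun x hx => by simpa using hx
    congr 1
    · refine Finset.sum_congr rfl fun l hl => ?_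
      have hne : ¬ (i = i ∧ l = u) := fun h => Finset.ne_of_mem_erase hl h.2
      simp only [hadj i l hi hne]
    · refine Finset.sum_congr rfl fun l hl => ?_
      have hl' : l ∉ insert i A := by simpa using hl
      have hne : ¬ (i = i ∧ l = u) := by
        rintro ⟨-, rfl⟩
        exact (hA l hl').2 hu
      simp only [hadj i l hi hne]
      rw [ih (Finset.mem_insert_self _ _) hl']
      exact fun x y hx _ => hadj x y (hA x hx).2 fun h => (hA x hx).1 h.1

lemma returnCount_toggleEdge {t : ℕ} {A : Finset (Fin n)} {u i : Fin n} (hu : u ∈ A)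
    (hi : i ∉ A) (ω : Config n) :
    returnCount (toggleEdge i u ω) t A u i = returnCount ω t A u i := by
  refine returnCount_congr hu hi fun x y hx hxy => toggleEdge_adj_of_ne ?_ ω
  rintro (h | ⟨rfl, rfl⟩)
  exacts [hxy h, hx hu]

/-- A bound for the expected number of returns, in units of the edge probability. -/
def returnBound (D : ℝ) : ℕ → ℕ → ℝ
  | 0, _ => 0
  | t + 1, m => m + D * returnBound D t (m + 1)

lemma returnBound_nonneg {D : ℝ} (hD : 0 ≤ D) (t m : ℕ) : 0 ≤ returnBound D t m := by
  induction t generalizing m with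
  | zero => exact le_rfl
  | succ t ih => exact add_nonneg (Nat.cast_nonneg _) (mul_nonneg hD (ih _))

lemma returnBound_mono {D : ℝ} (hD : 0 ≤ D) (t : ℕ) {m k : ℕ} (h : m ≤ k) :
    returnBound D t m ≤ returnBound D t k := by
  induction t generalizing m k with
  | zero => exact le_rfl
  | succ t ih =>
    exact add_le_add (by exact_mod_cast h) (mul_le_mul_of_nonneg_left (ih (by omega)) hD)

/-- First moment along walks: a step to a new node costs a factor at most `n P ≤ D`, a step into the
past costs `P` for each visited node. The edge into `l` is independent of the count continued from
`l`, so the bounds multiply. -/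
lemma condMean_returnCount_le {S : Finset (Fin n)} {p q α P D : ℝ}
    (hw : ∀ ω, 0 ≤ condWeight S p q α ω) (h1 : condMean S p q α (fun _ => (1 : ℝ)) = 1)
    (hP : ∀ i j, edgeProb S p q i j ≤ P) (hP0 : 0 ≤ P)
    (hD : n * P ≤ D) {t : ℕ} {A : Finset (Fin n)} {u i : Fin n} (hu : u ∈ A) (hi : i ∉ A) :
    condMean S p q α (fun ω => returnCount ω t A u i) ≤ returnBound D t A.card * P := by
  have hD0 : 0 ≤ D := le_trans (by positivity) hD
  induction t generalizing A u i with
  | zero => simp [returnCount, returnBound, condMean]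
  | succ t ih =>
    simp only [returnCount, returnBound]
    rw [condMean_add, condMean_sum, condMean_sum, add_mul]
    refine add_le_add ?_ ?_
    · calc _ ≤ ∑ l ∈ A.erase u, P := by
            refine Finset.sum_le_sum fun l hl => ?_
            have hil : i ≠ l := by
              rintro rfl
              exact hi (Finset.mem_of_mem_erase hl)
            rw [condMean_ite_adj hil (Φ := fun _ => (1 : ℝ)) fun _ => rfl, h1, smul_eq_mul, mul_one]
            exact hP i l
        _ ≤ A.card * P := by
            rw [Finset.sum_const, nsmul_eq_mul]
            gcongr
            exact Finset.erase_subset _ _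
    · calc _ ≤ ∑ l ∈ (insert i A)ᶜ, P * (returnBound D t (A.card + 1) * P) := by
            refine Finset.sum_le_sum fun l hl => ?_
            have hl' : l ∉ insert i A := by simpa using hl
            have hil : i ≠ l := by
              rintro rfl
              exact hl' (Finset.mem_insert_self _ _)
            rw [condMean_ite_adj hil (Φ := fun ω => returnCount ω t (insert i A) i l) fun ω => by
              rw [toggleEdge_comm, returnCount_toggleEdge (Finset.mem_insert_self _ _) hl'],
              smul_eq_mul]
            have := ih (Finset.mem_insert_self i A) hl'
            rw [Finset.card_insert_of_notMem hi] at this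
            have hB := returnBound_nonneg hD0 t (A.card + 1)
            exact mul_le_mul (hP i l) this
              (by rw [condMean]; exact Finset.sum_nonneg fun ω _ =>
                  mul_nonneg (hw ω) (returnCount_nonneg _ _ _ _ _)) hP0
        _ ≤ n * (P * (returnBound D t (A.card + 1) * P)) := by
            rw [Finset.sum_const, nsmul_eq_mul]
            have hB := returnBound_nonneg hD0 t (A.card + 1)
            gcongr
            simpa using Finset.card_le_univ (insert i A)ᶜ
        _ ≤ _ := by
            have hB := returnBound_nonneg hD0 t (A.card + 1)
            nlinarith [mul_le_mul_of_nonneg_right hD (mul_nonneg hB hP0)]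

/-- A Markov-type bound: where the messages may differ the count is at least `1`, so it dominates
the indicator of that event. -/
lemma norm_sub_le_returnCount {E : Type*} [SeminormedAddCommGroup E] {K : ℕ} {p q α B : ℝ}
    {ω : Config n} {t : ℕ} {A : Finset (Fin n)} {u i : Fin n} (hu : u ∈ A) (hi : i ∉ A)
    {F : ℝ → E} (hF : ∀ r, ‖F r‖ ≤ B) :
    ‖F (bpMessage K p q α ω t i u) - F (saMessage K p q α ω t A i)‖ ≤
      2 * B * returnCount ω t A u i := by
  have hB : 0 ≤ B := (norm_nonneg _).trans (hF 0)
  have hN := returnCount_nonneg ω t A u i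
  by_cases h : returnCount ω t A u i < 1
  · rw [bpMessage_eq_saMessage hu hi h, sub_self, norm_zero]
    positivity
  · refine (norm_sub_le _ _).trans ?_
    nlinarith [hF (bpMessage K p q α ω t i u), hF (saMessage K p q α ω t A i), not_lt.1 h]
end

/-! ### Poisson approximation and uniform Lévy continuity. -/

noncomputable section
open scoped Classical

lemma norm_prod_sub_prod_le {ι : Type*} (s : Finset ι) {f g : ι → ℂ}
    (hf : ∀ i ∈ s, ‖f i‖ ≤ 1) (hg : ∀ i ∈ s, ‖g i‖ ≤ 1) :
    ‖∏ i ∈ s, f i - ∏ i ∈ s, g i‖ ≤ ∑ i ∈ s, ‖f i - g i‖ := by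
  induction s using Finset.induction_on with
  | empty => simp
  | insert i s hi ih =>
    rw [Finset.forall_mem_insert] at hf hg
    have hG : ‖∏ i ∈ s, f i‖ ≤ 1 := by
      rw [norm_prod]
      exact Finset.prod_le_one (fun _ _ => norm_nonneg _) hf.2
    rw [Finset.prod_insert hi, Finset.prod_insert hi, Finset.sum_insert hi]
    calc _ = ‖(f i - g i) * ∏ j ∈ s, f j + g i * (∏ j ∈ s, f j - ∏ j ∈ s, g j)‖ := by ring_nf
      _ ≤ ‖f i - g i‖ * ‖∏ j ∈ s, f j‖ + ‖g i‖ * ‖∏ j ∈ s, f j - ∏ j ∈ s, g j‖ := by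
        refine (norm_add_le _ _).trans ?_
        rw [norm_mul, norm_mul]
      _ ≤ ‖f i - g i‖ * 1 + 1 * ∑ j ∈ s, ‖f j - g j‖ := by
        gcongr
        · exact hg.1
        · exact ih hf.2 hg.2
      _ = _ := by ring

lemma norm_mul_sub_mul_le {z w z' w' : ℂ} (hz : ‖z‖ ≤ 1) (hw' : ‖w'‖ ≤ 1) :
    ‖z * w - z' * w'‖ ≤ ‖z - z'‖ + ‖w - w'‖ := by
  calc _ = ‖(z - z') * w' + z * (w - w')‖ := by ring_nf
    _ ≤ ‖z - z'‖ * ‖w'‖ + ‖z‖ * ‖w - w'‖ := by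
      refine (norm_add_le _ _).trans ?_
      rw [norm_mul, norm_mul]
    _ ≤ ‖z - z'‖ * 1 + 1 * ‖w - w'‖ := by gcongr
    _ = _ := by ring

lemma norm_cexp_le_one {z : ℂ} (hz : z.re ≤ 0) : ‖Complex.exp z‖ ≤ 1 := by
  rw [Complex.norm_exp]; exact Real.exp_le_one_iff.2 hz

/-- The left half-plane is convex and the derivative of `exp` has norm at most `1` there. -/
lemma norm_cexp_sub_cexp_le {z w : ℂ} (hz : z.re ≤ 0) (hw : w.re ≤ 0) :
    ‖Complex.exp z - Complex.exp w‖ ≤ ‖z - w‖ := by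
  have h := (convex_halfSpace_re_le 0).norm_image_sub_le_of_norm_deriv_le (f := Complex.exp)
    (C := 1) (fun x _ => Complex.differentiableAt_exp)
    (fun x hx => by rw [Complex.deriv_exp]; exact norm_cexp_le_one hx) hw hz
  simpa using h

lemma norm_one_add_smul_le_one {r : ℝ} {h : ℂ} (hr0 : 0 ≤ r) (hr1 : r ≤ 1) (hh : ‖1 + h‖ ≤ 1) :
    ‖1 + r * h‖ ≤ 1 := by
  calc ‖1 + r * h‖ = ‖((1 - r : ℝ) : ℂ) + r * (1 + h)‖ := by push_cast; ring_nf
    _ ≤ ‖((1 - r : ℝ) : ℂ)‖ + ‖(r : ℂ) * (1 + h)‖ := norm_add_le _ _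
    _ ≤ (1 - r) + r * 1 := by
      rw [norm_mul, Complex.norm_of_nonneg (by linarith), Complex.norm_of_nonneg hr0]
      gcongr
    _ = 1 := by ring

lemma re_nonpos_of_norm_one_add_le {h : ℂ} (hh : ‖1 + h‖ ≤ 1) : h.re ≤ 0 := by
  have := (Complex.re_le_norm (1 + h)).trans hh
  simp at this
  linarith

/-- Poisson approximation on the Fourier side. Factors stay in the unit disc, so errors add up. Each
one is `|e^x - 1 - x| ≤ |x|²` with `|x| ≤ 2 r`, which gives the `4`; the bound `r ≤ 1 / 2` ensures
`|x| ≤ 1`. -/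
lemma norm_prod_one_add_sub_cexp_le {ι : Type*} (s : Finset ι) {r : ι → ℝ} {h : ι → ℂ} {X : ℂ}
    (hr0 : ∀ i ∈ s, 0 ≤ r i) (hr1 : ∀ i ∈ s, r i ≤ 1 / 2) (hh : ∀ i ∈ s, ‖1 + h i‖ ≤ 1)
    (hX : X.re ≤ 0) :
    ‖∏ i ∈ s, (1 + r i * h i) - Complex.exp X‖ ≤
      4 * ∑ i ∈ s, r i ^ 2 + ‖∑ i ∈ s, r i * h i - X‖ := by
  have hre : ∀ i ∈ s, (r i * h i : ℂ).re ≤ 0 := fun i hi => by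
    rw [Complex.re_ofReal_mul]
    exact mul_nonpos_of_nonneg_of_nonpos (hr0 i hi) (re_nonpos_of_norm_one_add_le (hh i hi))
  have hn : ∀ i ∈ s, ‖(r i * h i : ℂ)‖ ≤ 2 * r i := fun i hi => by
    have h2 : ‖h i‖ ≤ 2 := by
      calc ‖h i‖ = ‖(1 + h i) - 1‖ := by ring_nf
        _ ≤ ‖1 + h i‖ + ‖(1 : ℂ)‖ := norm_sub_le _ _
        _ ≤ 2 := by rw [norm_one]; linarith [hh i hi]
    rw [norm_mul, Complex.norm_of_nonneg (hr0 i hi)]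
    nlinarith [hr0 i hi]
  have h1 : ‖∏ i ∈ s, (1 + r i * h i) - Complex.exp (∑ i ∈ s, r i * h i)‖ ≤
      4 * ∑ i ∈ s, r i ^ 2 := by
    rw [Complex.exp_sum, Finset.mul_sum]
    refine (norm_prod_sub_prod_le s
      (fun i hi => norm_one_add_smul_le_one (hr0 i hi) (by linarith [hr1 i hi]) (hh i hi))
      (fun i hi => norm_cexp_le_one (hre i hi))).trans (Finset.sum_le_sum fun i hi => ?_)
    have := Complex.norm_exp_sub_one_sub_id_le (x := r i * h i)
      ((hn i hi).trans (by linarith [hr1 i hi]))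
    rw [norm_sub_rev, ← sub_sub]
    refine this.trans ?_
    nlinarith [hn i hi, norm_nonneg (r i * h i : ℂ)]
  have h2 := norm_cexp_sub_cexp_le (z := ∑ i ∈ s, r i * h i) (w := X)
    (by rw [Complex.re_sum]; exact Finset.sum_nonpos hre) hX
  calc _ ≤ _ := norm_sub_le_norm_sub_add_norm_sub _ _ _
    _ ≤ _ := add_le_add h1 h2

/-- Lévy's continuity theorem, uniformly over arrays of measures. -/
lemma eventually_integral_of_charFun {E : Type*} [NormedAddCommGroup E] [InnerProductSpace ℝ E]
    [FiniteDimensional ℝ E] [MeasurableSpace E] [BorelSpace E] {J : ℕ → Type*}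
    {V : ∀ n, J n → Prop} {μ : ∀ n, J n → Measure E} {ν : Measure E} [IsProbabilityMeasure ν]
    (hprob : ∀ᶠ n in atTop, ∀ j, V n j → IsProbabilityMeasure (μ n j))
    (h : ∀ θ, ∀ ε > 0, ∀ᶠ n in atTop, ∀ j, V n j → ‖charFun (μ n j) θ - charFun ν θ‖ < ε)
    (φ : E →ᵇ ℂ) : ∀ ε > 0, ∀ᶠ n in atTop, ∀ j, V n j →
      ‖∫ x, φ x ∂μ n j - ∫ x, φ x ∂ν‖ < ε := by
  intro ε hε
  -- If uniformity failed, choosing a bad index along a subsequence would contradict the sequential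
  -- theorem.
  by_contra hcon
  obtain ⟨g, hg, hbad⟩ := extraction_of_frequently_atTop
    ((not_eventually.1 hcon).and_eventually hprob)
  have hbad' : ∀ k, ∃ j, V (g k) j ∧ ¬ ‖∫ x, φ x ∂μ (g k) j - ∫ x, φ x ∂ν‖ < ε := fun k => by
    have := (hbad k).1
    push Not at this
    obtain ⟨j, hj, hj'⟩ := this
    exact ⟨j, hj, not_lt.2 hj'⟩
  choose j hV hj using hbad'
  let M : ℕ → ProbabilityMeasure E := fun k => ⟨μ (g k) (j k), (hbad k).2 _ (hV k)⟩
  let N : ProbabilityMeasure E := ⟨ν, inferInstance⟩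
  have hM : Tendsto M atTop (𝓝 N) := by
    refine ProbabilityMeasure.tendsto_of_tendsto_charFun fun θ => ?_
    rw [Metric.tendsto_nhds]
    intro δ hδ
    filter_upwards [hg.tendsto_atTop.eventually (h θ δ hδ)] with k hk
    rw [dist_eq_norm]
    exact hk _ (hV k)
  rw [ProbabilityMeasure.tendsto_iff_forall_integral_rclike_tendsto ℂ] at hM
  obtain ⟨k, hk⟩ := ((Metric.tendsto_nhds.1 (hM φ)) ε hε).exists
  rw [dist_eq_norm] at hk
  exact hj k hk

section law

variable {n : ℕ} {S : Finset (Fin n)} {p q α : ℝ}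

/-- The conditional law of the configuration given that the community is `S`. -/
def condLaw (S : Finset (Fin n)) (p q α : ℝ) : Measure (Config n) :=
  Measure.sum fun ω : Config n => ENNReal.ofReal (condWeight S p q α ω) • Measure.dirac ω

lemma integral_condLaw {E : Type*} [NormedAddCommGroup E] [NormedSpace ℝ E]
    [FiniteDimensional ℝ E] (hw : ∀ ω, 0 ≤ condWeight S p q α ω) (F : Config n → E) :
    ∫ ω, F ω ∂condLaw S p q α = condMean S p q α F := by
  rw [condLaw, integral_sum_dirac (by simp), tsum_fintype]
  simp only [ENNReal.toReal_ofReal (hw _)]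
  rfl

lemma isProbabilityMeasure_condLaw (hw : ∀ ω, 0 ≤ condWeight S p q α ω)
    (h1 : condMean S p q α (fun _ => (1 : ℝ)) = 1) : IsProbabilityMeasure (condLaw S p q α) := by
  rw [← integral_condLaw hw] at h1
  simp only [integral_const, smul_eq_mul, mul_one] at h1
  exact ⟨(ENNReal.toReal_eq_one_iff _).1 h1⟩

lemma eventually_model {a b : ℝ} (hα0 : 0 < α) (hα1 : α < 1) (hb : 0 < b) (hab : b < a) :
    ∀ᶠ n : ℕ in atTop, 0 < n ∧ a / n ≤ 1 / 2 ∧ ∀ S : Finset (Fin n),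
      (∀ ω, 0 ≤ condWeight S (a / n) (b / n) α ω) ∧
      condMean S (a / n) (b / n) α (fun _ => (1 : ℝ)) = 1 ∧
      (∀ i j, 0 ≤ edgeProb S (a / n) (b / n) i j) ∧
      (∀ i j, edgeProb S (a / n) (b / n) i j ≤ a / n) := by
  have h := (tendsto_const_div_atTop_nhds_zero_nat a).eventually_lt_const
    (show (0 : ℝ) < 1 / 2 by norm_num)
  filter_upwards [h, eventually_gt_atTop 0] with n hn hn0
  have hn' : (0 : ℝ) < n := by exact_mod_cast hn0
  have ha : 0 < a / n := div_pos (hb.trans hab) hn'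
  have hbn : 0 < b / n := div_pos hb hn'
  have hle : b / n ≤ a / n := by gcongr
  refine ⟨hn0, hn.le, fun S => ⟨condWeight_nonneg ha.le (by linarith) hbn.le (by linarith) hα0.le
    hα1, condMean_one ha.le (by linarith) hbn.le (by linarith) hα0.le hα1, fun i j => ?_,
    fun i j => ?_⟩⟩
  · exact (edgeProb_mem ha.le (by linarith) hbn.le (by linarith) i j).1
  · unfold edgeProb
    split_ifs
    exacts [le_rfl, hle]

lemma condMean_const {E : Type*} [AddCommGroup E] [Module ℝ E]
    (h1 : condMean S p q α (fun _ => (1 : ℝ)) = 1) (c : E) :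
    condMean S p q α (fun _ => c) = c := by
  have : condMean S p q α (fun _ => c) = condMean S p q α (fun _ => (1 : ℝ)) • c := by
    simp [condMean, Finset.sum_smul]
  rw [this, h1, one_smul]

lemma norm_condMean_sub_le {E : Type*} [NormedAddCommGroup E] [NormedSpace ℝ E]
    (hw : ∀ ω, 0 ≤ condWeight S p q α ω) (h1 : condMean S p q α (fun _ => (1 : ℝ)) = 1)
    (F : Config n → E) (c : E) :
    ‖condMean S p q α F - c‖ ≤ condMean S p q α fun ω => ‖F ω - c‖ := by
  have := norm_condMean_le hw fun ω => F ω - c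
  rwa [condMean_sub, condMean_const h1] at this

end law
end

/-! ### Pairwise asymptotic independence, with cues included. -/

noncomputable section
open scoped Classical

/-- The self-avoiding message in posterior form. -/
def saPosterior {n : ℕ} (K : ℕ) (p q α : ℝ) (ω : Config n) (t : ℕ) (A : Finset (Fin n))
    (i : Fin n) : ℝ :=
  saMessage K p q α ω t A i - priorLogOdds n K α

/-- The value `c` at a cue, and `φ` of the message at other nodes. -/
def cueOr {n : ℕ} (φ : ℝ → ℂ) (c : ℂ) (ω : Config n) (l : Fin n) (r : ℝ) : ℂ :=
  if l ∈ ω.cues then c else φ r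

/-- The probability that a node with label `x` is a cue. -/
def labelCueRate (α : ℝ) (x : Bool) : ℝ := if x then α else 0

/-- The limiting fraction of nodes with label `x`. -/
def labelFraction (κ : ℝ) (x : Bool) : ℝ := if x then κ else 1 - κ

/-- The limiting expectation of `cueOr φ c`. -/
def mixedMean (α : ℝ) (x : Bool) (ν : Measure ℝ) (φ : ℝ → ℂ) (c : ℂ) : ℂ :=
  labelCueRate α x * c + (1 - labelCueRate α x) * ∫ r, φ r ∂ν

/-- The messages of two distinct nodes are asymptotically independent with laws `messageLaw`,
uniformly over the community, the excluded nodes and the two nodes. -/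
def PairLimit (κ α a b : ℝ) (K : ℕ → ℕ) (t : ℕ) : Prop :=
  ∀ (φ ψ : ℝ →ᵇ ℂ) (x y : Bool) (k : ℕ), ∀ ε > 0, ∀ᶠ n : ℕ in atTop,
    ∀ (S A : Finset (Fin n)) (l m : Fin n), S.card = K n → A.card ≤ k → l ∉ A → m ∉ A → l ≠ m →
      (l ∈ S ↔ x = true) → (m ∈ S ↔ y = true) →
      ‖condMean S (a / n) (b / n) α (fun ω =>
          φ (saPosterior (K n) (a / n) (b / n) α ω t (insert m A) l) *
          ψ (saPosterior (K n) (a / n) (b / n) α ω t (insert l A) m)) -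
        (∫ r, φ r ∂messageLaw κ α a b t x) * ∫ r, ψ r ∂messageLaw κ α a b t y‖ < ε

/-- The average of `cueOr φ c` over the nodes with label `x`. -/
def labelAverage {n : ℕ} (K : ℕ) (p q α : ℝ) (φ : ℝ → ℂ) (c : ℂ) (t : ℕ) (S A : Finset (Fin n))
    (x : Bool) (ω : Config n) : ℂ :=
  (n : ℂ)⁻¹ * ∑ l ∈ Aᶜ with (l ∈ S ↔ x = true),
    cueOr φ c ω l (saPosterior K p q α ω t A l)

/-- The empirical averages over the messages concentrate around their limits. -/
def EmpiricalLimit (κ α a b : ℝ) (K : ℕ → ℕ) (t : ℕ) : Prop :=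
  ∀ (φ : ℝ →ᵇ ℂ) (c : ℂ) (x : Bool) (k : ℕ), ∀ ε > 0, ∀ᶠ n : ℕ in atTop,
    ∀ S A : Finset (Fin n), S.card = K n → A.Nonempty → A.card ≤ k →
      condMean S (a / n) (b / n) α (fun ω =>
        ‖labelAverage (K n) (a / n) (b / n) α φ c t S A x ω -
          labelFraction κ x * mixedMean α x (messageLaw κ α a b t x) φ c‖) < ε

section

variable {n : ℕ} {S : Finset (Fin n)} {p q α : ℝ}

lemma condMean_ite_cue_else {V : Type*} [AddCommGroup V] [Module ℝ V] (x : Fin n)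
    {Φ Ψ : Config n → V} (hΦ : ∀ ω, Φ (toggleCue x ω) = Φ ω)
    (hΨ : ∀ ω, Ψ (toggleCue x ω) = Ψ ω) :
    condMean S p q α (fun ω => if x ∈ ω.cues then Φ ω else Ψ ω) =
      cueProb S α x • condMean S p q α Φ + (1 - cueProb S α x) • condMean S p q α Ψ := by
  rw [← condMean_ite_cue x hΦ, ← condMean_ite_not_cue x hΨ, ← condMean_add]
  congr with ω
  split_ifs <;> simp

lemma condMean_cue_mul_cue {l m : Fin n} (hlm : l ≠ m) (c c' : ℂ) {F G : Config n → ℂ}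
    (h1 : condMean S p q α (fun _ => (1 : ℝ)) = 1)
    (hFl : ∀ ω, F (toggleCue l ω) = F ω) (hFm : ∀ ω, F (toggleCue m ω) = F ω)
    (hGl : ∀ ω, G (toggleCue l ω) = G ω) (hGm : ∀ ω, G (toggleCue m ω) = G ω) :
    condMean S p q α (fun ω => (if l ∈ ω.cues then c else F ω) *
        (if m ∈ ω.cues then c' else G ω)) =
      cueProb S α l * (cueProb S α m * (c * c') +
        (1 - cueProb S α m) * (c * condMean S p q α G)) +
      (1 - cueProb S α l) * (cueProb S α m * (c' * condMean S p q α F) +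
        (1 - cueProb S α m) * condMean S p q α (fun ω => F ω * G ω)) := by
  have hM : ∀ ω, (if m ∈ (toggleCue l ω).cues then c' else G (toggleCue l ω)) =
      if m ∈ ω.cues then c' else G ω := fun ω => by
    simp only [mem_toggleCue_of_ne hlm.symm, hGl]
  have e (u : Config n → ℂ) (hu : ∀ ω, u (toggleCue m ω) = u ω) :
      condMean S p q α (fun ω => u ω * if m ∈ ω.cues then c' else G ω) =
      cueProb S α m * condMean S p q α (fun ω => c' * u ω) +
        (1 - cueProb S α m) * condMean S p q α (fun ω => u ω * G ω) := by
    have := condMean_ite_cue_else (S := S) (p := p) (q := q) (α := α) m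
      (Φ := fun ω => c' * u ω) (Ψ := fun ω => u ω * G ω) (by simp [hu]) (by simp [hu, hGm])
    simp only [Complex.real_smul] at this
    push_cast at this
    rw [← this]
    congr with ω
    split_ifs <;> ring
  have h := condMean_ite_cue_else (S := S) (p := p) (q := q) (α := α) l
    (Φ := fun ω => c * if m ∈ ω.cues then c' else G ω)
    (Ψ := fun ω => F ω * if m ∈ ω.cues then c' else G ω)
    (fun ω => by rw [hM]) (fun ω => by rw [hM, hFl])
  rw [e _ (fun _ => rfl), e _ hFm, condMean_mul_left, condMean_mul_left, condMean_mul_left,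
    condMean_const h1] at h
  simp only [Complex.real_smul] at h
  push_cast at h
  rw [mul_comm c c', ← h]
  congr with ω
  split_ifs <;> rfl

lemma cueProb_eq {x : Bool} {l : Fin n} (h : l ∈ S ↔ x = true) :
    cueProb S α l = labelCueRate α x := by
  unfold cueProb labelCueRate
  simp only [h]

lemma norm_cueOr_le {φ : ℝ → ℂ} {c : ℂ} {B : ℝ} (hφ : ∀ r, ‖φ r‖ ≤ B) (hc : ‖c‖ ≤ B)
    (ω : Config n) (l : Fin n) (r : ℝ) : ‖cueOr φ c ω l r‖ ≤ B := by
  unfold cueOr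
  split_ifs
  exacts [hc, hφ r]

/-- Changing the excluded set changes few messages. -/
lemma norm_cueOr_sub_le {K : ℕ} {φ : ℝ → ℂ} {c : ℂ} {B : ℝ} (hφ : ∀ r, ‖φ r‖ ≤ B) {t : ℕ}
    {A A' : Finset (Fin n)} {u l : Fin n} (hu : u ∈ A) (hu' : u ∈ A') (hl : l ∉ A) (hl' : l ∉ A')
    (ω : Config n) :
    ‖cueOr φ c ω l (saPosterior K p q α ω t A l) -
      cueOr φ c ω l (saPosterior K p q α ω t A' l)‖ ≤
      2 * B * (returnCount ω t A u l + returnCount ω t A' u l) := by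
  have hB : 0 ≤ B := (norm_nonneg _).trans (hφ 0)
  unfold cueOr
  split_ifs
  · rw [sub_self, norm_zero]
    have := returnCount_nonneg ω t A u l
    have := returnCount_nonneg ω t A' u l
    positivity
  · have h1 := norm_sub_le_returnCount (K := K) (p := p) (q := q) (α := α) (ω := ω) (t := t) hu hl
      (F := fun r => φ (r - priorLogOdds n K α)) fun r => hφ _
    have h2 := norm_sub_le_returnCount (K := K) (p := p) (q := q) (α := α) (ω := ω) (t := t) hu' hl'
      (F := fun r => φ (r - priorLogOdds n K α)) fun r => hφ _
    rw [norm_sub_rev] at h1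
    unfold saPosterior
    rw [mul_add]
    exact (norm_sub_le_norm_sub_add_norm_sub _ _ _).trans (add_le_add h1 h2)

end

lemma labelCueRate_mem {α : ℝ} (hα0 : 0 < α) (hα1 : α < 1) (x : Bool) :
    0 ≤ labelCueRate α x ∧ labelCueRate α x ≤ 1 := by
  unfold labelCueRate
  split_ifs <;> constructor <;> linarith

variable {κ α a b : ℝ} {K : ℕ → ℕ}

/-- In `PairLimit` each message avoids the other node; here both avoid only `A`, as empirical
averages require. The former messages do not read the cues at `l` and `m`, so these can be averaged
out exactly; changing the excluded sets then costs only return counts, `O(1/n)`. -/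
lemma PairLimit.cueOr_mul (hα0 : 0 < α) (hα1 : α < 1) (hb : 0 < b) (hab : b < a)
    {t : ℕ} (H : PairLimit κ α a b K t) (φ ψ : ℝ →ᵇ ℂ) (c c' : ℂ) (x : Bool) (k : ℕ) :
    ∀ ε > 0, ∀ᶠ n : ℕ in atTop,
    ∀ (S A : Finset (Fin n)) (l m : Fin n), S.card = K n → A.Nonempty → A.card ≤ k →
      l ∉ A → m ∉ A → l ≠ m → (l ∈ S ↔ x = true) → (m ∈ S ↔ x = true) →
      ‖condMean S (a / n) (b / n) α (fun ω =>
          cueOr φ c ω l (saPosterior (K n) (a / n) (b / n) α ω t A l) *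
          cueOr ψ c' ω m (saPosterior (K n) (a / n) (b / n) α ω t A m)) -
        mixedMean α x (messageLaw κ α a b t x) φ c *
        mixedMean α x (messageLaw κ α a b t x) ψ c'‖ < ε := by
  intro ε hε
  obtain ⟨B, hB0, hB1, hB2, hB3, hB4⟩ : ∃ B : ℝ, 0 < B ∧ ‖c‖ ≤ B ∧ ‖c'‖ ≤ B ∧ (∀ r, ‖φ r‖ ≤ B) ∧
      ∀ r, ‖ψ r‖ ≤ B := by
    refine ⟨‖c‖ + ‖c'‖ + ‖φ‖ + ‖ψ‖ + 1, by positivity, ?_, ?_, fun r => ?_, fun r => ?_⟩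
    · linarith [norm_nonneg c', norm_nonneg φ, norm_nonneg ψ]
    · linarith [norm_nonneg c, norm_nonneg φ, norm_nonneg ψ]
    · linarith [norm_nonneg c', norm_nonneg c, φ.norm_coe_le_norm r, norm_nonneg ψ]
    · linarith [norm_nonneg c', norm_nonneg c, ψ.norm_coe_le_norm r, norm_nonneg φ]
  set δ := ε / (2 * (2 * B + 1)) with hδ_def
  have hδ : 0 < δ := by positivity
  have ha : 0 < a := hb.trans hab
  set C := returnBound a t (k + 1) with hC_def
  have hC : 0 ≤ C := returnBound_nonneg ha.le _ _
  have hlim : Tendsto (fun n : ℕ => (8 * B ^ 2 * C) * (a / n)) atTop (𝓝 0) := by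
    simpa using (tendsto_const_div_atTop_nhds_zero_nat a).const_mul (8 * B ^ 2 * C)
  -- The constant test function `1` extracts the one-message marginals.
  filter_upwards [H φ ψ x x k δ hδ, H φ (BoundedContinuousFunction.const ℝ 1) x x k δ hδ,
    H (BoundedContinuousFunction.const ℝ 1) ψ x x k δ hδ, eventually_model hα0 hα1 hb hab,
    hlim.eventually_lt_const (show (0 : ℝ) < ε / 2 by positivity)]
    with n h1 h2 h3 hn h5 S A l m hS hA hAk hl hm hlm hlx hmx
  obtain ⟨hn0, -, hmod⟩ := hn
  obtain ⟨hw, hone, he0, he1⟩ := hmod S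
  have hn' : (0 : ℝ) < n := by exact_mod_cast hn0
  -- Return counts need a previous node in the excluded set, whence the nonemptiness of `A`.
  obtain ⟨u, hu⟩ := hA
  have hlA : l ∉ insert m A := by simp [hlm, hl]
  have hmA : m ∉ insert l A := by simp [hlm.symm, hm]
  set Y : Finset (Fin n) → Fin n → Config n → ℝ := fun A l ω =>
    saPosterior (K n) (a / n) (b / n) α ω t A l with hY
  have hYl : ∀ v ∈ insert l (insert m A), ∀ ω, Y (insert m A) l (toggleCue v ω) =
      Y (insert m A) l ω := fun v hv ω => by
    simp only [hY, saPosterior, saMessage_toggleCue hlA hv]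
  have hYm : ∀ v ∈ insert m (insert l A), ∀ ω, Y (insert l A) m (toggleCue v ω) =
      Y (insert l A) m ω := fun v hv ω => by
    simp only [hY, saPosterior, saMessage_toggleCue hmA hv]
  have hmain := condMean_cue_mul_cue (S := S) (p := a / n) (q := b / n) (α := α) hlm c c'
    (F := fun ω => φ (Y (insert m A) l ω)) (G := fun ω => ψ (Y (insert l A) m ω)) hone
    (fun ω => by rw [hYl l (by simp)]) (fun ω => by rw [hYl m (by simp)])
    (fun ω => by rw [hYm l (by simp)]) (fun ω => by rw [hYm m (by simp)])
  have h1' := h1 S A l m hS hAk hl hm hlm hlx hmx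
  have h2' := h2 S A l m hS hAk hl hm hlm hlx hmx
  have h3' := h3 S A l m hS hAk hl hm hlm hlx hmx
  simp only [BoundedContinuousFunction.const_apply, mul_one, one_mul, integral_const,
    probReal_univ, one_smul] at h2' h3'
  have hmain' : ‖condMean S (a / n) (b / n) α (fun ω =>
      cueOr φ c ω l (Y (insert m A) l ω) * cueOr ψ c' ω m (Y (insert l A) m ω)) -
      mixedMean α x (messageLaw κ α a b t x) φ c *
        mixedMean α x (messageLaw κ α a b t x) ψ c'‖ ≤ (2 * B + 1) * δ := by
    unfold cueOr mixedMean
    rw [hmain, cueProb_eq hlx, cueProb_eq hmx]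
    obtain ⟨hr0, hr1⟩ := labelCueRate_mem hα0 hα1 x
    set r := labelCueRate α x
    set If := ∫ s, φ s ∂messageLaw κ α a b t x
    set Ig := ∫ s, ψ s ∂messageLaw κ α a b t x
    set EF := condMean S (a / n) (b / n) α fun ω => φ (Y (insert m A) l ω)
    set EG := condMean S (a / n) (b / n) α fun ω => ψ (Y (insert l A) m ω)
    set EFG := condMean S (a / n) (b / n) α fun ω =>
      φ (Y (insert m A) l ω) * ψ (Y (insert l A) m ω)
    have hid : (r : ℂ) * (r * (c * c') + (1 - r) * (c * EG)) +
        (1 - r) * (r * (c' * EF) + (1 - r) * EFG) -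
        (r * c + (1 - r) * If) * (r * c' + (1 - r) * Ig) =
        ((r * (1 - r) : ℝ) : ℂ) * (c * (EG - Ig)) + ((r * (1 - r) : ℝ) : ℂ) * (c' * (EF - If)) +
        (((1 - r) * (1 - r) : ℝ) : ℂ) * (EFG - If * Ig) := by
      push_cast; ring
    rw [hid]
    have b1 : 0 ≤ r * (1 - r) := mul_nonneg hr0 (by linarith)
    have b2 : r * (1 - r) ≤ 1 := by nlinarith
    have b3 : 0 ≤ (1 - r) * (1 - r) := mul_self_nonneg _
    have b4 : (1 - r) * (1 - r) ≤ 1 := by nlinarith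
    refine (norm_add₃_le).trans ?_
    rw [norm_mul, norm_mul, norm_mul, norm_mul, norm_mul, Complex.norm_of_nonneg b1,
      Complex.norm_of_nonneg b3]
    calc _ ≤ 1 * (B * δ) + 1 * (B * δ) + 1 * δ := by gcongr
      _ = _ := by ring
  -- Four return counts, each of mean at most `C * (a / n)`, with coefficient `2 B²`.
  have hswap : ‖condMean S (a / n) (b / n) α (fun ω =>
      cueOr φ c ω l (Y A l ω) * cueOr ψ c' ω m (Y A m ω)) -
      condMean S (a / n) (b / n) α (fun ω =>
      cueOr φ c ω l (Y (insert m A) l ω) * cueOr ψ c' ω m (Y (insert l A) m ω))‖ ≤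
      8 * B ^ 2 * C * (a / n) := by
    rw [← condMean_sub]
    have hD : (n : ℝ) * (a / n) ≤ a := by rw [mul_div_cancel₀ _ hn'.ne']
    have hrc : ∀ (A' : Finset (Fin n)) (v : Fin n), u ∈ A' → v ∉ A' → A'.card ≤ k + 1 →
        condMean S (a / n) (b / n) α (fun ω => returnCount ω t A' u v) ≤ C * (a / n) :=
      fun A' v hu' hv' hc => (condMean_returnCount_le hw hone he1 (by positivity) hD hu' hv').trans
        (mul_le_mul_of_nonneg_right (returnBound_mono ha.le t hc) (by positivity))
    have hu1 : ∀ v, u ∈ insert v A := fun v => Finset.mem_insert_of_mem hu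
    have hc1 : ∀ v, (insert v A).card ≤ k + 1 := fun v =>
      (Finset.card_insert_le _ _).trans (by omega)
    refine (norm_condMean_le hw _).trans ((condMean_mono hw
      (F' := fun ω => (2 * B ^ 2) * ((returnCount ω t A u l + returnCount ω t (insert m A) u l) +
        (returnCount ω t A u m + returnCount ω t (insert l A) u m))) fun ω _ => ?_).trans ?_)
    · have d1 := norm_cueOr_sub_le (K := K n) (p := a / n) (q := b / n) (α := α) (c := c) hB3
        (t := t) hu (hu1 m) hl hlA ω
      have d2 := norm_cueOr_sub_le (K := K n) (p := a / n) (q := b / n) (α := α) (c := c') hB4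
        (t := t) hu (hu1 l) hm hmA ω
      have e1 := norm_cueOr_le hB3 hB1 ω l (Y A l ω)
      have e2 := norm_cueOr_le hB4 hB2 ω m (Y (insert l A) m ω)
      simp only [hY] at e1 e2 ⊢
      set z := cueOr φ c ω l (saPosterior (K n) (a / n) (b / n) α ω t A l)
      set z' := cueOr φ c ω l (saPosterior (K n) (a / n) (b / n) α ω t (insert m A) l)
      set w := cueOr ψ c' ω m (saPosterior (K n) (a / n) (b / n) α ω t A m)
      set w' := cueOr ψ c' ω m (saPosterior (K n) (a / n) (b / n) α ω t (insert l A) m)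
      calc ‖z * w - z' * w'‖ = ‖(z - z') * w' + z * (w - w')‖ := by ring_nf
        _ ≤ ‖z - z'‖ * ‖w'‖ + ‖z‖ * ‖w - w'‖ := by
          refine (norm_add_le _ _).trans ?_
          rw [norm_mul, norm_mul]
        _ ≤ (2 * B * (returnCount ω t A u l + returnCount ω t (insert m A) u l)) * B +
            B * (2 * B * (returnCount ω t A u m + returnCount ω t (insert l A) u m)) := by
          have := (norm_nonneg _).trans d1
          gcongr
        _ = _ := by ring
    · rw [condMean_mul_left, condMean_add, condMean_add, condMean_add]
      have r1 := hrc A l hu hl (by omega)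
      have r2 := hrc A m hu hm (by omega)
      have r3 := hrc (insert m A) l (hu1 m) hlA (hc1 m)
      have r4 := hrc (insert l A) m (hu1 l) hmA (hc1 l)
      calc _ ≤ 2 * B ^ 2 * ((C * (a / n) + C * (a / n)) + (C * (a / n) + C * (a / n))) := by
            gcongr
        _ = _ := by ring
  calc _ ≤ _ := norm_sub_le_norm_sub_add_norm_sub _ _ _
    _ ≤ 8 * B ^ 2 * C * (a / n) + (2 * B + 1) * δ := add_le_add hswap hmain'
    _ < ε / 2 + (2 * B + 1) * δ := by gcongr
    _ = ε := by rw [hδ_def]; field_simp; ring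
end

/-! ### Concentration of empirical averages by the second moment. -/

noncomputable section
open scoped Classical

variable {κ α a b : ℝ} {K : ℕ → ℕ}

lemma eventually_labelCount (hK : Tendsto (fun n => (K n : ℝ) / n) atTop (𝓝 κ)) (x : Bool)
    (k : ℕ) : ∀ ε > 0, ∀ᶠ n : ℕ in atTop, ∀ S A : Finset (Fin n), S.card = K n → A.card ≤ k →
      |((Aᶜ.filter fun l => (l ∈ S ↔ x = true)).card : ℝ) / n - labelFraction κ x| < ε := by
  intro ε hε
  have hk := (tendsto_const_div_atTop_nhds_zero_nat (k : ℝ)).eventually_lt_const (half_pos hε)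
  filter_upwards [hk, (Metric.tendsto_nhds.1 hK) (ε / 2) (half_pos hε), eventually_gt_atTop 0]
    with n h1 h2 hn S A hS hA
  have hn' : (0 : ℝ) < n := by exact_mod_cast hn
  rw [Real.dist_eq] at h2
  set T : Finset (Fin n) := Finset.univ.filter fun l => (l ∈ S ↔ x = true) with hT
  have hs : Aᶜ.filter (fun l => (l ∈ S ↔ x = true)) = T \ A := by
    ext l; simp [hT, and_comm]
  have hTc : |(T.card : ℝ) / n - labelFraction κ x| < ε / 2 := by
    cases x with
    | true =>
      have : T = S := by ext l; simp [hT]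
      rw [this, hS]
      exact h2
    | false =>
      have : T = Sᶜ := by ext l; simp [hT]
      have hle : S.card ≤ n := by simpa using Finset.card_le_univ S
      rw [this, Finset.card_compl, Fintype.card_fin, Nat.cast_sub hle, hS, sub_div,
        div_self hn'.ne']
      have : (1 - (K n : ℝ) / n) - labelFraction κ false = -((K n : ℝ) / n - κ) := by
        simp [labelFraction]
      rw [this, abs_neg]
      exact h2
  have hup : (T \ A).card ≤ T.card := Finset.card_le_card Finset.sdiff_subset
  have hlo : T.card ≤ (T \ A).card + k := by
    have := Finset.le_card_sdiff A T
    omega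
  rw [hs]
  have hup' : ((T \ A).card : ℝ) / n ≤ T.card / n := by gcongr
  have hlo' : (T.card : ℝ) / n ≤ (T \ A).card / n + k / n := by
    rw [← add_div]; gcongr; exact_mod_cast hlo
  rw [abs_lt] at hTc ⊢
  constructor <;> linarith

/-- With this form of the arithmetic-geometric inequality a second moment at most `δ²` yields a
first moment at most `δ` by linearity alone. -/
lemma norm_le_of_sq (v : ℂ) {δ : ℝ} (hδ : 0 < δ) : ‖v‖ ≤ δ / 2 + (2 * δ)⁻¹ * ‖v‖ ^ 2 := by
  have : 0 ≤ (2 * δ)⁻¹ * (‖v‖ - δ) ^ 2 := by positivity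
  have h : (2 * δ)⁻¹ * (‖v‖ - δ) ^ 2 = (2 * δ)⁻¹ * ‖v‖ ^ 2 - ‖v‖ + δ / 2 := by
    field_simp; ring
  linarith

/-- A weak law of large numbers: after centring, the second moment of the average consists of
off-diagonal covariances, which vanish uniformly by asymptotic independence, and a diagonal of order
`1/n`. -/
lemma PairLimit.empirical (hα0 : 0 < α) (hα1 : α < 1) (hb : 0 < b) (hab : b < a)
    (hK : Tendsto (fun n => (K n : ℝ) / n) atTop (𝓝 κ)) {t : ℕ} (H : PairLimit κ α a b K t) :
    EmpiricalLimit κ α a b K t := by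
  intro φ c x k ε hε
  set m := mixedMean α x (messageLaw κ α a b t x) φ c with hm_def
  -- Message values and the cue value are centred by the same `m`, so the limiting mixed mean is
  -- zero.
  set φ' : ℝ →ᵇ ℂ := φ - BoundedContinuousFunction.const ℝ m with hφ'
  have hφ'_apply : ∀ r, φ' r = φ r - m := fun r => rfl
  have hmean : mixedMean α x (messageLaw κ α a b t x) φ' (c - m) = 0 := by
    unfold mixedMean
    simp only [hφ'_apply]
    rw [integral_sub (φ.integrable _) (integrable_const _)]
    simp only [integral_const, probReal_univ, one_smul]
    rw [hm_def, mixedMean]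
    ring
  obtain ⟨B, hB0, hB1, hB2⟩ : ∃ B : ℝ, 0 < B ∧ ‖c - m‖ ≤ B ∧ ∀ r, ‖φ' r‖ ≤ B := by
    refine ⟨‖c - m‖ + ‖φ'‖ + 1, by positivity, ?_, fun r => ?_⟩
    · linarith [norm_nonneg φ']
    · linarith [norm_nonneg (c - m), φ'.norm_coe_le_norm r]
  set δ := ε / 2 with hδ_def
  have hδ : 0 < δ := by positivity
  -- Pairing `φ'` with its conjugate produces the terms of the squared modulus.
  have hcov := H.cueOr_mul hα0 hα1 hb hab φ' (star φ') (c - m) (star (c - m)) x k (δ ^ 2 / 2)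
    (by positivity)
  simp only [hmean, zero_mul, sub_zero] at hcov
  have hlim := (tendsto_const_div_atTop_nhds_zero_nat (B ^ 2)).eventually_lt_const
    (show (0 : ℝ) < δ ^ 2 / 2 by positivity)
  filter_upwards [hcov, hlim, eventually_model hα0 hα1 hb hab,
    eventually_labelCount hK x k (ε / (2 * (‖m‖ + 1))) (by positivity)]
    with n h1 h2 hn h4 S A hS hA hAk
  obtain ⟨hn0, -, hmod⟩ := hn
  obtain ⟨hw, hone, -, -⟩ := hmod S
  have hn' : (0 : ℝ) < n := by exact_mod_cast hn0
  set s := Aᶜ.filter fun l => (l ∈ S ↔ x = true) with hs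
  set Y : Fin n → Config n → ℝ := fun l ω => saPosterior (K n) (a / n) (b / n) α ω t A l with hY
  set h : Fin n → Config n → ℂ := fun l ω => cueOr φ' (c - m) ω l (Y l ω) with hh
  have hstar : ∀ l ω, cueOr (star φ') (star (c - m)) ω l (Y l ω) = star (h l ω) := fun l ω => by
    simp only [hh, cueOr]
    split_ifs <;> rfl
  have hnorm : ∀ l ω, ‖h l ω‖ ≤ B := fun l ω => norm_cueOr_le hB2 hB1 _ _ _
  have hmem : ∀ l ∈ s, l ∉ A ∧ (l ∈ S ↔ x = true) := fun l hl => by simpa [hs] using hl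
  have hscard : (s.card : ℝ) ≤ n := by exact_mod_cast (by simpa using Finset.card_le_univ s)
  have hpair : ∀ l ∈ s, ∀ v ∈ s, ‖condMean S (a / n) (b / n) α fun ω => h l ω * star (h v ω)‖ ≤
      δ ^ 2 / 2 + if l = v then B ^ 2 else 0 := by
    intro l hl v hv
    split_ifs with hlv
    · refine (norm_condMean_le hw _).trans ((condMean_mono hw (F' := fun _ => B ^ 2)
        fun ω _ => ?_).trans ?_)
      · rw [norm_mul, norm_star, sq]
        exact mul_le_mul (hnorm _ _) (hnorm _ _) (norm_nonneg _) hB0.le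
      · rw [condMean_const hone]
        linarith [sq_nonneg δ]
    · have := h1 S A l v hS hA hAk (hmem l hl).1 (hmem v hv).1 hlv (hmem l hl).2 (hmem v hv).2
      rw [add_zero]
      refine le_of_eq_of_le ?_ this.le
      congr 2 with ω
      rw [← hstar]
      rfl
  set V : Config n → ℂ := fun ω => (n : ℂ)⁻¹ * ∑ l ∈ s, h l ω with hV
  have hsecond : condMean S (a / n) (b / n) α (fun ω => ‖V ω‖ ^ 2) ≤ δ ^ 2 := by
    have hexp : ((condMean S (a / n) (b / n) α (fun ω => ‖V ω‖ ^ 2) : ℝ) : ℂ) =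
        ((n : ℂ)⁻¹ * (n : ℂ)⁻¹) * ∑ l ∈ s, ∑ v ∈ s,
          condMean S (a / n) (b / n) α fun ω => h l ω * star (h v ω) := by
      rw [← Finset.sum_congr rfl fun l _ => condMean_sum s fun v ω => h l ω * star (h v ω),
        ← condMean_sum, ← condMean_mul_left]
      simp only [condMean, Complex.ofReal_sum, smul_eq_mul, Complex.real_smul,
        Complex.ofReal_mul]
      refine Finset.sum_congr rfl fun ω _ => ?_
      congr 1
      have : ((‖V ω‖ ^ 2 : ℝ) : ℂ) = V ω * star (V ω) := by
        rw [Complex.star_def, Complex.mul_conj, Complex.normSq_eq_norm_sq]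
      rw [this, hV]
      simp only [star_mul', star_sum, star_inv₀, star_natCast]
      rw [mul_mul_mul_comm, Finset.sum_mul_sum]
    have hle : ‖((condMean S (a / n) (b / n) α (fun ω => ‖V ω‖ ^ 2) : ℝ) : ℂ)‖ ≤ δ ^ 2 := by
      rw [hexp, norm_mul, norm_mul, norm_inv, Complex.norm_natCast]
      calc _ ≤ (n : ℝ)⁻¹ * (n : ℝ)⁻¹ * ∑ l ∈ s, ∑ v ∈ s,
              (δ ^ 2 / 2 + if l = v then B ^ 2 else 0) := by
            gcongr
            refine (norm_sum_le _ _).trans (Finset.sum_le_sum fun l hl => ?_)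
            exact (norm_sum_le _ _).trans (Finset.sum_le_sum fun v hv => hpair l hl v hv)
        _ = (n : ℝ)⁻¹ * (n : ℝ)⁻¹ * (s.card * s.card * (δ ^ 2 / 2) + s.card * B ^ 2) := by
            congr 1
            simp only [Finset.sum_add_distrib, Finset.sum_const, nsmul_eq_mul, Finset.sum_ite_eq]
            rw [← Finset.sum_filter, Finset.filter_mem_eq_inter, Finset.inter_self,
              Finset.sum_const, nsmul_eq_mul]
            ring
        _ ≤ (n : ℝ)⁻¹ * (n : ℝ)⁻¹ * (n * n * (δ ^ 2 / 2) + n * B ^ 2) := by gcongr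
        _ = δ ^ 2 / 2 + B ^ 2 / n := by field_simp
        _ ≤ δ ^ 2 := by linarith
    exact (le_abs_self _).trans (by rwa [Complex.norm_real, Real.norm_eq_abs] at hle)
  have hfirst : condMean S (a / n) (b / n) α (fun ω => ‖V ω‖) ≤ δ := by
    calc _ ≤ condMean S (a / n) (b / n) α (fun ω => δ / 2 + (2 * δ)⁻¹ * ‖V ω‖ ^ 2) :=
          condMean_mono hw fun ω _ => norm_le_of_sq _ hδ
      _ = δ / 2 + (2 * δ)⁻¹ * condMean S (a / n) (b / n) α (fun ω => ‖V ω‖ ^ 2) := by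
          rw [condMean_add, condMean_mul_left, condMean_const hone]
      _ ≤ δ / 2 + (2 * δ)⁻¹ * δ ^ 2 := by gcongr
      _ = δ := by field_simp; ring
  have hcard := h4 S A hS hAk
  -- The average is normalized by `n` and not by the number of nodes with label `x`, so the
  -- fluctuation of that fraction appears separately.
  have hdecomp : ∀ ω, labelAverage (K n) (a / n) (b / n) α φ c t S A x ω -
      labelFraction κ x * m = V ω + (((s.card : ℝ) / n - labelFraction κ x : ℝ) : ℂ) * m := by
    intro ω
    have : ∀ l, cueOr φ c ω l (Y l ω) = h l ω + m := fun l => by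
      simp only [hh, cueOr]
      split_ifs <;> simp [hφ'_apply]
    rw [labelAverage, Finset.sum_congr rfl fun l _ => this l, Finset.sum_add_distrib,
      Finset.sum_const, nsmul_eq_mul, hV]
    push_cast
    ring
  simp only [hdecomp]
  calc _ ≤ condMean S (a / n) (b / n) α (fun ω => ‖V ω‖ +
          |(s.card : ℝ) / n - labelFraction κ x| * ‖m‖) := by
        refine condMean_mono hw fun ω _ => (norm_add_le _ _).trans_eq ?_
        rw [norm_mul (Complex.ofReal _), Complex.norm_real, Real.norm_eq_abs]
    _ ≤ δ + |(s.card : ℝ) / n - labelFraction κ x| * ‖m‖ := by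
        rw [condMean_add, condMean_const hone]
        gcongr
    _ ≤ δ + |(s.card : ℝ) / n - labelFraction κ x| * (‖m‖ + 1) := by gcongr; linarith
    _ < δ + ε / (2 * (‖m‖ + 1)) * (‖m‖ + 1) := by gcongr
    _ = ε := by rw [hδ_def]; field_simp; norm_num
end

/-! ### The induction step through characteristic functions. -/

noncomputable section
open scoped Classical

/-- The increment `e^{iθ g} - 1` of a character along a message jump. -/
def jumpChar (ρ θ : ℝ) (r : ℝ) : ℂ := Complex.exp (θ * messageJump ρ r * Complex.I) - 1

/-- The increment of a character along a cue jump. -/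
def cueChar (ρ θ : ℝ) : ℂ := Complex.exp (θ * Real.log ρ * Complex.I) - 1

lemma norm_one_add_jumpChar (ρ θ r : ℝ) : ‖1 + jumpChar ρ θ r‖ ≤ 1 := by
  rw [jumpChar, add_sub_cancel, ← Complex.ofReal_mul, Complex.norm_exp_ofReal_mul_I]

lemma norm_one_add_cueChar (ρ θ : ℝ) : ‖1 + cueChar ρ θ‖ ≤ 1 := by
  rw [cueChar, add_sub_cancel, ← Complex.ofReal_mul, Complex.norm_exp_ofReal_mul_I]

lemma norm_jumpChar_le (ρ θ r : ℝ) : ‖jumpChar ρ θ r‖ ≤ 2 := by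
  calc ‖jumpChar ρ θ r‖ = ‖(1 + jumpChar ρ θ r) - 1‖ := by ring_nf
    _ ≤ ‖1 + jumpChar ρ θ r‖ + ‖(1 : ℂ)‖ := norm_sub_le _ _
    _ ≤ 2 := by rw [norm_one]; linarith [norm_one_add_jumpChar ρ θ r]

lemma continuous_jumpChar {ρ : ℝ} (hρ : 0 < ρ) (θ : ℝ) : Continuous (jumpChar ρ θ) := by
  have := continuous_messageJump hρ
  unfold jumpChar
  fun_prop

/-- The exponent of the characteristic function of the limiting law of a message. -/
def messageExponent (κ α a b : ℝ) (t : ℕ) (x : Bool) (θ : ℝ) : ℂ :=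
  communityRate a b x * (κ * α) * cueChar (a / b) θ +
    communityRate a b x * (κ * (1 - α)) * ∫ r, jumpChar (a / b) θ r ∂messageLaw κ α a b t true +
    b * (1 - κ) * ∫ r, jumpChar (a / b) θ r ∂messageLaw κ α a b t false

section

variable {κ α a b : ℝ}

lemma charFun_messageLaw_succ (hκ0 : 0 < κ) (hκ1 : κ < 1) (hα0 : 0 < α) (hα1 : α < 1)
    (hb : 0 < b) (hab : b < a) (t : ℕ) (x : Bool) (θ : ℝ) :
    charFun (messageLaw κ α a b (t + 1) x) θ =
      Complex.exp (θ * (-(κ * (a - b)) - limitLogOdds κ α : ℝ) * Complex.I) *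
        Complex.exp (messageExponent κ α a b t x θ) := by
  have h := (integral_cexp_messageLaw_succ hκ0 hκ1 hα0 hα1 hb hab t x (θ * Complex.I)).2
  have e : ∀ y : ℂ, (θ * Complex.I) * y = θ * y * Complex.I := fun y => by ring
  simp only [e] at h
  rw [charFun_apply_real, h, ← Complex.exp_add]
  rfl

/-- Read off from `|charFun| ≤ 1`, since the remaining factor is unimodular. -/
lemma re_messageExponent_nonpos (hκ0 : 0 < κ) (hκ1 : κ < 1) (hα0 : 0 < α) (hα1 : α < 1)
    (hb : 0 < b) (hab : b < a) (t : ℕ) (x : Bool) (θ : ℝ) :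
    (messageExponent κ α a b t x θ).re ≤ 0 := by
  have h := norm_charFun_le_one (μ := messageLaw κ α a b (t + 1) x) θ
  rw [charFun_messageLaw_succ hκ0 hκ1 hα0 hα1 hb hab, norm_mul, ← Complex.ofReal_mul,
    Complex.norm_exp_ofReal_mul_I, one_mul, Complex.norm_exp] at h
  exact Real.exp_le_one_iff.1 h

end

/-- Every factor is affine in one edge indicator, which lets the edges at `i` be averaged one at a
time. -/
lemma cexp_saPosterior_succ {n : ℕ} (K : ℕ) (p q α : ℝ) (ω : Config n) (t : ℕ)
    (A : Finset (Fin n)) (i : Fin n) (θ : ℝ) :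
    Complex.exp (θ * saPosterior K p q α ω (t + 1) A i * Complex.I) =
      Complex.exp (θ * (-(K : ℝ) * (p - q) - priorLogOdds n K α : ℝ) * Complex.I) *
        ∏ v ∈ (insert i A)ᶜ, (1 + if ω.graph.Adj i v then
          cueOr (jumpChar (p / q) θ) (cueChar (p / q) θ) ω v
            (saPosterior K p q α ω t (insert i A) v) else 0) := by
  have h : ∀ v, (1 + if ω.graph.Adj i v then
          cueOr (jumpChar (p / q) θ) (cueChar (p / q) θ) ω v
            (saPosterior K p q α ω t (insert i A) v) else 0) =
      Complex.exp (θ * (if ω.graph.Adj i v then jumpAt p q ω v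
            (saPosterior K p q α ω t (insert i A) v) else 0 : ℝ) * Complex.I) := fun v => by
    unfold cueOr jumpAt jumpChar cueChar
    split_ifs <;> simp
  simp only [h]
  rw [← Complex.exp_sum, ← Complex.exp_add]
  congr 1
  rw [← Finset.sum_mul, ← Finset.mul_sum, ← Complex.ofReal_sum, saPosterior, saMessage]
  unfold saPosterior
  push_cast
  ring

variable {κ α a b : ℝ} {K : ℕ → ℕ}

lemma tendsto_priorLogOdds (hκ0 : 0 < κ) (hκ1 : κ < 1) (hα1 : α < 1)
    (hK : Tendsto (fun n => (K n : ℝ) / n) atTop (𝓝 κ)) :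
    Tendsto (fun n => priorLogOdds n (K n) α) atTop (𝓝 (limitLogOdds κ α)) := by
  have hα' : 0 < 1 - α := by linarith
  have hκ' : 0 < 1 - κ := by linarith
  have h : Tendsto (fun n : ℕ => (1 - (K n : ℝ) / n) / ((K n : ℝ) / n * (1 - α))) atTop
      (𝓝 ((1 - κ) / (κ * (1 - α)))) :=
    (tendsto_const_nhds.sub hK).div (hK.mul_const _) (by positivity)
  refine ((h.log (by positivity)).congr' ?_)
  filter_upwards [eventually_gt_atTop 0] with n hn
  have hn' : (n : ℝ) ≠ 0 := by exact_mod_cast hn.ne'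
  rw [priorLogOdds]
  congr 1
  rw [show 1 - (K n : ℝ) / n = ((n : ℝ) - K n) / n by field_simp,
    show (K n : ℝ) / n * (1 - α) = (K n * (1 - α)) / n by ring, div_div_div_cancel_right₀ hn']

lemma PairLimit.zero (hκ0 : 0 < κ) (hκ1 : κ < 1) (hα0 : 0 < α) (hα1 : α < 1) (hb : 0 < b)
    (hab : b < a) (hK : Tendsto (fun n => (K n : ℝ) / n) atTop (𝓝 κ)) :
    PairLimit κ α a b K 0 := by
  intro φ ψ x y k ε hε
  have h := (tendsto_priorLogOdds hκ0 hκ1 hα1 hK).neg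
  have h' := ((φ.continuous.tendsto _).comp h).mul ((ψ.continuous.tendsto _).comp h)
  filter_upwards [(Metric.tendsto_nhds.1 h') ε hε, eventually_model hα0 hα1 hb hab]
    with n h1 hn S A l m _ _ _ _ _ _ _
  obtain ⟨-, hone, -⟩ := hn.2.2 S
  simp only [saPosterior, saMessage, zero_sub, messageLaw, integral_dirac]
  rw [condMean_const hone]
  rwa [dist_eq_norm] at h1

/-- Given the label of `l`, the edge probability depends only on the label of `v`. The Poisson
exponent is then a combination of the two label averages, with rates `communityRate` and `b`, and
these concentrate. -/
lemma EmpiricalLimit.prod (hκ0 : 0 < κ) (hκ1 : κ < 1) (hα0 : 0 < α) (hα1 : α < 1)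
    (hb : 0 < b) (hab : b < a) {t : ℕ} (H : EmpiricalLimit κ α a b K t) (θ : ℝ) (x : Bool)
    (k : ℕ) : ∀ ε > 0, ∀ᶠ n : ℕ in atTop, ∀ (S A : Finset (Fin n)) (l : Fin n), S.card = K n →
      A.Nonempty → A.card ≤ k → (l ∈ S ↔ x = true) →
      condMean S (a / n) (b / n) α (fun ω =>
        ‖∏ v ∈ Aᶜ, (1 + edgeProb S (a / n) (b / n) l v *
          cueOr (jumpChar (a / b) θ) (cueChar (a / b) θ) ω v
            (saPosterior (K n) (a / n) (b / n) α ω t A v)) -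
          Complex.exp (messageExponent κ α a b t x θ)‖) < ε := by
  intro ε hε
  have ha : 0 < a := hb.trans hab
  have hρ : 0 < a / b := by positivity
  set φ : ℝ →ᵇ ℂ := BoundedContinuousFunction.ofNormedAddCommGroup (jumpChar (a / b) θ)
    (continuous_jumpChar hρ θ) 2 (norm_jumpChar_le _ _) with hφ
  set c := cueChar (a / b) θ with hc
  set cr := communityRate a b x with hcr
  have hcr0 : 0 < cr := by rw [hcr]; unfold communityRate; split_ifs <;> assumption
  have hlim := (tendsto_const_div_atTop_nhds_zero_nat (4 * a ^ 2)).eventually_lt_const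
    (show (0 : ℝ) < ε / 3 by positivity)
  filter_upwards [H φ c true k (ε / (3 * cr)) (by positivity),
    H φ c false k (ε / (3 * b)) (by positivity), eventually_model hα0 hα1 hb hab, hlim]
    with n h1 h2 hn h4 S A l hS hA hAk hl
  obtain ⟨hn0, hahalf, hmod⟩ := hn
  obtain ⟨hw, hone, he0, he1⟩ := hmod S
  have hn' : (0 : ℝ) < n := by exact_mod_cast hn0
  specialize h1 S A hS hA hAk
  specialize h2 S A hS hA hAk
  set LA : Bool → Config n → ℂ := fun x ω =>
    labelAverage (K n) (a / n) (b / n) α φ c t S A x ω with hLA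
  set Λ : Bool → ℂ := fun x =>
    labelFraction κ x * mixedMean α x (messageLaw κ α a b t x) φ c with hΛ
  have hX : messageExponent κ α a b t x θ = cr * Λ true + b * Λ false := by
    simp only [hΛ, messageExponent, labelFraction, mixedMean, labelCueRate, hφ,
      BoundedContinuousFunction.coe_ofNormedAddCommGroup, if_true, Bool.false_eq_true, if_false]
    push_cast
    ring
  have hsum : ∀ ω, ∑ v ∈ Aᶜ, (edgeProb S (a / n) (b / n) l v : ℂ) * cueOr φ c ω v
      (saPosterior (K n) (a / n) (b / n) α ω t A v) = cr * LA true ω + b * LA false ω := by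
    intro ω
    simp only [hLA, labelAverage]
    rw [← Finset.sum_filter_add_sum_filter_not Aᶜ (fun v => (v ∈ S ↔ true = true))]
    congr 1
    · rw [← mul_assoc, Finset.mul_sum]
      refine Finset.sum_congr (by ext v; simp) fun v hv => ?_
      have hv' : v ∈ S := by simpa using (Finset.mem_filter.1 hv).2
      congr 1
      rw [hcr, edgeProb, communityRate]
      simp only [hl, hv', and_true]
      split_ifs <;> push_cast <;> ring
    · rw [← mul_assoc, Finset.mul_sum]
      refine Finset.sum_congr (by ext v; simp) fun v hv => ?_
      have hv' : v ∉ S := by simpa using (Finset.mem_filter.1 hv).2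
      congr 1
      rw [edgeProb, if_neg fun h => hv' h.2]
      push_cast; ring
  have hsq : 4 * ∑ v ∈ Aᶜ, edgeProb S (a / n) (b / n) l v ^ 2 ≤ 4 * a ^ 2 / n := by
    calc _ ≤ 4 * ∑ v ∈ Aᶜ, (a / n) ^ 2 := by
          gcongr with v _
          exacts [he0 _ _, he1 _ _]
      _ ≤ 4 * (n * (a / n) ^ 2) := by
          rw [Finset.sum_const, nsmul_eq_mul]
          gcongr
          simpa using Finset.card_le_univ Aᶜ
      _ = _ := by field_simp
  calc _ ≤ condMean S (a / n) (b / n) α (fun ω => 4 * a ^ 2 / n +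
        (cr * ‖LA true ω - Λ true‖ + b * ‖LA false ω - Λ false‖)) := by
        refine condMean_mono hw fun ω _ => ?_
        refine (norm_prod_one_add_sub_cexp_le Aᶜ (fun v _ => he0 l v)
          (fun v _ => (he1 l v).trans hahalf) (fun v _ => ?_)
          (re_messageExponent_nonpos hκ0 hκ1 hα0 hα1 hb hab t x θ)).trans ?_
        · unfold cueOr
          split_ifs
          exacts [norm_one_add_cueChar _ _, norm_one_add_jumpChar _ _ _]
        · refine add_le_add hsq ?_
          have := hsum ω
          simp only [hφ, BoundedContinuousFunction.coe_ofNormedAddCommGroup] at this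
          rw [this, hX, show (cr : ℂ) * LA true ω + b * LA false ω - (cr * Λ true + b * Λ false) =
            cr * (LA true ω - Λ true) + b * (LA false ω - Λ false) by ring]
          refine (norm_add_le _ _).trans_eq ?_
          rw [norm_mul, norm_mul, Complex.norm_of_nonneg hcr0.le, Complex.norm_of_nonneg hb.le]
    _ = 4 * a ^ 2 / n + (cr * condMean S (a / n) (b / n) α (fun ω => ‖LA true ω - Λ true‖) +
        b * condMean S (a / n) (b / n) α (fun ω => ‖LA false ω - Λ false‖)) := by
        rw [condMean_add, condMean_add, condMean_mul_left, condMean_mul_left, condMean_const hone]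
    _ < ε / 3 + (cr * (ε / (3 * cr)) + b * (ε / (3 * b))) := by gcongr
    _ = ε := by field_simp; norm_num

/-- Once the fresh edges are averaged out, each of the two products is close in mean to a constant.
The expectation of their product thus tends to the product of the limits, even though both use the
same messages from below. -/
lemma EmpiricalLimit.pair_charFun (hκ0 : 0 < κ) (hκ1 : κ < 1) (hα0 : 0 < α) (hα1 : α < 1)
    (hb : 0 < b) (hab : b < a) (hK : Tendsto (fun n => (K n : ℝ) / n) atTop (𝓝 κ)) {t : ℕ}
    (H : EmpiricalLimit κ α a b K t) (θ₁ θ₂ : ℝ) (x y : Bool) (k : ℕ) :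
    ∀ ε > 0, ∀ᶠ n : ℕ in atTop, ∀ (S A : Finset (Fin n)) (l m : Fin n), S.card = K n →
      A.card ≤ k → l ∉ A → m ∉ A → l ≠ m → (l ∈ S ↔ x = true) → (m ∈ S ↔ y = true) →
      ‖condMean S (a / n) (b / n) α (fun ω =>
        Complex.exp (θ₁ * saPosterior (K n) (a / n) (b / n) α ω (t + 1) (insert m A) l *
          Complex.I) *
        Complex.exp (θ₂ * saPosterior (K n) (a / n) (b / n) α ω (t + 1) (insert l A) m *
          Complex.I)) -
        charFun (messageLaw κ α a b (t + 1) x) θ₁ *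
          charFun (messageLaw κ α a b (t + 1) y) θ₂‖ < ε := by
  intro ε hε
  set d := -(κ * (a - b)) - limitLogOdds κ α with hd
  set D : ℕ → ℝ := fun n => -(K n : ℝ) * (a / n - b / n) - priorLogOdds n (K n) α with hD
  have hDlim : Tendsto D atTop (𝓝 d) := by
    refine Tendsto.sub ?_ (tendsto_priorLogOdds hκ0 hκ1 hα1 hK)
    refine (hK.mul_const (a - b)).neg.congr fun n => ?_
    ring
  have hcl : Tendsto (fun n => Complex.exp (θ₁ * D n * Complex.I) *
      Complex.exp (θ₂ * D n * Complex.I)) atTop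
      (𝓝 (Complex.exp (θ₁ * d * Complex.I) * Complex.exp (θ₂ * d * Complex.I))) := by
    have hc : Continuous fun s : ℝ => Complex.exp (θ₁ * s * Complex.I) *
      Complex.exp (θ₂ * s * Complex.I) := by fun_prop
    exact (hc.tendsto d).comp hDlim
  filter_upwards [H.prod hκ0 hκ1 hα0 hα1 hb hab θ₁ x (k + 2) (ε / 3) (by positivity),
    H.prod hκ0 hκ1 hα0 hα1 hb hab θ₂ y (k + 2) (ε / 3) (by positivity),
    eventually_model hα0 hα1 hb hab, (Metric.tendsto_nhds.1 hcl) (ε / 3) (by positivity)]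
    with n h1 h2 hn h4 S A l m hS hAk hl hm hlm hlx hmy
  obtain ⟨hn0, hahalf, hmod⟩ := hn
  obtain ⟨hw, hone, he0, he1⟩ := hmod S
  have hn' : (n : ℝ) ≠ 0 := by exact_mod_cast hn0.ne'
  have hratio : (a / n) / (b / n) = a / b := div_div_div_cancel_right₀ hn' _ _
  -- After one step both recursions exclude the same set, and the messages below ignore every edge
  -- at `l` and `m`.
  set A' := insert l (insert m A) with hA'
  have hA'2 : insert m (insert l A) = A' := Finset.insert_comm _ _ _
  have hA'k : A'.card ≤ k + 2 :=
    (Finset.card_insert_le _ _).trans (by have := Finset.card_insert_le m A; omega)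
  have hA'ne : A'.Nonempty := Finset.insert_nonempty _ _
  set h : ℝ → Fin n → Config n → ℂ := fun θ v ω =>
    cueOr (jumpChar (a / b) θ) (cueChar (a / b) θ) ω v
      (saPosterior (K n) (a / n) (b / n) α ω t A' v) with hh
  set r := edgeProb S (a / n) (b / n) with hr
  set P : ℝ → Fin n → Config n → ℂ := fun θ i ω => ∏ v ∈ A'ᶜ, (1 + r i v * h θ v ω) with hP
  have hinv : ∀ i ∈ A', ∀ θ, ∀ v ∈ A'ᶜ, ∀ w ∈ A'ᶜ, ∀ ω, h θ w (toggleEdge i v ω) = h θ w ω := by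
    intro i hi θ v hv w hw ω
    simp only [hh, cueOr, saPosterior, toggleEdge_cues]
    rw [saMessage_toggleEdge (by simpa using hw) hi]
    rfl
  have hlA' : l ∈ A' := Finset.mem_insert_self _ _
  have hmA' : m ∈ A' := Finset.mem_insert_of_mem (Finset.mem_insert_self _ _)
  have hstep : condMean S (a / n) (b / n) α (fun ω =>
        Complex.exp (θ₁ * saPosterior (K n) (a / n) (b / n) α ω (t + 1) (insert m A) l *
          Complex.I) *
        Complex.exp (θ₂ * saPosterior (K n) (a / n) (b / n) α ω (t + 1) (insert l A) m *
          Complex.I)) = (Complex.exp (θ₁ * D n * Complex.I) *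
      Complex.exp (θ₂ * D n * Complex.I)) * condMean S (a / n) (b / n) α (fun ω =>
        P θ₁ l ω * P θ₂ m ω) := by
    have e1 := condMean_mul_prod_adj (S := S) (p := a / n) (q := b / n) (α := α) (i := l) A'ᶜ
      (by simpa using hlA') (F := fun ω => ∏ v ∈ A'ᶜ,
        (1 + if ω.graph.Adj m v then h θ₂ v ω else 0)) (h := h θ₁) (fun v hv ω => by
          refine Finset.prod_congr rfl fun w hw => ?_
          rw [hinv l hlA' θ₂ v hv w hw]
          have : ¬ (m = l ∧ w = v ∨ m = v ∧ w = l) := by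
            rintro (⟨h, -⟩ | ⟨-, h⟩)
            · exact hlm h.symm
            · rw [h] at hw
              exact (Finset.mem_compl.1 hw) hlA'
          simp only [toggleEdge_adj_of_ne this]) (hinv l hlA' θ₁)
    have e2 := condMean_mul_prod_adj (S := S) (p := a / n) (q := b / n) (α := α) (i := m) A'ᶜ
      (by simpa using hmA') (F := fun ω => P θ₁ l ω) (h := h θ₂) (fun v hv ω => by
          refine Finset.prod_congr rfl fun w hw => ?_
          rw [hinv m hmA' θ₁ v hv w hw]) (hinv m hmA' θ₂)
    -- The edges at `l` are averaged first, with the product over the edges at `m` as a weight, and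
    -- then those at `m`.
    have e := e1.trans ((condMean_congr fun ω _ => mul_comm _ _).trans e2)
    simp only [hP, hr]
    rw [← e, ← condMean_mul_left]
    refine condMean_congr fun ω _ => ?_
    rw [cexp_saPosterior_succ, cexp_saPosterior_succ, hratio, hA'2]
    simp only [hh, hD]
    push_cast
    ring
  rw [hstep, charFun_messageLaw_succ hκ0 hκ1 hα0 hα1 hb hab,
    charFun_messageLaw_succ hκ0 hκ1 hα0 hα1 hb hab, ← hd, mul_mul_mul_comm]
  set X₁ := Complex.exp (messageExponent κ α a b t x θ₁)
  set X₂ := Complex.exp (messageExponent κ α a b t y θ₂)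
  have hX₁ : ‖X₁‖ ≤ 1 :=
    norm_cexp_le_one (re_messageExponent_nonpos hκ0 hκ1 hα0 hα1 hb hab t x θ₁)
  have hX₂ : ‖X₂‖ ≤ 1 :=
    norm_cexp_le_one (re_messageExponent_nonpos hκ0 hκ1 hα0 hα1 hb hab t y θ₂)
  have hPn : ∀ θ i ω, ‖P θ i ω‖ ≤ 1 := by
    intro θ i ω
    simp only [hP, norm_prod]
    refine Finset.prod_le_one (fun _ _ => norm_nonneg _) fun v _ => ?_
    refine norm_one_add_smul_le_one (he0 i v) ((he1 i v).trans (by linarith)) ?_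
    simp only [hh, cueOr]
    split_ifs
    exacts [norm_one_add_cueChar _ _, norm_one_add_jumpChar _ _ _]
  have hEP : ‖condMean S (a / n) (b / n) α (fun ω => P θ₁ l ω * P θ₂ m ω) - X₁ * X₂‖ <
      ε / 3 + ε / 3 := by
    refine (norm_condMean_sub_le hw hone _ _).trans_lt
      (lt_of_le_of_lt ?_ (add_lt_add (h1 S A' l hS hA'ne hA'k hlx) (h2 S A' m hS hA'ne hA'k hmy)))
    rw [← condMean_add]
    exact condMean_mono hw fun ω _ => norm_mul_sub_mul_le (hPn _ _ _) hX₂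
  rw [dist_eq_norm] at h4
  set E := condMean S (a / n) (b / n) α (fun ω => P θ₁ l ω * P θ₂ m ω)
  set cn := Complex.exp (θ₁ * D n * Complex.I) * Complex.exp (θ₂ * D n * Complex.I) with hcn
  set cl := Complex.exp (θ₁ * d * Complex.I) * Complex.exp (θ₂ * d * Complex.I)
  have hcn1 : ‖cn‖ ≤ 1 := by
    rw [hcn, norm_mul, ← Complex.ofReal_mul, ← Complex.ofReal_mul, Complex.norm_exp_ofReal_mul_I,
      Complex.norm_exp_ofReal_mul_I, one_mul]
  have hXX : ‖X₁ * X₂‖ ≤ 1 := by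
    rw [norm_mul]
    exact mul_le_one₀ hX₁ (norm_nonneg _) hX₂
  calc _ ≤ ‖cn - cl‖ + ‖E - X₁ * X₂‖ := norm_mul_sub_mul_le hcn1 hXX
    _ < ε / 3 + (ε / 3 + ε / 3) := add_lt_add h4 hEP
    _ = ε := by ring

/-- The step from characters to bounded continuous test functions is Lévy's theorem in the plane;
`WithLp 2` supplies the inner product that `charFun` needs. -/
lemma PairLimit.succ (hκ0 : 0 < κ) (hκ1 : κ < 1) (hα0 : 0 < α) (hα1 : α < 1)
    (hb : 0 < b) (hab : b < a) (hK : Tendsto (fun n => (K n : ℝ) / n) atTop (𝓝 κ)) {t : ℕ}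
    (H : EmpiricalLimit κ α a b K t) : PairLimit κ α a b K (t + 1) := by
  intro φ ψ x y k ε hε
  let J : ℕ → Type := fun n => Finset (Fin n) × Finset (Fin n) × Fin n × Fin n
  let V : ∀ n, J n → Prop := fun n j => j.1.card = K n ∧ j.2.1.card ≤ k ∧ j.2.2.1 ∉ j.2.1 ∧
    j.2.2.2 ∉ j.2.1 ∧ j.2.2.1 ≠ j.2.2.2 ∧ (j.2.2.1 ∈ j.1 ↔ x = true) ∧
    (j.2.2.2 ∈ j.1 ↔ y = true)
  let Y : ∀ n, J n → Config n → WithLp 2 (ℝ × ℝ) := fun n j ω => WithLp.toLp 2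
    (saPosterior (K n) (a / n) (b / n) α ω (t + 1) (insert j.2.2.2 j.2.1) j.2.2.1,
      saPosterior (K n) (a / n) (b / n) α ω (t + 1) (insert j.2.2.1 j.2.1) j.2.2.2)
  have hYm : ∀ n j, Measurable (Y n j) := fun n j => measurable_from_top
  let μ : ∀ n, J n → Measure (WithLp 2 (ℝ × ℝ)) := fun n j =>
    (condLaw j.1 (a / n) (b / n) α).map (Y n j)
  let ν : Measure (WithLp 2 (ℝ × ℝ)) :=
    ((messageLaw κ α a b (t + 1) x).prod (messageLaw κ α a b (t + 1) y)).map (WithLp.toLp 2)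
  have hν : IsProbabilityMeasure ν :=
    Measure.isProbabilityMeasure_map (WithLp.measurable_toLp 2 _).aemeasurable
  let Φ : WithLp 2 (ℝ × ℝ) →ᵇ ℂ :=
    (φ.compContinuous ⟨fun z => (WithLp.ofLp z).1, by fun_prop⟩) *
      (ψ.compContinuous ⟨fun z => (WithLp.ofLp z).2, by fun_prop⟩)
  have hmodel := eventually_model hα0 hα1 hb hab
  have hprob : ∀ᶠ n in atTop, ∀ j, V n j → IsProbabilityMeasure (μ n j) := by
    filter_upwards [hmodel] with n hn j _
    obtain ⟨hw, hone, -⟩ := hn.2.2 j.1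
    have := isProbabilityMeasure_condLaw hw hone
    exact Measure.isProbabilityMeasure_map (hYm n j).aemeasurable
  have hchar : ∀ θ, ∀ ε > 0, ∀ᶠ n in atTop, ∀ j, V n j →
      ‖charFun (μ n j) θ - charFun ν θ‖ < ε := by
    intro θ δ hδ
    filter_upwards [hmodel, H.pair_charFun hκ0 hκ1 hα0 hα1 hb hab hK (WithLp.ofLp θ).1
      (WithLp.ofLp θ).2 x y k δ hδ] with n hn h1 j hj
    obtain ⟨hw, hone, -⟩ := hn.2.2 j.1
    have := h1 j.1 j.2.1 j.2.2.1 j.2.2.2 hj.1 hj.2.1 hj.2.2.1 hj.2.2.2.1 hj.2.2.2.2.1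
      hj.2.2.2.2.2.1 hj.2.2.2.2.2.2
    rw [charFun_prod, charFun_apply, integral_map (hYm n j).aemeasurable
      (Continuous.aestronglyMeasurable (by fun_prop)), integral_condLaw hw]
    refine lt_of_eq_of_lt ?_ this
    congr 3
    ext ω
    rw [← Complex.exp_add, WithLp.prod_inner_apply]
    congr 1
    simp only [Y, Real.inner_apply]
    push_cast
    ring
  filter_upwards [hmodel, eventually_integral_of_charFun hprob hchar Φ ε hε]
    with n hn h1 S A l m hS hAk hl hm hlm hlx hmy
  obtain ⟨hw, hone, -⟩ := hn.2.2 S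
  have := h1 (S, A, l, m) ⟨hS, hAk, hl, hm, hlm, hlx, hmy⟩
  simp only [μ, ν] at this
  rw [integral_map (hYm n _).aemeasurable Φ.continuous.aestronglyMeasurable,
    integral_condLaw hw, integral_map (WithLp.measurable_toLp 2 _).aemeasurable
    Φ.continuous.aestronglyMeasurable] at this
  have hΦ : ∀ z : ℝ × ℝ, Φ (WithLp.toLp 2 z) = φ z.1 * ψ z.2 := fun z => rfl
  simp only [hΦ, Y] at this
  rwa [integral_prod_mul (fun r => φ r) (fun r => ψ r)] at this

lemma pairLimit (hκ0 : 0 < κ) (hκ1 : κ < 1) (hα0 : 0 < α) (hα1 : α < 1)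
    (hb : 0 < b) (hab : b < a) (hK : Tendsto (fun n => (K n : ℝ) / n) atTop (𝓝 κ)) (t : ℕ) :
    PairLimit κ α a b K t := by
  induction t with
  | zero => exact PairLimit.zero hκ0 hκ1 hα0 hα1 hb hab hK
  | succ t ih =>
    exact PairLimit.succ hκ0 hκ1 hα0 hα1 hb hab hK (ih.empirical hα0 hα1 hb hab hK)
end

/-! ### Conditioning on the message event. -/

noncomputable section
open scoped Classical

section

variable {n : ℕ} {S : Finset (Fin n)} {p q α : ℝ}

/-- The probability, given the community, that a message passes from `i` to `u`. -/
lemma condMean_ite_message {i u : Fin n} (hiu : i ≠ u) {V : Type*} [AddCommGroup V] [Module ℝ V]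
    {Φ : Config n → V} (he : ∀ ω, Φ (toggleEdge i u ω) = Φ ω)
    (hi : ∀ ω, Φ (toggleCue i ω) = Φ ω) (hu : ∀ ω, Φ (toggleCue u ω) = Φ ω) :
    condMean S p q α (fun ω => if ω.graph.Adj i u ∧ i ∉ ω.cues ∧ u ∉ ω.cues then Φ ω else 0) =
      (edgeProb S p q i u * (1 - cueProb S α i) * (1 - cueProb S α u)) •
        condMean S p q α Φ := by
  rw [mul_smul, mul_smul, ← condMean_ite_not_cue u hu, ← condMean_ite_not_cue i,
    ← condMean_ite_adj hiu]
  · refine condMean_congr fun ω _ => ?_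
    split_ifs <;> tauto
  · intro ω
    simp only [toggleEdge_cues, he]
  · intro ω
    simp only [mem_toggleCue_of_ne hiu.symm, hi]

lemma sum_configWeight {V : Type*} [AddCommGroup V] [Module ℝ V] (K : ℕ) (F : Config n → V) :
    ∑ ω, configWeight K p q α ω • F ω =
      ∑ S : Finset (Fin n), (if S.card = K then ((n.choose K : ℕ) : ℝ)⁻¹ else 0) •
        condMean S p q α F := by
  simp only [condMean, Finset.smul_sum]
  rw [Finset.sum_comm]
  refine Finset.sum_congr rfl fun ω _ => ?_
  rw [Finset.sum_eq_single ω.community]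
  · rw [configWeight, condWeight, if_pos rfl, smul_smul, mul_assoc]
  · intro S _ hS
    rw [condWeight, if_neg hS.symm, zero_smul, smul_zero]
  · simp

lemma integral_communityMeasure_cond {K : ℕ} (hw : ∀ ω : Config n, 0 ≤ configWeight K p q α ω)
    (s : Set (Config n)) (F : Config n → ℝ) :
    ∫ ω, F ω ∂(communityMeasure n K p q α)[|s] =
      (∑ ω, configWeight K p q α ω • s.indicator 1 ω)⁻¹ *
        ∑ ω, configWeight K p q α ω • s.indicator F ω := by
  have hint : ∀ G : Config n → ℝ, ∫ ω, G ω ∂communityMeasure n K p q α =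
      ∑ ω, configWeight K p q α ω • G ω := fun G => by
    rw [communityMeasure, integral_sum_dirac (by simp), tsum_fintype]
    simp only [ENNReal.toReal_ofReal (hw _)]
  have hs : MeasurableSet s := trivial
  have hden : ∑ ω, configWeight K p q α ω • s.indicator (1 : Config n → ℝ) ω =
      (communityMeasure n K p q α s).toReal := by
    rw [← hint, integral_indicator_one hs]
    rfl
  rw [hden, ← hint, ProbabilityTheory.cond, integral_smul_measure, ← integral_indicator hs,
    ENNReal.toReal_inv, smul_eq_mul]

end

lemma exists_community {n K : ℕ} (hK0 : 0 < K) (hKn : K < n) (i : Fin n) (x : Bool) :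
    ∃ S : Finset (Fin n), S.card = K ∧ (i ∈ S ↔ x = true) := by
  cases x with
  | true =>
    obtain ⟨S, hS, -, hc⟩ := Finset.exists_subsuperset_card_eq (Finset.subset_univ {i})
      (n := K) (by simpa) (by simpa using hKn.le)
    exact ⟨S, hc, by simpa using hS⟩
  | false =>
    obtain ⟨S, hS, hc⟩ := Finset.exists_subset_card_eq (s := Finset.univ.erase i) (n := K)
      (by rw [Finset.card_erase_of_mem (Finset.mem_univ _), Finset.card_univ, Fintype.card_fin]
          omega)
    refine ⟨S, hc, ?_⟩
    simp only [Bool.false_eq_true, iff_false]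
    exact fun h => Finset.ne_of_mem_erase (hS h) rfl

variable {κ α a b : ℝ}

/-- The conditioning event has probability of order `1/n`, so errors must be `o(1/n)`. The bound is
relative to the probability of the event so that it can be summed over communities, where that
probability varies. -/
lemma eventually_condMean_message {K : ℕ → ℕ} (hκ0 : 0 < κ) (hκ1 : κ < 1) (hα0 : 0 < α)
    (hα1 : α < 1) (hb : 0 < b) (hab : b < a)
    (hK : Tendsto (fun n => (K n : ℝ) / n) atTop (𝓝 κ)) (t : ℕ) (x : Bool) (φ : ℝ →ᵇ ℝ) :
    ∀ ε > 0, ∀ᶠ n : ℕ in atTop, ∀ (S : Finset (Fin n)) (i u : Fin n), S.card = K n → i ≠ u →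
      (i ∈ S ↔ x = true) →
      0 < condMean S (a / n) (b / n) α (fun ω =>
        if ω.graph.Adj i u ∧ i ∉ ω.cues ∧ u ∉ ω.cues then (1 : ℝ) else 0) ∧
      |condMean S (a / n) (b / n) α (fun ω =>
        if ω.graph.Adj i u ∧ i ∉ ω.cues ∧ u ∉ ω.cues then
          φ (posteriorMessage (K n) (a / n) (b / n) α ω t i u) -
            ∫ r, φ r ∂messageLaw κ α a b t x else 0)| ≤
      ε * condMean S (a / n) (b / n) α (fun ω =>
        if ω.graph.Adj i u ∧ i ∉ ω.cues ∧ u ∉ ω.cues then (1 : ℝ) else 0) := by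
  intro ε hε
  have ha : 0 < a := hb.trans hab
  have hα' : 0 < 1 - α := by linarith
  set L := ∫ r, φ r ∂messageLaw κ α a b t x with hL
  set B := ‖φ‖ with hB
  set C := returnBound a t 2 with hC_def
  have hC : 0 ≤ C := returnBound_nonneg ha.le _ _
  let φc : ℝ →ᵇ ℂ := BoundedContinuousFunction.ofNormedAddCommGroup (fun r => (φ r : ℂ))
    (by fun_prop) B (fun r => by rw [Complex.norm_real]; exact φ.norm_coe_le_norm r)
  have hpair := pairLimit hκ0 hκ1 hα0 hα1 hb hab hK t φc (BoundedContinuousFunction.const ℝ 1)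
  have hlim := (tendsto_const_div_atTop_nhds_zero_nat (2 * B * C * a ^ 2)).eventually_lt_const
    (show (0 : ℝ) < ε / 2 * (b * (1 - α) ^ 2) by positivity)
  filter_upwards [hpair x true 1 (ε / 2) (by positivity), hpair x false 1 (ε / 2) (by positivity),
    eventually_model hα0 hα1 hb hab, hlim, eventually_ge_atTop 3]
    with n h1 h2 hn h4 hn3 S i u hS hiu hix
  obtain ⟨hn0, hahalf, hmod⟩ := hn
  obtain ⟨hw, hone, he0, he1⟩ := hmod S
  have hn' : (0 : ℝ) < n := by exact_mod_cast hn0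
  -- `PairLimit` speaks of two nodes; `v` is a dummy partner tested against the constant `1`, and
  -- exists because `n ≥ 3`.
  obtain ⟨v, hv⟩ : ∃ v : Fin n, v ∉ ({i, u} : Finset (Fin n)) := by
    by_contra! hcon
    have := Finset.card_le_card (fun v _ => hcon v : Finset.univ ⊆ ({i, u} : Finset (Fin n)))
    have := Finset.card_le_two (a := i) (b := u)
    simp at *
    omega
  simp only [Finset.mem_insert, Finset.mem_singleton, not_or] at hv
  have hiA : i ∉ insert v ({u} : Finset (Fin n)) := by
    simp only [Finset.mem_insert, Finset.mem_singleton, not_or]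
    exact ⟨Ne.symm hv.1, hiu⟩
  have huA : u ∈ insert v ({u} : Finset (Fin n)) := by simp
  set Y : Config n → ℝ := fun ω =>
    saPosterior (K n) (a / n) (b / n) α ω t (insert v {u}) i with hY
  have hE : |condMean S (a / n) (b / n) α (fun ω => φ (Y ω)) - L| < ε / 2 := by
    have hvx : ∃ y : Bool, (v ∈ S ↔ y = true) := ⟨decide (v ∈ S), by simp⟩
    obtain ⟨y, hy⟩ := hvx
    have key : ‖condMean S (a / n) (b / n) α (fun ω => φc (Y ω) *
        (BoundedContinuousFunction.const ℝ (1 : ℂ))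
          (saPosterior (K n) (a / n) (b / n) α ω t (insert i {u}) v)) -
        (∫ r, φc r ∂messageLaw κ α a b t x) * ∫ r, (BoundedContinuousFunction.const ℝ (1 : ℂ)) r
          ∂messageLaw κ α a b t y‖ < ε / 2 := by
      cases y
      · exact h2 S {u} i v hS (by simp) (by simpa) (by simpa using hv.2) (Ne.symm hv.1) hix hy
      · exact h1 S {u} i v hS (by simp) (by simpa) (by simpa using hv.2) (Ne.symm hv.1) hix hy
    simp only [BoundedContinuousFunction.const_apply, mul_one, integral_const,
      probReal_univ, one_smul] at key
    have e1 : condMean S (a / n) (b / n) α (fun ω => φc (Y ω)) =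
        ((condMean S (a / n) (b / n) α (fun ω => φ (Y ω)) : ℝ) : ℂ) := by
      simp only [condMean, Complex.ofReal_sum, smul_eq_mul, Complex.real_smul, Complex.ofReal_mul]
      rfl
    have e2 : ∫ r, φc r ∂messageLaw κ α a b t x = ((L : ℝ) : ℂ) := integral_ofReal
    rwa [e1, e2, ← Complex.ofReal_sub, Complex.norm_real, Real.norm_eq_abs] at key
  set W := edgeProb S (a / n) (b / n) i u * (1 - cueProb S α i) * (1 - cueProb S α u) with hW
  have hden : condMean S (a / n) (b / n) α (fun ω =>
      if ω.graph.Adj i u ∧ i ∉ ω.cues ∧ u ∉ ω.cues then (1 : ℝ) else 0) = W := by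
    rw [condMean_ite_message hiu (Φ := fun _ => (1 : ℝ)) (fun _ => rfl) (fun _ => rfl)
      (fun _ => rfl), hone, smul_eq_mul, mul_one]
  have hWlow : b / n * (1 - α) ^ 2 ≤ W := by
    have hq : b / n ≤ edgeProb S (a / n) (b / n) i u := by
      unfold edgeProb
      split_ifs
      · gcongr
      · exact le_rfl
    have hcue : ∀ j, 1 - α ≤ 1 - cueProb S α j := fun j => by
      unfold cueProb
      split_ifs <;> linarith
    rw [hW, sq, ← mul_assoc]
    have := hcue i
    have := hcue u
    have := he0 i u
    have := mul_nonneg (he0 i u) (by linarith : 0 ≤ 1 - cueProb S α i)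
    gcongr
  have hWpos : 0 < W := lt_of_lt_of_le (by positivity) hWlow
  rw [hden]
  refine ⟨hWpos, ?_⟩
  have hmain : condMean S (a / n) (b / n) α (fun ω =>
      if ω.graph.Adj i u ∧ i ∉ ω.cues ∧ u ∉ ω.cues then φ (Y ω) - L else 0) =
      W * (condMean S (a / n) (b / n) α (fun ω => φ (Y ω)) - L) := by
    rw [condMean_ite_message hiu, condMean_sub, condMean_const hone, smul_eq_mul]
    · intro ω
      simp only [hY, saPosterior]
      rw [toggleEdge_comm, saMessage_toggleEdge hiA huA]
    · intro ω
      simp only [hY, saPosterior]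
      rw [saMessage_toggleCue hiA (Finset.mem_insert_self _ _)]
    · intro ω
      simp only [hY, saPosterior]
      rw [saMessage_toggleCue hiA (Finset.mem_insert_of_mem huA)]
  -- The return count is independent of the edge `i u`, so the error is `O(1/n²)`: one factor `a /
  -- n` from the edge and one from the return.
  have herr : ‖condMean S (a / n) (b / n) α (fun ω =>
      if ω.graph.Adj i u ∧ i ∉ ω.cues ∧ u ∉ ω.cues then
        φ (posteriorMessage (K n) (a / n) (b / n) α ω t i u) - φ (Y ω) else 0)‖ ≤
      W * (ε / 2) := by
    calc _ ≤ condMean S (a / n) (b / n) α (fun ω => if ω.graph.Adj i u then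
            2 * B * returnCount ω t (insert v {u}) u i else 0) := by
          refine (norm_condMean_le hw _).trans (condMean_mono hw fun ω _ => ?_)
          have hN := returnCount_nonneg ω t (insert v {u}) u i
          split_ifs with h h' h'
          · exact norm_sub_le_returnCount huA hiA (F := fun r => φ (r - priorLogOdds n (K n) α))
              fun r => φ.norm_coe_le_norm _
          · exact absurd h.1 h'
          · rw [norm_zero]; positivity
          · rw [norm_zero]
      _ = edgeProb S (a / n) (b / n) i u * (2 * B *
            condMean S (a / n) (b / n) α fun ω => returnCount ω t (insert v {u}) u i) := by
          rw [condMean_ite_adj hiu fun ω => by rw [returnCount_toggleEdge huA hiA],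
            condMean_mul_left, smul_eq_mul]
      _ ≤ a / n * (2 * B * (C * (a / n))) := by
          have hD : (n : ℝ) * (a / n) ≤ a := by rw [mul_div_cancel₀ _ hn'.ne']
          have := condMean_returnCount_le hw hone he1 (t := t) (by positivity) hD huA hiA
          have hc : (insert v ({u} : Finset (Fin n))).card ≤ 2 := Finset.card_le_two
          have hle := this.trans (mul_le_mul_of_nonneg_right (returnBound_mono ha.le t hc)
            (by positivity : 0 ≤ a / n))
          have hN : 0 ≤ condMean S (a / n) (b / n) α
              fun ω => returnCount ω t (insert v {u}) u i :=
            Finset.sum_nonneg fun ω _ => mul_nonneg (hw ω) (returnCount_nonneg _ _ _ _ _)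
          have := he1 i u
          gcongr
      _ = (2 * B * C * a ^ 2 / n) / n := by ring
      _ ≤ (ε / 2 * (b * (1 - α) ^ 2)) / n := by gcongr
      _ = b / n * (1 - α) ^ 2 * (ε / 2) := by ring
      _ ≤ _ := by gcongr
  have hsplit : condMean S (a / n) (b / n) α (fun ω =>
        if ω.graph.Adj i u ∧ i ∉ ω.cues ∧ u ∉ ω.cues then
          φ (posteriorMessage (K n) (a / n) (b / n) α ω t i u) - L else 0) =
      condMean S (a / n) (b / n) α (fun ω =>
      if ω.graph.Adj i u ∧ i ∉ ω.cues ∧ u ∉ ω.cues then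
        φ (posteriorMessage (K n) (a / n) (b / n) α ω t i u) - φ (Y ω) else 0) +
      W * (condMean S (a / n) (b / n) α (fun ω => φ (Y ω)) - L) := by
    rw [← hmain, ← condMean_add]
    refine condMean_congr fun ω _ => ?_
    split_ifs <;> ring
  rw [hsplit]
  refine (abs_add_le _ _).trans ?_
  rw [abs_mul, abs_of_pos hWpos]
  calc _ ≤ W * (ε / 2) + W * (ε / 2) := add_le_add herr (by gcongr)
    _ = ε * W := by ring

theorem isLimitingMessageLaw_messageLaw (hκ0 : 0 < κ) (hκ1 : κ < 1) (hα0 : 0 < α)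
    (hα1 : α < 1) (hb : 0 < b) (hab : b < a) (t : ℕ) (x : Bool) :
    IsLimitingMessageLaw κ α a b x t ⟨messageLaw κ α a b t x, inferInstance⟩ := by
  intro K hK φ ε hε
  have ha : 0 < a := hb.trans hab
  filter_upwards [eventually_condMean_message hκ0 hκ1 hα0 hα1 hb hab hK t x φ (ε / 2)
    (by positivity), eventually_model hα0 hα1 hb hab, hK.eventually_lt_const hκ1,
    hK.eventually_const_lt hκ0] with n h1 hn hK1 hK0 i u hiu
  obtain ⟨hn0, -, hmod⟩ := hn
  have hn' : (0 : ℝ) < n := by exact_mod_cast hn0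
  have hKn : K n < n := by
    rw [div_lt_one hn'] at hK1
    exact_mod_cast hK1
  have hKpos : 0 < K n := by
    have := (div_pos_iff_of_pos_right hn').1 hK0
    exact_mod_cast this
  set p := a / n
  set q := b / n
  have hcoef : ∀ S : Finset (Fin n),
      0 ≤ if S.card = K n then ((n.choose (K n) : ℕ) : ℝ)⁻¹ else 0 := fun S => by
    split_ifs <;> positivity
  have hwpos : ∀ ω : Config n, 0 ≤ configWeight (K n) p q α ω := fun ω => by
    have h := (hmod ω.community).1 ω
    rw [condWeight, if_pos rfl] at h
    rw [configWeight, mul_assoc]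
    exact mul_nonneg (hcoef _) h
  change |(∫ ω, φ (posteriorMessage (K n) p q α ω t i u)
    ∂(communityMeasure n (K n) p q α)[|messageEvent x i u]) - ∫ y, φ y ∂messageLaw κ α a b t x| < ε
  rw [integral_communityMeasure_cond hwpos]
  set L := ∫ y, φ y ∂messageLaw κ α a b t x
  set s : Set (Config n) := messageEvent x i u
  set F : Config n → ℝ := fun ω => φ (posteriorMessage (K n) p q α ω t i u)
  set den := ∑ ω, configWeight (K n) p q α ω • s.indicator (1 : Config n → ℝ) ω with hden
  have hdiff : ∑ ω, configWeight (K n) p q α ω • s.indicator F ω - L * den =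
      ∑ ω, configWeight (K n) p q α ω • s.indicator (fun ω => F ω - L) ω := by
    rw [hden, Finset.mul_sum, ← Finset.sum_sub_distrib]
    refine Finset.sum_congr rfl fun ω _ => ?_
    by_cases hω : ω ∈ s
    · simp only [Set.indicator_of_mem hω, smul_eq_mul, Pi.one_apply]; ring
    · simp [Set.indicator_of_notMem hω]
  have hcond : ∀ (S : Finset (Fin n)) (G : Config n → ℝ), (i ∈ S ↔ x = true) →
      condMean S p q α (s.indicator G) = condMean S p q α (fun ω =>
        if ω.graph.Adj i u ∧ i ∉ ω.cues ∧ u ∉ ω.cues then G ω else 0) := by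
    intro S G hS
    refine condMean_congr fun ω hω => ?_
    have : (ω ∈ s) ↔ (ω.graph.Adj i u ∧ i ∉ ω.cues ∧ u ∉ ω.cues) := by
      change (ω.graph.Adj i u ∧ i ∉ ω.cues ∧ u ∉ ω.cues ∧ (i ∈ ω.community ↔ x = true)) ↔ _
      rw [hω]
      tauto
    simp only [Set.indicator_apply, this]
  have hcond0 : ∀ (S : Finset (Fin n)) (G : Config n → ℝ), ¬ (i ∈ S ↔ x = true) →
      condMean S p q α (s.indicator G) = 0 := by
    intro S G hS
    have : condMean S p q α (s.indicator G) = condMean S p q α (fun _ => (0 : ℝ)) := by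
      refine condMean_congr fun ω hω => Set.indicator_of_notMem (fun h => hS ?_) _
      rw [← hω]
      exact h.2.2.2
    rw [this]
    simp [condMean]
  -- A bound of numerator by denominator for each community survives mixing over `S`, with no need
  -- for the ratios to agree.
  have hcompare : ∀ S : Finset (Fin n),
      |(if S.card = K n then ((n.choose (K n) : ℕ) : ℝ)⁻¹ else 0) •
        condMean S p q α (s.indicator fun ω => F ω - L)| ≤
      ε / 2 * ((if S.card = K n then ((n.choose (K n) : ℕ) : ℝ)⁻¹ else 0) •
        condMean S p q α (s.indicator (1 : Config n → ℝ))) := by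
    intro S
    by_cases hS : S.card = K n
    · by_cases hx : i ∈ S ↔ x = true
      · rw [hcond S _ hx, hcond S _ hx, smul_eq_mul, smul_eq_mul, abs_mul,
          abs_of_nonneg (hcoef S), mul_left_comm]
        exact mul_le_mul_of_nonneg_left (h1 S i u hS hiu hx).2 (hcoef S)
      · rw [hcond0 S _ hx, hcond0 S _ hx]
        simp
    · simp [hS]
  have hle : |∑ ω, configWeight (K n) p q α ω • s.indicator (fun ω => F ω - L) ω| ≤
      ε / 2 * den := by
    rw [hden, sum_configWeight, sum_configWeight, Finset.mul_sum]
    exact (Finset.abs_sum_le_sum_abs _ _).trans (Finset.sum_le_sum fun S _ => hcompare S)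
  have hpos : 0 < den := by
    rw [hden, sum_configWeight]
    obtain ⟨S, hS, hx⟩ := exists_community hKpos hKn i x
    refine Finset.sum_pos' (fun S _ => ?_) ⟨S, Finset.mem_univ _, ?_⟩
    · have := (abs_nonneg _).trans (hcompare S)
      exact nonneg_of_mul_nonneg_right this (by positivity)
    · rw [hcond S _ hx, if_pos hS, smul_eq_mul]
      exact mul_pos (inv_pos.2 (by exact_mod_cast Nat.choose_pos hKn.le)) (h1 S i u hS hiu hx).1
  rw [← hdiff] at hle
  have : den⁻¹ * ∑ ω, configWeight (K n) p q α ω • s.indicator F ω - L =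
      den⁻¹ * (∑ ω, configWeight (K n) p q α ω • s.indicator F ω - L * den) := by
    field_simp
  rw [this, abs_mul, abs_of_pos (inv_pos.2 hpos)]
  calc _ ≤ den⁻¹ * (ε / 2 * den) := by gcongr
    _ = ε / 2 := by field_simp
    _ < ε := by linarith
end

/-! ### Second order expansion of the characteristic exponent. -/

noncomputable section
open scoped Classical

/-- The posterior probability of belonging to the community at log-odds `r`. -/
def posteriorWeight (r : ℝ) : ℝ := Real.exp r / (Real.exp r + 1)

lemma posteriorWeight_mem (r : ℝ) : posteriorWeight r ∈ Set.Icc (0 : ℝ) 1 := by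
  have := Real.exp_pos r
  refine ⟨by unfold posteriorWeight; positivity, ?_⟩
  rw [posteriorWeight, div_le_one (by positivity)]
  linarith

lemma continuous_posteriorWeight : Continuous posteriorWeight := by
  unfold posteriorWeight
  exact Real.continuous_exp.div (by fun_prop) fun r => by positivity

lemma messageJump_eq_log (ρ r : ℝ) :
    messageJump ρ r = Real.log (1 + (ρ - 1) * posteriorWeight r) := by
  rw [messageJump, posteriorWeight]
  congr 1
  have := Real.exp_pos r
  field_simp
  ring

lemma integrable_posteriorWeight_pow (ν : Measure ℝ) [IsFiniteMeasure ν] (k : ℕ) :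
    Integrable (fun r => posteriorWeight r ^ k) ν := by
  refine Integrable.of_bound (continuous_posteriorWeight.pow k).aestronglyMeasurable 1
    (ae_of_all _ fun r => ?_)
  obtain ⟨h0, h1⟩ := posteriorWeight_mem r
  rw [Real.norm_of_nonneg (by positivity)]
  exact pow_le_one₀ h0 h1

/-- The second order Taylor polynomial of `s ↦ (1 + s) ^ (iθ) - 1`. -/
def charTaylor (θ s : ℝ) : ℂ :=
  Complex.I * θ * s - (Complex.I * θ + θ ^ 2) / 2 * s ^ 2

lemma abs_log_one_add_sub_le {s : ℝ} (hs0 : 0 ≤ s) (hs : s ≤ 1 / 2) :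
    |Real.log (1 + s) - (s - s ^ 2 / 2)| ≤ 2 * s ^ 3 := by
  have h := Real.abs_log_sub_add_sum_range_le (x := -s) (by rw [abs_neg, abs_of_nonneg hs0]; linarith) 2
  rw [abs_neg, abs_of_nonneg hs0] at h
  simp only [Finset.sum_range_succ, Finset.sum_range_zero] at h
  norm_num at h
  have e : -s + s ^ 2 / 2 + Real.log (1 + s) = Real.log (1 + s) - (s - s ^ 2 / 2) := by ring
  rw [e] at h
  refine h.trans ?_
  rw [div_le_iff₀ (by linarith)]
  nlinarith [pow_nonneg hs0 3]

/-- With `y = log (1 + s)`, the three constants come from the cubic remainder of `e^{iθy}`, from `y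
- (s - s²/2)` and from `y² - s²`. -/
lemma norm_cexp_log_sub_charTaylor_le (θ : ℝ) {s : ℝ} (hs0 : 0 ≤ s) (hs : s ≤ 1 / 2) :
    ‖Complex.exp (θ * Real.log (1 + s) * Complex.I) - 1 - charTaylor θ s‖ ≤
      (|θ| ^ 3 * Real.exp |θ| + 2 * |θ| + 2 * θ ^ 2) * s ^ 3 := by
  set y := Real.log (1 + s) with hy
  have hy0 : 0 ≤ y := Real.log_nonneg (by linarith)
  have hys : y ≤ s := by
    have := Real.log_le_sub_one_of_pos (show 0 < 1 + s by linarith)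
    linarith
  have hlog := abs_log_one_add_sub_le hs0 hs
  have hexp := Complex.norm_exp_sub_sum_le_norm_mul_exp (θ * y * Complex.I) 3
  have hn : ‖(θ * y * Complex.I : ℂ)‖ = |θ| * y := by
    rw [norm_mul, Complex.norm_I, mul_one, norm_mul, Complex.norm_real, Complex.norm_of_nonneg hy0,
      Real.norm_eq_abs]
  rw [hn] at hexp
  simp only [Finset.sum_range_succ, Finset.sum_range_zero] at hexp
  have hdecomp : Complex.exp (θ * y * Complex.I) - 1 - charTaylor θ s =
      (Complex.exp (θ * y * Complex.I) - (0 + (θ * y * Complex.I) ^ 0 / (Nat.factorial 0 : ℕ) +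
        (θ * y * Complex.I) ^ 1 / (Nat.factorial 1 : ℕ) +
        (θ * y * Complex.I) ^ 2 / (Nat.factorial 2 : ℕ))) +
      Complex.I * ((θ * (y - (s - s ^ 2 / 2)) : ℝ) : ℂ) -
      ((θ ^ 2 / 2 * (y ^ 2 - s ^ 2) : ℝ) : ℂ) := by
    rw [charTaylor]
    push_cast [Nat.factorial]
    linear_combination (θ ^ 2 * y ^ 2 / 2 : ℂ) * Complex.I_sq
  rw [hdecomp]
  have h1 : (|θ| * y) ^ 3 * Real.exp (|θ| * y) ≤ |θ| ^ 3 * Real.exp |θ| * s ^ 3 := by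
    have hexp' : Real.exp (|θ| * y) ≤ Real.exp |θ| := by
      refine Real.exp_le_exp.2 ?_
      nlinarith [abs_nonneg θ]
    calc _ ≤ (|θ| * s) ^ 3 * Real.exp |θ| := by gcongr
      _ = _ := by ring
  have h2 : ‖Complex.I * ((θ * (y - (s - s ^ 2 / 2)) : ℝ) : ℂ)‖ ≤ 2 * |θ| * s ^ 3 := by
    rw [norm_mul, Complex.norm_I, one_mul, Complex.norm_real, Real.norm_eq_abs, abs_mul]
    nlinarith [abs_nonneg θ]
  have h3 : ‖((θ ^ 2 / 2 * (y ^ 2 - s ^ 2) : ℝ) : ℂ)‖ ≤ 2 * θ ^ 2 * s ^ 3 := by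
    rw [Complex.norm_real, Real.norm_eq_abs, abs_mul, abs_of_nonneg (by positivity)]
    have : |y ^ 2 - s ^ 2| ≤ 4 * s ^ 3 := by
      rw [abs_le] at hlog ⊢
      have : s - y ≤ s ^ 2 / 2 + 2 * s ^ 3 := by linarith [hlog.1]
      have h4 : s ^ 2 / 2 + 2 * s ^ 3 ≤ 2 * s ^ 2 := by nlinarith [sq_nonneg s]
      constructor
      · nlinarith [sq_nonneg s]
      · nlinarith [pow_nonneg hs0 3]
    nlinarith [sq_nonneg θ]
  refine (norm_sub_le _ _).trans ?_
  refine (add_le_add (norm_add_le _ _) h3).trans ?_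
  linarith [hexp.trans h1]

/-- The constant of the Taylor estimate. -/
def taylorBound (θ : ℝ) : ℝ := |θ| ^ 3 * Real.exp |θ| + 2 * |θ| + 2 * θ ^ 2

lemma taylorBound_nonneg (θ : ℝ) : 0 ≤ taylorBound θ := by unfold taylorBound; positivity

lemma norm_cueChar_sub_le {ρ : ℝ} (hρ1 : 1 ≤ ρ) (hρ : ρ - 1 ≤ 1 / 2) (θ : ℝ) :
    ‖cueChar ρ θ - (Complex.I * θ * (ρ - 1 : ℝ) -
      (Complex.I * θ + θ ^ 2) / 2 * (ρ - 1 : ℝ) ^ 2)‖ ≤ taylorBound θ * (ρ - 1) ^ 3 := by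
  have := norm_cexp_log_sub_charTaylor_le θ (s := ρ - 1) (by linarith) hρ
  rwa [add_sub_cancel, charTaylor] at this

lemma norm_integral_jumpChar_sub_le {ρ : ℝ} (hρ1 : 1 ≤ ρ) (hρ : ρ - 1 ≤ 1 / 2) (θ : ℝ)
    (ν : Measure ℝ) [IsProbabilityMeasure ν] :
    ‖∫ r, jumpChar ρ θ r ∂ν -
      (Complex.I * θ * (ρ - 1 : ℝ) * (∫ r, posteriorWeight r ∂ν : ℝ) -
      (Complex.I * θ + θ ^ 2) / 2 * (ρ - 1 : ℝ) ^ 2 * (∫ r, posteriorWeight r ^ 2 ∂ν : ℝ))‖ ≤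
      taylorBound θ * (ρ - 1) ^ 3 := by
  have i1 : Integrable (fun r => ((posteriorWeight r : ℝ) : ℂ)) ν := by
    simpa using (integrable_posteriorWeight_pow ν 1).ofReal (𝕜 := ℂ)
  have i2 : Integrable (fun r => ((posteriorWeight r ^ 2 : ℝ) : ℂ)) ν :=
    (integrable_posteriorWeight_pow ν 2).ofReal
  have ij : Integrable (jumpChar ρ θ) ν :=
    Integrable.of_bound (continuous_jumpChar (by linarith) θ).aestronglyMeasurable 2
      (ae_of_all _ (norm_jumpChar_le ρ θ))
  have e1 : ((∫ r, posteriorWeight r ∂ν : ℝ) : ℂ) = ∫ r, ((posteriorWeight r : ℝ) : ℂ) ∂ν :=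
    integral_ofReal.symm
  have e2 : ((∫ r, posteriorWeight r ^ 2 ∂ν : ℝ) : ℂ) =
      ∫ r, ((posteriorWeight r ^ 2 : ℝ) : ℂ) ∂ν := integral_ofReal.symm
  rw [e1, e2]
  have isub : Integrable (fun r => Complex.I * θ * (ρ - 1 : ℝ) * (posteriorWeight r : ℝ) -
      (Complex.I * θ + θ ^ 2) / 2 * (ρ - 1 : ℝ) ^ 2 * (posteriorWeight r ^ 2 : ℝ)) ν :=
    (i1.const_mul _).sub (i2.const_mul _)
  rw [← integral_const_mul, ← integral_const_mul,
    ← integral_sub (i1.const_mul _) (i2.const_mul _),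
    ← integral_sub ij isub]
  have := norm_integral_le_of_norm_le_const (μ := ν) (f := fun r => jumpChar ρ θ r -
    (Complex.I * θ * (ρ - 1 : ℝ) * (posteriorWeight r : ℝ) -
      (Complex.I * θ + θ ^ 2) / 2 * (ρ - 1 : ℝ) ^ 2 * (posteriorWeight r ^ 2 : ℝ)))
    (C := taylorBound θ * (ρ - 1) ^ 3) (ae_of_all _ fun r => ?_)
  · simpa using this
  · obtain ⟨h0, h1⟩ := posteriorWeight_mem r
    have hρ0 : 0 ≤ ρ - 1 := by linarith
    have hs : (ρ - 1) * posteriorWeight r ≤ ρ - 1 := by nlinarith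
    have h := norm_cexp_log_sub_charTaylor_le θ (s := (ρ - 1) * posteriorWeight r)
      (mul_nonneg hρ0 h0) (hs.trans hρ)
    rw [← messageJump_eq_log, charTaylor] at h
    refine le_trans (le_of_eq ?_) (h.trans ?_)
    · rw [jumpChar]
      congr 1
      push_cast
      ring
    · exact mul_le_mul_of_nonneg_left (pow_le_pow_left₀ (mul_nonneg hρ0 h0) hs 3)
        (taylorBound_nonneg θ)

section posterior

variable {κ α : ℝ} {ν₁ ν₀ : Measure ℝ} [IsProbabilityMeasure ν₁]

/-- For the posterior weight `w`, this is the change of measure applied to `e^r (1 - w) = w`. -/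
lemma IsPosteriorPair.integral_posteriorWeight (h : IsPosteriorPair κ α ν₁ ν₀)
    (hκ0 : 0 < κ) (hκ1 : κ < 1) (hα1 : α < 1) :
    (1 - κ) * ∫ r, posteriorWeight r ∂ν₀ =
      κ * (1 - α) * (1 - ∫ r, posteriorWeight r ∂ν₁) := by
  have := h.integral hκ0 hκ1 hα1 fun r => 1 - posteriorWeight r
  rw [integral_sub (integrable_const _) (by simpa using integrable_posteriorWeight_pow ν₁ 1)] at this
  simp only [smul_eq_mul, integral_const, probReal_univ, one_mul] at this
  rw [← this]
  congr 2 with r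
  rw [posteriorWeight]
  have := Real.exp_pos r
  field_simp
  ring

/-- The same change of measure, applied to `e^r (w - w²) = w²`. -/
lemma IsPosteriorPair.integral_posteriorWeight_sq (h : IsPosteriorPair κ α ν₁ ν₀)
    (hκ0 : 0 < κ) (hκ1 : κ < 1) (hα1 : α < 1) :
    (1 - κ) * ∫ r, posteriorWeight r ^ 2 ∂ν₀ =
      κ * (1 - α) * (∫ r, posteriorWeight r ∂ν₁ - ∫ r, posteriorWeight r ^ 2 ∂ν₁) := by
  have := h.integral hκ0 hκ1 hα1 fun r => posteriorWeight r - posteriorWeight r ^ 2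
  rw [integral_sub (by simpa using integrable_posteriorWeight_pow ν₁ 1)
    (integrable_posteriorWeight_pow ν₁ 2)] at this
  simp only [smul_eq_mul] at this
  rw [← this]
  congr 2 with r
  rw [posteriorWeight]
  have := Real.exp_pos r
  field_simp
  ring

end posterior

section exponent

variable {κ α a b : ℝ}

/-- The variance of a message, up to terms that vanish for large degrees. -/
def approxVariance (κ α a b : ℝ) (t : ℕ) : ℝ :=
  b * (a / b - 1) ^ 2 * (κ * (α + (1 - α) * ∫ r, posteriorWeight r ∂messageLaw κ α a b t true))

/-- The posterior identities make both orders collapse: the first moments of the weights add up to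
`κ`, giving exactly `κ(a - b)`, and the second moments to `κ(α + (1 - α) E₁[w])`. What remains is of
order `b δ³`. -/
lemma norm_messageExponent_false_sub_le (hκ0 : 0 < κ) (hκ1 : κ < 1) (hα0 : 0 < α)
    (hα1 : α < 1) (hb : 0 < b) (hab : b < a) (hδ : a / b - 1 ≤ 1 / 2) (t : ℕ) (θ : ℝ) :
    ‖messageExponent κ α a b t false θ - (Complex.I * θ * (κ * (a - b) : ℝ) -
      (Complex.I * θ + θ ^ 2) / 2 * approxVariance κ α a b t)‖ ≤
      taylorBound θ * (b * (a / b - 1) ^ 2) * (a / b - 1) := by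
  have hρ1 : 1 ≤ a / b := by rw [le_div_iff₀ hb]; linarith
  have hp := isPosteriorPair_messageLaw hκ0 hκ1 hα0 hα1 hb hab t
  have n1 := hp.integral_posteriorWeight hκ0 hκ1 hα1
  have n2 := hp.integral_posteriorWeight_sq hκ0 hκ1 hα1
  have hc := norm_cueChar_sub_le hρ1 hδ θ
  have h1 := norm_integral_jumpChar_sub_le hρ1 hδ θ (messageLaw κ α a b t true)
  have h0 := norm_integral_jumpChar_sub_le hρ1 hδ θ (messageLaw κ α a b t false)
  have hab' : a - b = b * (a / b - 1) := by field_simp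
  rw [approxVariance, hab', messageExponent]
  simp only [communityRate, Bool.false_eq_true, if_false]
  set δ := a / b - 1
  set W1 := ∫ r, posteriorWeight r ∂messageLaw κ α a b t true
  set W0 := ∫ r, posteriorWeight r ∂messageLaw κ α a b t false
  set V1 := ∫ r, posteriorWeight r ^ 2 ∂messageLaw κ α a b t true
  set V0 := ∫ r, posteriorWeight r ^ 2 ∂messageLaw κ α a b t false
  set c := cueChar (a / b) θ
  set J1 := ∫ r, jumpChar (a / b) θ r ∂messageLaw κ α a b t true
  set J0 := ∫ r, jumpChar (a / b) θ r ∂messageLaw κ α a b t false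
  set C := taylorBound θ
  have n1' : (1 - κ : ℂ) * W0 = κ * (1 - α) * (1 - W1) := by exact_mod_cast n1
  have n2' : (1 - κ : ℂ) * V0 = κ * (1 - α) * (W1 - V1) := by exact_mod_cast n2
  have hκ' : 0 ≤ 1 - κ := by linarith
  have hα' : 0 ≤ 1 - α := by linarith
  set ec := c - (Complex.I * θ * (δ : ℝ) - (Complex.I * θ + θ ^ 2) / 2 * (δ : ℝ) ^ 2)
  set e1 := J1 - (Complex.I * θ * (δ : ℝ) * W1 - (Complex.I * θ + θ ^ 2) / 2 * (δ : ℝ) ^ 2 * V1)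
  set e0 := J0 - (Complex.I * θ * (δ : ℝ) * W0 - (Complex.I * θ + θ ^ 2) / 2 * (δ : ℝ) ^ 2 * V0)
  have key : b * (κ * α) * c + b * (κ * (1 - α)) * J1 + b * (1 - κ) * J0 -
      (Complex.I * θ * (κ * (b * δ) : ℝ) -
        (Complex.I * θ + θ ^ 2) / 2 * ((b * δ ^ 2 * (κ * (α + (1 - α) * W1)) : ℝ) : ℂ)) =
      ((b * (κ * α) : ℝ) : ℂ) * ec + ((b * (κ * (1 - α)) : ℝ) : ℂ) * e1 +
        ((b * (1 - κ) : ℝ) : ℂ) * e0 := by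
    simp only [ec, e1, e0]
    push_cast
    linear_combination (b * Complex.I * θ * δ : ℂ) * n1' -
      (b * ((Complex.I * θ + θ ^ 2) / 2) * δ ^ 2 : ℂ) * n2'
  rw [key]
  refine norm_add₃_le.trans ?_
  rw [norm_mul, norm_mul, norm_mul, Complex.norm_of_nonneg (by positivity),
    Complex.norm_of_nonneg (by positivity), Complex.norm_of_nonneg (by positivity)]
  calc _ ≤ b * (κ * α) * (C * δ ^ 3) + b * (κ * (1 - α)) * (C * δ ^ 3) +
        b * (1 - κ) * (C * δ ^ 3) := by gcongr
    _ = _ := by ring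

/-- Only the rates towards community nodes change, by `a - b = b δ`. This prefactor already carries
one power of `δ`, so a first order expansion of the jumps suffices, and it reproduces the variance.
-/
lemma norm_messageExponent_true_sub_false_le (hκ0 : 0 < κ) (hκ1 : κ < 1) (hα0 : 0 < α)
    (hα1 : α < 1) (hb : 0 < b) (hab : b < a) (hδ : a / b - 1 ≤ 1 / 2) (t : ℕ) (θ : ℝ) :
    ‖messageExponent κ α a b t true θ - messageExponent κ α a b t false θ -
      Complex.I * θ * approxVariance κ α a b t‖ ≤
      (taylorBound θ + (|θ| + θ ^ 2)) * (b * (a / b - 1) ^ 2) * (a / b - 1) := by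
  have hρ1 : 1 ≤ a / b := by rw [le_div_iff₀ hb]; linarith
  have hc := norm_cueChar_sub_le hρ1 hδ θ
  have h1 := norm_integral_jumpChar_sub_le hρ1 hδ θ (messageLaw κ α a b t true)
  have hV1 : |∫ r, posteriorWeight r ^ 2 ∂messageLaw κ α a b t true| ≤ 1 := by
    have := norm_integral_le_of_norm_le_const (μ := messageLaw κ α a b t true)
      (f := fun r => posteriorWeight r ^ 2) (C := 1) (ae_of_all _ fun r => by
        obtain ⟨h0, h1⟩ := posteriorWeight_mem r
        rw [Real.norm_of_nonneg (by positivity)]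
        exact pow_le_one₀ h0 h1)
    simpa using this
  have hab' : a = b * (a / b - 1) + b := by field_simp; ring
  have hrate : (communityRate a b true : ℂ) = b * (a / b - 1 : ℝ) + b := by
    rw [communityRate, if_pos rfl]
    exact_mod_cast hab'
  rw [approxVariance, messageExponent, messageExponent, hrate]
  simp only [communityRate, Bool.false_eq_true, if_false]
  have hδ0 : 0 ≤ a / b - 1 := by linarith
  set δ := a / b - 1
  set W1 := ∫ r, posteriorWeight r ∂messageLaw κ α a b t true
  set V1 := ∫ r, posteriorWeight r ^ 2 ∂messageLaw κ α a b t true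
  set c := cueChar (a / b) θ
  set J1 := ∫ r, jumpChar (a / b) θ r ∂messageLaw κ α a b t true
  set J0 := ∫ r, jumpChar (a / b) θ r ∂messageLaw κ α a b t false
  set C := taylorBound θ with hC
  have hC0 : 0 ≤ C := taylorBound_nonneg θ
  have hα' : 0 ≤ 1 - α := by linarith
  have hcoef : ‖(Complex.I * θ + θ ^ 2 : ℂ) / 2‖ ≤ |θ| + θ ^ 2 := by
    rw [norm_div, Complex.norm_ofNat]
    have : ‖(Complex.I * θ + θ ^ 2 : ℂ)‖ ≤ |θ| + θ ^ 2 := by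
      refine (norm_add_le _ _).trans_eq ?_
      rw [norm_mul, Complex.norm_I, one_mul, norm_pow, Complex.norm_real, Real.norm_eq_abs, sq_abs]
    linarith [abs_nonneg θ, sq_nonneg θ]
  have hcube : δ ^ 3 ≤ δ ^ 2 := by nlinarith [sq_nonneg δ]
  have hec : ‖c - Complex.I * θ * (δ : ℝ)‖ ≤ (C + (|θ| + θ ^ 2)) * δ ^ 2 := by
    calc _ = ‖(c - (Complex.I * θ * (δ : ℝ) - (Complex.I * θ + θ ^ 2) / 2 * (δ : ℝ) ^ 2)) -
          (Complex.I * θ + θ ^ 2) / 2 * ((δ ^ 2 : ℝ) : ℂ)‖ := by push_cast; ring_nf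
      _ ≤ C * δ ^ 3 + (|θ| + θ ^ 2) * δ ^ 2 := by
          refine (norm_sub_le _ _).trans (add_le_add hc ?_)
          rw [norm_mul, Complex.norm_of_nonneg (sq_nonneg δ)]
          gcongr
      _ ≤ _ := by nlinarith
  have he1 : ‖J1 - Complex.I * θ * (δ : ℝ) * W1‖ ≤ (C + (|θ| + θ ^ 2)) * δ ^ 2 := by
    calc _ = ‖(J1 - (Complex.I * θ * (δ : ℝ) * W1 -
            (Complex.I * θ + θ ^ 2) / 2 * (δ : ℝ) ^ 2 * V1)) -
          (Complex.I * θ + θ ^ 2) / 2 * ((δ ^ 2 : ℝ) : ℂ) * V1‖ := by push_cast; ring_nf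
      _ ≤ C * δ ^ 3 + (|θ| + θ ^ 2) * δ ^ 2 * 1 := by
          refine (norm_sub_le _ _).trans (add_le_add h1 ?_)
          rw [norm_mul, norm_mul, Complex.norm_of_nonneg (sq_nonneg δ), Complex.norm_real,
            Real.norm_eq_abs]
          gcongr
      _ ≤ _ := by nlinarith
  set B := (C + (|θ| + θ ^ 2)) * δ ^ 2
  have key : (b * (δ : ℝ) + b) * (κ * α) * c + (b * (δ : ℝ) + b) * (κ * (1 - α)) * J1 +
      b * (1 - κ) * J0 - (b * (κ * α) * c + b * (κ * (1 - α)) * J1 + b * (1 - κ) * J0) -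
      Complex.I * θ * ((b * δ ^ 2 * (κ * (α + (1 - α) * W1)) : ℝ) : ℂ) =
      ((b * δ * (κ * α) : ℝ) : ℂ) * (c - Complex.I * θ * (δ : ℝ)) +
      ((b * δ * (κ * (1 - α)) : ℝ) : ℂ) * (J1 - Complex.I * θ * (δ : ℝ) * W1) := by
    push_cast
    ring
  rw [key]
  refine (norm_add_le _ _).trans ?_
  rw [norm_mul (Complex.ofReal _), norm_mul (Complex.ofReal _),
    Complex.norm_of_nonneg (by positivity), Complex.norm_of_nonneg (by positivity)]
  have hB : 0 ≤ B := by positivity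
  calc _ ≤ b * δ * (κ * α) * B + b * δ * (κ * (1 - α)) * B := by gcongr
    _ = κ * (b * δ * B) := by ring
    _ ≤ 1 * (b * δ * B) := by gcongr
    _ = _ := by simp only [B]; ring

end exponent
end

/-! ### The Gaussian limit for large degrees. -/

noncomputable section
open scoped Classical

/-- Lévy's theorem is sequential; for a countably generated filter, sequences decide convergence. -/
lemma tendsto_probabilityMeasure_of_charFun {ι : Type*} {L : Filter ι} [L.IsCountablyGenerated]
    {ν : ι → ProbabilityMeasure ℝ} {ν' : ProbabilityMeasure ℝ}
    (h : ∀ θ : ℝ, Tendsto (fun i => charFun (ν i : Measure ℝ) θ) L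
      (𝓝 (charFun (ν' : Measure ℝ) θ))) : Tendsto ν L (𝓝 ν') :=
  tendsto_of_seq_tendsto fun _ hx =>
    ProbabilityMeasure.tendsto_of_tendsto_charFun fun θ => (h θ).comp hx

/-- The value of `b (a / b - 1) ^ 2` at effective signal-to-noise ratio `lam`. -/
def signalScale (κ α lam : ℝ) : ℝ := lam * (1 - κ) / (κ ^ 2 * (1 - α) ^ 2)

variable {κ α lam : ℝ}

instance : (largeDegreeRegime κ α lam).IsCountablyGenerated := by
  unfold largeDegreeRegime; infer_instance

lemma eventually_largeDegreeRegime (hκ0 : 0 < κ) (hκ1 : κ < 1) (hα1 : α < 1) :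
    ∀ᶠ ab in largeDegreeRegime κ α lam, 0 < ab.2 ∧ ab.2 < ab.1 ∧
      ab.2 * (ab.1 / ab.2 - 1) ^ 2 = signalScale κ α lam := by
  have h1 : ∀ᶠ ab : ℝ × ℝ in largeDegreeRegime κ α lam, 0 < ab.2 :=
    (tendsto_snd.eventually (eventually_gt_atTop 0)).filter_mono inf_le_left
  have h2 : ∀ᶠ ab : ℝ × ℝ in largeDegreeRegime κ α lam,
      ab.2 < ab.1 ∧ effectiveSNR κ α ab.1 ab.2 = lam :=
    (eventually_principal.2 fun _ h => h).filter_mono inf_le_right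
  filter_upwards [h1, h2] with ⟨a, b⟩ hb ⟨hab, hs⟩
  refine ⟨hb, hab, ?_⟩
  have h3 : 1 - κ ≠ 0 := by linarith
  have h4 : 1 - α ≠ 0 := by linarith
  simp only at *
  rw [signalScale, ← hs, effectiveSNR]
  field_simp

/-- Since `b (a / b - 1)²` is held fixed, `a / b - 1` is of order `b^{-1/2}`. -/
lemma tendsto_ratio_largeDegreeRegime (hκ0 : 0 < κ) (hκ1 : κ < 1) (hα1 : α < 1) :
    Tendsto (fun ab : ℝ × ℝ => ab.1 / ab.2 - 1) (largeDegreeRegime κ α lam) (𝓝 0) := by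
  have hb : Tendsto (fun ab : ℝ × ℝ => ab.2) (largeDegreeRegime κ α lam) atTop :=
    tendsto_snd.mono_left inf_le_left
  have h : Tendsto (fun ab : ℝ × ℝ => √(signalScale κ α lam / ab.2))
      (largeDegreeRegime κ α lam) (𝓝 0) := by
    simpa using (hb.const_div_atTop (signalScale κ α lam)).sqrt
  refine h.congr' ?_
  filter_upwards [eventually_largeDegreeRegime hκ0 hκ1 hα1] with ⟨a, b⟩ ⟨hb, hab, hs⟩
  simp only at *
  have h1 : 0 ≤ a / b - 1 := by
    rw [sub_nonneg, le_div_iff₀ hb]; linarith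
  rw [← hs, mul_div_cancel_left₀ _ hb.ne', Real.sqrt_sq h1]

lemma integral_gaussianReal_eq (m : ℝ) {v : ℝ} (hv : 0 ≤ v) {f : ℝ → ℝ} (hf : Continuous f) :
    ∫ r, f r ∂gaussianReal m v.toNNReal = ∫ z, f (m + √v * z) ∂gaussianReal 0 1 := by
  have h : gaussianReal m v.toNNReal = (gaussianReal 0 1).map fun z => m + √v * z := by
    have e : (fun z => m + √v * z) = (m + ·) ∘ (√v * ·) := rfl
    rw [e, ← Measure.map_map (by fun_prop) (by fun_prop), gaussianReal_map_const_mul,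
      gaussianReal_map_const_add]
    congr 1
    · simp
    · ext; simp [Real.sq_sqrt hv, hv]
  rw [h, integral_map (by fun_prop) hf.aestronglyMeasurable]

lemma posteriorWeight_shift (hκ0 : 0 < κ) (hκ1 : κ < 1) (hα1 : α < 1) (y : ℝ) :
    posteriorWeight (-limitLogOdds κ α + y) =
      κ * (1 - α) / (κ * (1 - α) + (1 - κ) * Real.exp (-y)) := by
  have h := exp_neg_limitLogOdds hκ0 hκ1 hα1
  have h1 : 0 < 1 - κ := by linarith
  have h2 : 0 < 1 - α := by linarith
  rw [posteriorWeight, Real.exp_add, Real.exp_neg y, ← h]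
  have := Real.exp_pos (-limitLogOdds κ α)
  have := Real.exp_pos y
  field_simp

/-- The integrand of the recursion is, up to a constant, the posterior weight under the Gaussian law
of label 1; this matches the limit of `approxVariance`. -/
lemma messageVariance_succ_eq (hκ0 : 0 < κ) (hκ1 : κ < 1) (hα0 : 0 < α) (hα1 : α < 1)
    (hlam : 0 < lam) (t : ℕ) :
    messageVariance κ α lam (t + 1) = signalScale κ α lam * (κ * (α + (1 - α) *
      ∫ r, posteriorWeight r ∂(gaussianLaw (-limitLogOdds κ α + messageVariance κ α lam t / 2)
        (messageVariance κ α lam t) : Measure ℝ))) := by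
  have hv := messageVariance_nonneg hκ0 hκ1 hα0 hα1 hlam t
  have h1 : 0 < 1 - κ := by linarith
  have h2 : 0 < 1 - α := by linarith
  rw [messageVariance]
  set v := messageVariance κ α lam t
  change _ = _ * (κ * (α + (1 - α) * ∫ r, posteriorWeight r
    ∂gaussianReal (-limitLogOdds κ α + v / 2) v.toNNReal))
  rw [integral_gaussianReal_eq _ hv continuous_posteriorWeight]
  have e : ∀ z, posteriorWeight (-limitLogOdds κ α + v / 2 + √v * z) =
      κ * (1 - α) / (1 - κ) *
        ((1 - κ) / (κ * (1 - α) + (1 - κ) * Real.exp (-v / 2 - √v * z))) := fun z => by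
    rw [add_assoc, posteriorWeight_shift hκ0 hκ1 hα1,
      show -(v / 2 + √v * z) = -v / 2 - √v * z by ring]
    have : 0 < κ * (1 - α) + (1 - κ) * Real.exp (-v / 2 - √v * z) := by positivity
    field_simp
  simp_rw [e]
  rw [integral_const_mul, signalScale]
  field_simp

/-- `posteriorWeight` as a bounded continuous function. -/
def posteriorWeightBCF : ℝ →ᵇ ℝ :=
  BoundedContinuousFunction.ofNormedAddCommGroup posteriorWeight continuous_posteriorWeight 1
    fun r => by
      rw [Real.norm_eq_abs, abs_of_nonneg (posteriorWeight_mem r).1]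
      exact (posteriorWeight_mem r).2

/-- The message law as a probability measure. -/
def messageProb (κ α : ℝ) (x : Bool) (t : ℕ) (a b : ℝ) : ProbabilityMeasure ℝ :=
  ⟨messageLaw κ α a b t x, inferInstance⟩

lemma tendsto_approxVariance (hκ0 : 0 < κ) (hκ1 : κ < 1) (hα0 : 0 < α) (hα1 : α < 1)
    (hlam : 0 < lam) (t : ℕ)
    (h : Tendsto (fun ab : ℝ × ℝ => messageProb κ α true t ab.1 ab.2) (largeDegreeRegime κ α lam)
      (𝓝 (gaussianLaw (-limitLogOdds κ α + messageVariance κ α lam t / 2)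
        (messageVariance κ α lam t)))) :
    Tendsto (fun ab : ℝ × ℝ => approxVariance κ α ab.1 ab.2 t) (largeDegreeRegime κ α lam)
      (𝓝 (messageVariance κ α lam (t + 1))) := by
  rw [messageVariance_succ_eq hκ0 hκ1 hα0 hα1 hlam]
  have h1 := ProbabilityMeasure.tendsto_iff_forall_integral_tendsto.1 h posteriorWeightBCF
  refine ((((h1.const_mul (1 - α)).const_add α).const_mul κ).const_mul
    (signalScale κ α lam)).congr' ?_
  filter_upwards [eventually_largeDegreeRegime hκ0 hκ1 hα1] with ab ⟨_, _, hs⟩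
  rw [approxVariance, hs]
  rfl

lemma tendsto_messageExponent (hκ0 : 0 < κ) (hκ1 : κ < 1) (hα0 : 0 < α) (hα1 : α < 1)
    (t : ℕ) {v : ℝ}
    (h : Tendsto (fun ab : ℝ × ℝ => approxVariance κ α ab.1 ab.2 t) (largeDegreeRegime κ α lam)
      (𝓝 v)) (θ : ℝ) :
    Tendsto (fun ab : ℝ × ℝ => messageExponent κ α ab.1 ab.2 t false θ -
        Complex.I * θ * (κ * (ab.1 - ab.2) : ℝ)) (largeDegreeRegime κ α lam)
      (𝓝 (-((Complex.I * θ + θ ^ 2) / 2 * v))) ∧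
    Tendsto (fun ab : ℝ × ℝ => messageExponent κ α ab.1 ab.2 t true θ -
        Complex.I * θ * (κ * (ab.1 - ab.2) : ℝ)) (largeDegreeRegime κ α lam)
      (𝓝 (-((Complex.I * θ + θ ^ 2) / 2 * v) + Complex.I * θ * v)) := by
  have hδ := tendsto_ratio_largeDegreeRegime (lam := lam) hκ0 hκ1 hα1
  have hδ' := hδ.eventually_le_const (show (0 : ℝ) < 1 / 2 by norm_num)
  have hev := eventually_largeDegreeRegime (lam := lam) hκ0 hκ1 hα1
  have hvC : Tendsto (fun ab : ℝ × ℝ => (approxVariance κ α ab.1 ab.2 t : ℂ))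
      (largeDegreeRegime κ α lam) (𝓝 (v : ℂ)) := (Complex.continuous_ofReal.tendsto v).comp h
  have z1 : Tendsto (fun ab : ℝ × ℝ => messageExponent κ α ab.1 ab.2 t false θ -
      (Complex.I * θ * (κ * (ab.1 - ab.2) : ℝ) -
        (Complex.I * θ + θ ^ 2) / 2 * approxVariance κ α ab.1 ab.2 t))
      (largeDegreeRegime κ α lam) (𝓝 0) := by
    refine squeeze_zero_norm' (a := fun ab : ℝ × ℝ =>
      taylorBound θ * signalScale κ α lam * (ab.1 / ab.2 - 1)) ?_ (by simpa using hδ.const_mul _)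
    filter_upwards [hev, hδ'] with ab ⟨hb, hab, hs⟩ hd
    have := norm_messageExponent_false_sub_le hκ0 hκ1 hα0 hα1 hb hab hd t θ
    rwa [hs] at this
  have z2 : Tendsto (fun ab : ℝ × ℝ => messageExponent κ α ab.1 ab.2 t true θ -
      messageExponent κ α ab.1 ab.2 t false θ -
        Complex.I * θ * approxVariance κ α ab.1 ab.2 t)
      (largeDegreeRegime κ α lam) (𝓝 0) := by
    refine squeeze_zero_norm' (a := fun ab : ℝ × ℝ =>
      (taylorBound θ + (|θ| + θ ^ 2)) * signalScale κ α lam * (ab.1 / ab.2 - 1)) ?_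
      (by simpa using hδ.const_mul _)
    filter_upwards [hev, hδ'] with ab ⟨hb, hab, hs⟩ hd
    have := norm_messageExponent_true_sub_false_le hκ0 hκ1 hα0 hα1 hb hab hd t θ
    rwa [hs] at this
  have f1 := z1.sub (hvC.const_mul ((Complex.I * θ + θ ^ 2) / 2))
  have f2 := (f1.add z2).add (hvC.const_mul (Complex.I * θ))
  simp only [zero_sub, add_zero] at f1 f2
  exact ⟨f1.congr fun ab => by ring, f2.congr fun ab => by ring⟩

lemma tendsto_messageProb_succ (hκ0 : 0 < κ) (hκ1 : κ < 1) (hα0 : 0 < α) (hα1 : α < 1)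
    (t : ℕ) (x : Bool) {v m : ℝ} (hv : 0 ≤ v)
    (h : ∀ θ : ℝ, Tendsto (fun ab : ℝ × ℝ => messageExponent κ α ab.1 ab.2 t x θ -
        Complex.I * θ * (κ * (ab.1 - ab.2) : ℝ)) (largeDegreeRegime κ α lam)
      (𝓝 (Complex.I * θ * m - θ ^ 2 / 2 * v))) :
    Tendsto (fun ab : ℝ × ℝ => messageProb κ α x (t + 1) ab.1 ab.2) (largeDegreeRegime κ α lam)
      (𝓝 (gaussianLaw (-limitLogOdds κ α + m) v)) := by
  refine tendsto_probabilityMeasure_of_charFun fun θ => ?_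
  change Tendsto (fun ab : ℝ × ℝ => charFun (messageLaw κ α ab.1 ab.2 (t + 1) x) θ) _
    (𝓝 (charFun (gaussianReal (-limitLogOdds κ α + m) v.toNNReal) θ))
  have hl : charFun (gaussianReal (-limitLogOdds κ α + m) v.toNNReal) θ =
      Complex.exp (θ * (-limitLogOdds κ α : ℝ) * Complex.I +
        (Complex.I * θ * m - θ ^ 2 / 2 * v)) := by
    have hvn : ((v.toNNReal : ℝ) : ℂ) = v := by rw [Real.coe_toNNReal v hv]
    rw [charFun_gaussianReal]
    congr 1
    rw [hvn]
    push_cast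
    ring
  rw [hl]
  refine (((h θ).const_add _).cexp).congr' ?_
  filter_upwards [eventually_largeDegreeRegime hκ0 hκ1 hα1] with ab ⟨hb, hab, _⟩
  rw [charFun_messageLaw_succ hκ0 hκ1 hα0 hα1 hb hab, ← Complex.exp_add]
  congr 1
  push_cast
  ring

/-- Only the label-1 law is needed at level `t`, because the posterior identity has removed the
label-0 law from the variance. -/
lemma tendsto_messageProb_of_true (hκ0 : 0 < κ) (hκ1 : κ < 1) (hα0 : 0 < α) (hα1 : α < 1)
    (hlam : 0 < lam) (t : ℕ)
    (h : Tendsto (fun ab : ℝ × ℝ => messageProb κ α true t ab.1 ab.2) (largeDegreeRegime κ α lam)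
      (𝓝 (gaussianLaw (-limitLogOdds κ α + messageVariance κ α lam t / 2)
        (messageVariance κ α lam t)))) :
    Tendsto (fun ab : ℝ × ℝ => messageProb κ α false (t + 1) ab.1 ab.2)
      (largeDegreeRegime κ α lam)
      (𝓝 (gaussianLaw (-limitLogOdds κ α - messageVariance κ α lam (t + 1) / 2)
        (messageVariance κ α lam (t + 1)))) ∧
    Tendsto (fun ab : ℝ × ℝ => messageProb κ α true (t + 1) ab.1 ab.2)
      (largeDegreeRegime κ α lam)
      (𝓝 (gaussianLaw (-limitLogOdds κ α + messageVariance κ α lam (t + 1) / 2)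
        (messageVariance κ α lam (t + 1)))) := by
  have hv := messageVariance_nonneg hκ0 hκ1 hα0 hα1 hlam (t + 1)
  have hexp := tendsto_messageExponent hκ0 hκ1 hα0 hα1 t
    (tendsto_approxVariance hκ0 hκ1 hα0 hα1 hlam t h)
  rw [sub_eq_add_neg (-limitLogOdds κ α)]
  refine ⟨tendsto_messageProb_succ hκ0 hκ1 hα0 hα1 t false hv fun θ => ?_,
    tendsto_messageProb_succ hκ0 hκ1 hα0 hα1 t true hv fun θ => ?_⟩
  · convert (hexp θ).1 using 2
    push_cast
    ring
  · convert (hexp θ).2 using 2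
    push_cast
    ring

lemma tendsto_messageProb_true (hκ0 : 0 < κ) (hκ1 : κ < 1) (hα0 : 0 < α) (hα1 : α < 1)
    (hlam : 0 < lam) (t : ℕ) :
    Tendsto (fun ab : ℝ × ℝ => messageProb κ α true t ab.1 ab.2) (largeDegreeRegime κ α lam)
      (𝓝 (gaussianLaw (-limitLogOdds κ α + messageVariance κ α lam t / 2)
        (messageVariance κ α lam t))) := by
  induction t with
  | zero =>
    -- The initial law is a point mass, that is, the Gaussian of variance `0`, for every `a` and
    -- `b`.
    refine tendsto_const_nhds.congr fun ab => Subtype.ext ?_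
    simp [gaussianLaw, messageProb, messageVariance, messageLaw, gaussianReal_zero_var]
  | succ t ih => exact (tendsto_messageProb_of_true hκ0 hκ1 hα0 hα1 hlam t ih).2

end

theorem mainTheorem3 (κ α lam : ℝ) (hκ0 : 0 < κ) (hκ1 : κ < 1) (hα0 : 0 < α) (hα1 : α < 1)
    (hlam : 0 < lam) :
    ∃ ξ : Bool → ℕ → ℝ → ℝ → ProbabilityMeasure ℝ,
      (∀ x t a b, 0 < b → b < a → IsLimitingMessageLaw κ α a b x t (ξ x t a b)) ∧
      ∀ t : ℕ,
        Tendsto (fun ab : ℝ × ℝ => ξ false (t + 1) ab.1 ab.2) (largeDegreeRegime κ α lam)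
          (𝓝 (gaussianLaw
            (-Real.log ((1 - κ) / (κ * (1 - α))) - messageVariance κ α lam (t + 1) / 2)
            (messageVariance κ α lam (t + 1)))) ∧
        Tendsto (fun ab : ℝ × ℝ => ξ true (t + 1) ab.1 ab.2) (largeDegreeRegime κ α lam)
          (𝓝 (gaussianLaw
            (-Real.log ((1 - κ) / (κ * (1 - α))) + messageVariance κ α lam (t + 1) / 2)
            (messageVariance κ α lam (t + 1)))) :=
  ⟨messageProb κ α,
    fun x t _ _ hb hab => isLimitingMessageLaw_messageLaw hκ0 hκ1 hα0 hα1 hb hab t x,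
    fun t => tendsto_messageProb_of_true hκ0 hκ1 hα0 hα1 hlam t
      (tendsto_messageProb_true hκ0 hκ1 hα0 hα1 hlam t)⟩
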